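/- Let $p$ be a prime. Let $G$ be a pro-$p$ group of finite $p$-rank $d=\dim_{\mathbb F_p}H^1(G,\mathbb F_p)$, let $F$ be a free pro-$p$ group on $x_1,\dots,x_d$, and let $1\to R\to F\xrightarrow{\pi} G\to 1$ be a (minimal) presentation of $G$. For a pro-$p$ group $H$ write $\Lambda_H=\mathbb F_p[[H]]=\varprojlim_U \mathbb F_p[H/U]$ for the completed group algebra, and let $R^p[R,R]$ denote the closed subgroup of $R$ generated by $p$-th powers and commutators; $R/R^p[R,R]$ is a compact $\Lambda_G$-module, $G$ acting by conjugation. Let $E=\mathbb F_p^{nc}[[X_1,\dots,X_d]]$ be the algebra of noncommutative power series, let $\omega(Z)$ be the least degree of a monomial occurring in $Z\in E$ (with $\omega(0)=\infty$), put $E_n=\{Z\in E:\omega(Z)\ge n\}$, and let $\varphi:\Lambda_F\to E$ be the Magnus isomorphism, $x_i\mapsto 1+X_i$. Order monomials by: $X_\alpha>X_\beta$ if $\deg X_\alpha<\deg X_\beta$, or if the degrees are equal and $\alpha$ is larger than $\beta$ in the lexicographic order with $X_1<\dots<X_d$. For $1\ne y\in F$ let $\deg(y)=\omega(\varphi(y-1))$,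 and let the highest term $\widehat y$ be the largest monomial occurring in $\varphi(y-1)$. A family $(m_i)_{i\in I}$ of monomials is combinatorially free if (i) for $i\neq j$, $m_i$ is not a submonomial (a factor of consecutive letters) of $m_j$, and (ii) for all $i,j\in I$, including $i=j$, whenever $m_i=uv$ and $m_j=u'v'$ with $u,v,u',v'$ monomials different from $1$, one has $u\neq v'$. Let $(\rho_i)_{i\in I}$ be a family of elements $\neq1$ of $R$, with $I$ possibly infinite, whose classes topologically generate the $\Lambda_G$-module $R/R^p[R,R]$. If the family $(\widehat{\rho_i})_{i\in I}$ is combinatorially free, then: (i) $R/R^p[R,R]\simeq\prod_{i\in I}\Lambda_G$ as topological $\Lambda_G$-modules, and $\mathrm{cd}(G)\le 2$, that is, $H^n(G,\mathbb F_p)=0$ for all $n\geq 3$; (ii) with $n_i=\deg(\rho_i)$, only finitely many $n_i$ take any given value, and $$P_G(t):=\sum_{n\ge0}\dim_{\mathbb F_p}(E_{G,n}/E_{G,n+1})\,t^n=\Big(1-dt+\sum_{i\in I}t^{n_i}\Big)^{-1}$$ in $\mathbb Z[[t]]$, where $E_{G,n}\subseteq\Lambda_G$ is the image of $\varphi^{-1}(E_n)$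 under the map $\Lambda_F\to\Lambda_G$ induced by $\pi$, and all the dimensions are finite. -/

import Mathlib

noncomputable section

/-! ### Noncommutative formal power series over `𝔽_p` -/

/-- The Magnus algebra `E = 𝔽_p^{nc}⟦X_1, …, X_d⟧`. The word `[α_1, …, α_n]` stands for the
monomial `X_{α_1} ⋯ X_{α_n}`, and a series is the function giving its coefficients. -/
def MagnusAlgebra (p d : ℕ) : Type := List (Fin d) → ZMod p

namespace MagnusAlgebra

variable {p d : ℕ}

instance : AddCommGroup (MagnusAlgebra p d) := inferInstanceAs (AddCommGroup (_ → ZMod p))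

instance : Module (ZMod p) (MagnusAlgebra p d) := inferInstanceAs (Module (ZMod p) (_ → ZMod p))

/-- The topology of coefficientwise convergence, `𝔽_p` being discrete. -/
instance : TopologicalSpace (MagnusAlgebra p d) := inferInstanceAs (TopologicalSpace (_ → ZMod p))

@[ext] theorem ext {a b : MagnusAlgebra p d} (h : ∀ w, a w = b w) : a = b := funext h

@[simp] theorem add_apply (a b : MagnusAlgebra p d) (w) : (a + b) w = a w + b w := rfl
@[simp] theorem sub_apply (a b : MagnusAlgebra p d) (w) : (a - b) w = a w - b w := rfl
@[simp] theorem neg_apply (a : MagnusAlgebra p d) (w) : (-a) w = -a w := rfl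
@[simp] theorem zero_apply (w) : (0 : MagnusAlgebra p d) w = 0 := rfl
@[simp] theorem smul_apply (r : ZMod p) (a : MagnusAlgebra p d) (w) : (r • a) w = r * a w := rfl

/-- The monomial `X_w` attached to a word `w`. -/
def monomial (w : List (Fin d)) : MagnusAlgebra p d := fun v => if v = w then 1 else 0

/-- The variable `X_i`. -/
def X (i : Fin d) : MagnusAlgebra p d := monomial [i]

instance : One (MagnusAlgebra p d) := ⟨monomial []⟩

/-- The product of series: the coefficient at `w` is the sum of `a_u b_v` over all the
factorizations `w = u v`. -/
instance : Mul (MagnusAlgebra p d) :=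
  ⟨fun a b w => ∑ k ∈ Finset.range (w.length + 1), a (w.take k) * b (w.drop k)⟩

theorem one_apply (w : List (Fin d)) : (1 : MagnusAlgebra p d) w = if w = [] then 1 else 0 := rfl

theorem mul_apply (a b : MagnusAlgebra p d) (w) :
    (a * b) w = ∑ k ∈ Finset.range (w.length + 1), a (w.take k) * b (w.drop k) := rfl

protected theorem mul_assoc (a b c : MagnusAlgebra p d) : a * b * c = a * (b * c) := by
  ext w
  simp only [mul_apply, Finset.sum_mul, Finset.mul_sum]
  rw [Finset.sum_sigma', Finset.sum_sigma']
  refine Finset.sum_bij' (fun s _ => ⟨s.2, s.1 - s.2⟩) (fun s _ => ⟨s.1 + s.2, s.1⟩) ?_ ?_ ?_ ?_ ?_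
  · rintro ⟨i, j⟩ h
    simp at h ⊢; omega
  · rintro ⟨i, j⟩ h
    simp at h ⊢; omega
  · rintro ⟨i, j⟩ h
    simp at h ⊢; omega
  · rintro ⟨i, j⟩ h
    simp at h ⊢
  · rintro ⟨i, j⟩ h
    simp at h
    simp only [List.take_take, List.drop_drop, List.drop_take]
    rw [min_eq_left (by omega), Nat.add_sub_cancel' (by omega), mul_assoc]

protected theorem one_mul (a : MagnusAlgebra p d) : 1 * a = a := by
  ext w
  rw [mul_apply, Finset.sum_eq_single 0]
  · simp [one_apply]
  · intro k hk h0
    have : w.take k ≠ [] := by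
      intro h; simp at h hk; rcases h with h | h
      · exact h0 h
      · subst h; simp at hk; exact h0 hk
    simp [one_apply, this]
  · simp

protected theorem mul_one (a : MagnusAlgebra p d) : a * 1 = a := by
  ext w
  rw [mul_apply, Finset.sum_eq_single w.length]
  · simp [one_apply]
  · intro k hk h0
    have : w.drop k ≠ [] := by
      intro h; simp at h hk; omega
    simp [one_apply, this]
  · simp

instance : Ring (MagnusAlgebra p d) where
  __ := (inferInstance : AddCommGroup (MagnusAlgebra p d))
  mul_assoc := MagnusAlgebra.mul_assoc
  one_mul := MagnusAlgebra.one_mul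
  mul_one := MagnusAlgebra.mul_one
  left_distrib a b c := by ext w; simp [mul_apply, mul_add, Finset.sum_add_distrib]
  right_distrib a b c := by ext w; simp [mul_apply, add_mul, Finset.sum_add_distrib]
  zero_mul a := by ext w; simp [mul_apply]
  mul_zero a := by ext w; simp [mul_apply]

instance : Algebra (ZMod p) (MagnusAlgebra p d) :=
  Algebra.ofModule
    (fun r a b => by ext w; simp [mul_apply, Finset.mul_sum, mul_assoc])
    (fun r a b => by ext w; simp [mul_apply, Finset.mul_sum, mul_left_comm])

/-- The valuation `ω(Z)`: the least degree of a monomial occurring in `Z`, with `ω(0) = ∞`. -/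
def valuation (Z : MagnusAlgebra p d) : ℕ∞ := ⨅ (w : List (Fin d)) (_ : Z w ≠ 0), (w.length : ℕ∞)

theorem le_valuation_iff {Z : MagnusAlgebra p d} {n : ℕ} :
    (n : ℕ∞) ≤ Z.valuation ↔ ∀ w, w.length < n → Z w = 0 := by
  simp only [valuation, le_iInf_iff, Nat.cast_le]
  exact forall_congr' fun w => ⟨fun h hw => by by_contra h0; exact absurd (h h0) (by omega),
    fun h h0 => by by_contra hw; exact h0 (h (by omega))⟩

/-- The filtration `E_n = {Z | ω(Z) ≥ n}`. -/
def filtration (p d n : ℕ) : Submodule (ZMod p) (MagnusAlgebra p d) where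
  carrier := {Z | (n : ℕ∞) ≤ Z.valuation}
  add_mem' {a b} ha hb := by
    simp only [Set.mem_ofPred_eq, le_valuation_iff] at *
    intro w hw; simp [ha w hw, hb w hw]
  zero_mem' := by simp [le_valuation_iff]
  smul_mem' r a ha := by
    simp only [Set.mem_ofPred_eq, le_valuation_iff] at *
    intro w hw; simp [ha w hw]

/-- The total order on monomials: `X_v ≤ X_w` if `X_v` has larger degree than `X_w`, or if both
have the same degree and `v` is at most `w` lexicographically, where `X_1 < ⋯ < X_d`. -/
def MonomialLE (v w : List (Fin d)) : Prop :=
  w.length < v.length ∨ (v.length = w.length ∧ v ≤ w)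

/-- `X_w` is the highest term of `Z`. -/
def IsHighestTerm (Z : MagnusAlgebra p d) (w : List (Fin d)) : Prop :=
  Z w ≠ 0 ∧ ∀ v, Z v ≠ 0 → MonomialLE v w

/-! The finite quotient algebras `E / E_n`. -/

/-- Congruence modulo `E_n`. -/
def truncCon (p d n : ℕ) : RingCon (MagnusAlgebra p d) where
  r a b := ∀ w, w.length < n → a w = b w
  iseqv := ⟨fun _ _ _ => rfl, fun h w hw => (h w hw).symm,
    fun h h' w hw => (h w hw).trans (h' w hw)⟩
  add' h h' w hw := by simp [h w hw, h' w hw]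
  mul' h h' w hw := by
    simp only [mul_apply]
    refine Finset.sum_congr rfl fun k _ => ?_
    rw [h _ (by simp; omega), h' _ (by simp; omega)]

/-- The quotient algebra `E / E_n`. -/
abbrev Trunc (p d n : ℕ) : Type := (truncCon p d n).Quotient

/-- The projection `E → E / E_n`. -/
def toTrunc (p d n : ℕ) : MagnusAlgebra p d →+* Trunc p d n := (truncCon p d n).mk'

theorem toTrunc_eq_iff {n : ℕ} {a b : MagnusAlgebra p d} :
    toTrunc p d n a = toTrunc p d n b ↔ ∀ w, w.length < n → a w = b w :=
  (truncCon p d n).eq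

theorem toTrunc_surjective (n : ℕ) : Function.Surjective (toTrunc p d n) :=
  (truncCon p d n).mk'_surjective

/-- The coefficient of a word of length `< n`, on `E / E_n`. -/
def truncCoeff (n : ℕ) (w : List (Fin d)) (hw : w.length < n) : Trunc p d n →ₗ[ZMod p] ZMod p where
  toFun q := Quotient.liftOn q (fun a => a w) fun _ _ h => h w hw
  map_add' a b := by
    obtain ⟨a, rfl⟩ := toTrunc_surjective n a
    obtain ⟨b, rfl⟩ := toTrunc_surjective n b
    rfl
  map_smul' r a := by
    obtain ⟨a, rfl⟩ := toTrunc_surjective n a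
    rfl

@[simp] theorem truncCoeff_toTrunc (n : ℕ) (w : List (Fin d)) (hw : w.length < n)
    (a : MagnusAlgebra p d) : truncCoeff n w hw (toTrunc p d n a) = a w := rfl

instance [Fact p.Prime] (n : ℕ) : Finite (Trunc p d n) := by
  have : Finite {w : List (Fin d) // w.length < n} := List.finite_length_lt (Fin d) n
  refine Finite.of_injective
    (fun q : Trunc p d n => fun w : {w : List (Fin d) // w.length < n} => truncCoeff n w.1 w.2 q) ?_
  intro a b h
  obtain ⟨a, rfl⟩ := toTrunc_surjective n a
  obtain ⟨b, rfl⟩ := toTrunc_surjective n b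
  exact toTrunc_eq_iff.2 fun w hw => congrFun h ⟨w, hw⟩

theorem pow_apply_eq_zero {y : MagnusAlgebra p d} (hy : y [] = 0) (m : ℕ) :
    ∀ w : List (Fin d), w.length < m → (y ^ m) w = 0 := by
  induction m with
  | zero => simp
  | succ m ih =>
    intro w hw
    rw [pow_succ, mul_apply]
    refine Finset.sum_eq_zero fun k hk => ?_
    simp at hk
    by_cases h : (w.take k).length < m
    · rw [ih _ h, zero_mul]
    · have : w.drop k = [] := by simp at h ⊢; omega
      rw [this, hy, mul_zero]

theorem mul_nil (a b : MagnusAlgebra p d) : (a * b) [] = a [] * b [] := by simp [mul_apply]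

theorem pow_nil {a : MagnusAlgebra p d} (ha : a [] = 1) (m : ℕ) : (a ^ m) [] = 1 := by
  induction m with
  | zero => simp [one_apply]
  | succ m ih => rw [pow_succ, mul_nil, ih, ha, one_mul]

variable [hp : Fact p.Prime]

instance : CharP (MagnusAlgebra p d) p := by
  have : Nontrivial (MagnusAlgebra p d) :=
    ⟨1, 0, fun h => by simpa [one_apply] using congrFun h []⟩
  exact charP_of_injective_algebraMap (algebraMap (ZMod p) (MagnusAlgebra p d)).injective p

theorem toTrunc_pow_eq_one {a : MagnusAlgebra p d} (ha : a [] = 1) (n : ℕ) :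
    toTrunc p d n a ^ p ^ n = 1 := by
  have h : a ^ p ^ n = 1 + (a - 1) ^ p ^ n := by
    conv_lhs => rw [← add_sub_cancel 1 a]
    rw [add_pow_char_pow_of_commute p n (Commute.one_left _), one_pow]
  rw [← map_pow, ← map_one (toTrunc p d n), toTrunc_eq_iff, h]
  intro w hw
  rw [add_apply, pow_apply_eq_zero (by simp [ha, one_apply]) (p ^ n) w
    (hw.trans (Nat.lt_pow_self hp.out.one_lt)), add_zero]

/-- The group of units of `E / E_n` with constant coefficient `1`. -/
def oneUnits (p d n : ℕ) [hp : Fact p.Prime] : Subgroup (Trunc p d n)ˣ where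
  carrier := {u | ∃ a : MagnusAlgebra p d, a [] = 1 ∧ toTrunc p d n a = u}
  mul_mem' := by
    rintro u v ⟨a, ha, hu⟩ ⟨b, hb, hv⟩
    exact ⟨a * b, by rw [mul_nil, ha, hb, one_mul], by rw [map_mul, hu, hv, Units.val_mul]⟩
  one_mem' := ⟨1, by simp [one_apply], by simp⟩
  inv_mem' := by
    rintro u ⟨a, ha, hu⟩
    refine ⟨a ^ (p ^ n - 1), pow_nil ha _, ?_⟩
    have h1 : u ^ p ^ n = 1 := by
      ext; rw [Units.val_pow_eq_pow_val, ← hu, toTrunc_pow_eq_one ha, Units.val_one]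
    have h2 : u⁻¹ = u ^ (p ^ n - 1) := by
      rw [inv_eq_iff_mul_eq_one, ← pow_succ', Nat.sub_add_cancel (pow_pos hp.out.pos n), h1]
    rw [h2, map_pow, hu, Units.val_pow_eq_pow_val]

instance (n : ℕ) : Finite (oneUnits p d n) :=
  Finite.of_injective (fun u : oneUnits p d n => (u.1 : Trunc p d n))
    fun _ _ h => Subtype.ext (Units.ext h)

theorem isPGroup_oneUnits (n : ℕ) : IsPGroup p (oneUnits p d n) := by
  rintro ⟨u, a, ha, hu⟩
  refine ⟨n, Subtype.ext (Units.ext ?_)⟩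
  simp [← hu, toTrunc_pow_eq_one ha]

theorem exists_oneUnit {a : MagnusAlgebra p d} (ha : a [] = 1) (n : ℕ) :
    ∃ u : oneUnits p d n, (u.1 : Trunc p d n) = toTrunc p d n a :=
  ⟨⟨Units.ofPowEqOne _ _ (toTrunc_pow_eq_one ha n) (pow_pos hp.out.pos n).ne', a, ha, rfl⟩, rfl⟩

theorem exists_oneUnits_map {n m : ℕ} (h : n ≤ m) :
    ∃ f : oneUnits p d m →* oneUnits p d n, ∀ (u : oneUnits p d m) (a : MagnusAlgebra p d),
      toTrunc p d m a = (u.1 : Trunc p d m) → toTrunc p d n a = ((f u).1 : Trunc p d n) := by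
  have key : ∀ a b, truncCon p d m a b → toTrunc p d n a = toTrunc p d n b :=
    fun a b hab => toTrunc_eq_iff.2 fun w hw => hab w (hw.trans_le h)
  let g : Trunc p d m →+* Trunc p d n := (truncCon p d m).lift (toTrunc p d n) key
  have hg : ∀ a, g (toTrunc p d m a) = toTrunc p d n a := fun a => rfl
  refine ⟨((Units.map (g : Trunc p d m →* Trunc p d n)).comp (oneUnits p d m).subtype).codRestrict
    (oneUnits p d n) ?_, ?_⟩
  · rintro ⟨u, a, ha, hu⟩
    exact ⟨a, ha, by simp [← hu, hg]⟩
  · intro u a hu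
    simp [← hu, hg]

end MagnusAlgebra

/-! ### Pro-`p` groups and free pro-`p` groups -/

/-- `G` is a pro-`p` group: a profinite group all of whose finite continuous quotients are
`p`-groups. -/
structure IsProP (p : ℕ) (G : Type*) [Group G] [TopologicalSpace G] [IsTopologicalGroup G] :
    Prop where
  compactSpace : CompactSpace G
  t2Space : T2Space G
  totallyDisconnectedSpace : TotallyDisconnectedSpace G
  isPGroup_quotient : ∀ U : OpenNormalSubgroup G, IsPGroup p (G ⧸ U.toSubgroup)

/-- `F` is the free pro-`p` group on `x_1, …, x_d`: it is pro-`p` and every map from the `x_i` to a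
finite `p`-group (with the discrete topology) extends uniquely to a continuous homomorphism on `F`.
Passing to inverse limits, the same universal property holds with respect to all pro-`p` groups. -/
structure IsFreeProP (p : ℕ) {d : ℕ} {F : Type*} [Group F] [TopologicalSpace F]
    [IsTopologicalGroup F] (x : Fin d → F) : Prop extends IsProP p F where
  existsUnique_hom : ∀ (H : Type) [Group H] [Finite H] [TopologicalSpace H] [DiscreteTopology H],
    IsPGroup p H → ∀ f : Fin d → H, ∃! φ : F →ₜ* H, ∀ i, φ (x i) = f i

namespace IsFreeProP

open MagnusAlgebra

variable {p d : ℕ} [Fact p.Prime] {F : Type*} [Group F] [TopologicalSpace F]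
  [IsTopologicalGroup F] {x : Fin d → F}

/-- Existence of the Magnus homomorphism `F → E`, `x_i ↦ 1 + X_i`. -/
theorem exists_magnus (hF : IsFreeProP p x) :
    ∃ μ : F →* MagnusAlgebra p d, Continuous μ ∧ ∀ i, μ (x i) = 1 + X i := by
  have hX : ∀ i, (1 + X i : MagnusAlgebra p d) [] = 1 := by
    intro i; simp [one_apply, X, monomial]
  choose e he using fun (n : ℕ) (i : Fin d) => exists_oneUnit (p := p) (hX i) n
  let _ (n : ℕ) : TopologicalSpace (oneUnits p d n) := ⊥
  have (n : ℕ) : DiscreteTopology (oneUnits p d n) := ⟨rfl⟩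
  choose f hf using fun n => (hF.existsUnique_hom (oneUnits p d n) (isPGroup_oneUnits n) (e n)).exists
  have hcompat : ∀ {n m : ℕ} (_ : n ≤ m) (y : F) (a : MagnusAlgebra p d),
      toTrunc p d m a = ((f m y).1 : Trunc p d m) → toTrunc p d n a = ((f n y).1 : Trunc p d n) := by
    intro n m h y a ha
    obtain ⟨g, hg⟩ := exists_oneUnits_map (p := p) (d := d) h
    let g' : oneUnits p d m →ₜ* oneUnits p d n := ⟨g, continuous_of_discreteTopology⟩
    have : g'.comp (f m) = f n := by
      refine (hF.existsUnique_hom (oneUnits p d n) (isPGroup_oneUnits n) (e n)).unique ?_ (hf n)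
      intro i
      refine Subtype.ext (Units.ext ?_)
      rw [he n i]
      refine (hg (f m (x i)) (1 + X i) ?_).symm
      rw [hf, he]
    rw [hg _ a ha, ← this]
    rfl
  choose a ha using fun (n : ℕ) (y : F) => toTrunc_surjective n ((f n y).1 : Trunc p d n)
  let m : F → MagnusAlgebra p d := fun y w => a (w.length + 1) y w
  have hm : ∀ n y, toTrunc p d n (m y) = ((f n y).1 : Trunc p d n) := by
    intro n y
    rw [← ha n y, toTrunc_eq_iff]
    intro w hw
    have := hcompat (Nat.succ_le_of_lt hw) y (a n y) (ha n y)
    rw [← ha (w.length + 1) y, toTrunc_eq_iff] at this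
    exact (this w (Nat.lt_succ_self _)).symm
  have hext : ∀ b c : MagnusAlgebra p d, (∀ n, toTrunc p d n b = toTrunc p d n c) → b = c := by
    intro b c h
    ext w
    exact toTrunc_eq_iff.1 (h (w.length + 1)) w (Nat.lt_succ_self _)
  refine ⟨⟨⟨m, ?_⟩, ?_⟩, ?_, ?_⟩
  · refine hext _ _ fun n => ?_
    rw [hm, map_one, map_one]; rfl
  · intro y z
    refine hext _ _ fun n => ?_
    simp only [hm, map_mul]; rfl
  · refine continuous_pi fun w => ?_
    have : (fun y : F => m y w) = (fun u : oneUnits p d (w.length + 1) =>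
        truncCoeff (w.length + 1) w (Nat.lt_succ_self _) (u.1 : Trunc p d (w.length + 1)))
          ∘ f (w.length + 1) := by
      funext y
      simp [← hm]
    change Continuous (fun y : F => m y w)
    rw [this]
    exact continuous_of_discreteTopology.comp (f (w.length + 1)).continuous_toFun
  · intro i
    refine hext _ _ fun n => ?_
    change toTrunc p d n (m (x i)) = _
    rw [hm, hf, he]

/-- The Magnus homomorphism `F → E`: the (unique) continuous multiplicative map with
`x_i ↦ 1 + X_i`. -/
def magnus (hF : IsFreeProP p x) : F →* MagnusAlgebra p d := hF.exists_magnus.choose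

theorem continuous_magnus (hF : IsFreeProP p x) : Continuous hF.magnus :=
  hF.exists_magnus.choose_spec.1

theorem magnus_generator (hF : IsFreeProP p x) (i : Fin d) : hF.magnus (x i) = 1 + X i :=
  hF.exists_magnus.choose_spec.2 i

/-- The degree `deg(y) = ω(φ(y - 1))` of an element `y` of `F`. -/
def degree (hF : IsFreeProP p x) (y : F) : ℕ∞ := (hF.magnus y - 1).valuation

/-- The Magnus homomorphism modulo `E_n`. -/
def magnusTrunc (hF : IsFreeProP p x) (n : ℕ) : F →* Trunc p d n :=
  (toTrunc p d n : MagnusAlgebra p d →* Trunc p d n).comp hF.magnus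

/-- The open normal subgroup `F_n = {y ∈ F | φ(y - 1) ∈ E_n}`, as the kernel of `F → E / E_n`. -/
def zassenhaus (hF : IsFreeProP p x) (n : ℕ) : OpenNormalSubgroup F where
  toSubgroup := (hF.magnusTrunc n).ker
  isOpen' := by
    have : ((hF.magnusTrunc n).ker : Set F) = ⋂ w ∈ {w : List (Fin d) | w.length < n},
        (fun y => hF.magnus y w) ⁻¹' {(1 : MagnusAlgebra p d) w} := by
      ext y
      simp only [SetLike.mem_coe, MonoidHom.mem_ker, magnusTrunc, MonoidHom.coe_comp,
        Function.comp_apply, MonoidHom.coe_coe, Set.mem_iInter, Set.mem_preimage,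
        Set.mem_singleton_iff]
      rw [← map_one (toTrunc p d n)]
      exact toTrunc_eq_iff
    change IsOpen ((hF.magnusTrunc n).ker : Set F)
    rw [this]
    refine (List.finite_length_lt (Fin d) n).isOpen_biInter fun w _ => ?_
    exact (isOpen_discrete _).preimage ((continuous_apply w).comp hF.continuous_magnus)
  isNormal' := inferInstance

end IsFreeProP

/-! ### Completed group algebras -/

/-- The inverse limit of the group algebras `𝔽_p[G/U]` over the open normal subgroups `U` of `G`,
as a subalgebra of their product. -/
def completedGroupSubalgebra (p : ℕ) (G : Type*) [Group G] [TopologicalSpace G] :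
    Subalgebra (ZMod p) (∀ U : OpenNormalSubgroup G, MonoidAlgebra (ZMod p) (G ⧸ U.toSubgroup)) where
  carrier := {z | ∀ (U V : OpenNormalSubgroup G) (h : U ≤ V),
    MonoidAlgebra.mapDomainAlgHom (ZMod p) (ZMod p)
      (QuotientGroup.map U.toSubgroup V.toSubgroup (MonoidHom.id G) h) (z U) = z V}
  mul_mem' ha hb U V h := by rw [Pi.mul_apply, map_mul, ha U V h, hb U V h, Pi.mul_apply]
  add_mem' ha hb U V h := by rw [Pi.add_apply, map_add, ha U V h, hb U V h, Pi.add_apply]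
  algebraMap_mem' r U V h := by rw [Pi.algebraMap_apply, AlgHom.commutes, Pi.algebraMap_apply]

/-- The completed group algebra `Λ_G = 𝔽_p⟦G⟧`. -/
def CompletedGroupAlgebra (p : ℕ) (G : Type*) [Group G] [TopologicalSpace G] : Type _ :=
  completedGroupSubalgebra p G

namespace CompletedGroupAlgebra

variable (p : ℕ) {G : Type*} [Group G] [TopologicalSpace G]

instance : Ring (CompletedGroupAlgebra p G) := inferInstanceAs (Ring (completedGroupSubalgebra p G))

instance : Algebra (ZMod p) (CompletedGroupAlgebra p G) :=
  inferInstanceAs (Algebra (ZMod p) (completedGroupSubalgebra p G))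

/-- The projection `Λ_G → 𝔽_p[G/U]`. -/
def proj (U : OpenNormalSubgroup G) :
    CompletedGroupAlgebra p G →ₐ[ZMod p] MonoidAlgebra (ZMod p) (G ⧸ U.toSubgroup) :=
  (Pi.evalAlgHom (ZMod p) _ U).comp (completedGroupSubalgebra p G).val

/-- The inverse limit topology, each `𝔽_p[G/U]` being discrete. -/
instance : TopologicalSpace (CompletedGroupAlgebra p G) :=
  ⨅ U : OpenNormalSubgroup G, TopologicalSpace.induced (proj p U) ⊥

/-- The image of `g ∈ G` in `Λ_G`. -/
def of (g : G) : CompletedGroupAlgebra p G :=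
  ⟨fun U => MonoidAlgebra.of (ZMod p) (G ⧸ U.toSubgroup) (g : G ⧸ U.toSubgroup), fun U V h => by
    simp only [MonoidAlgebra.of_apply, MonoidAlgebra.mapDomainAlgHom_apply,
      MonoidAlgebra.mapDomain_single]
    rfl⟩

/-- The preimage of an open normal subgroup under a continuous homomorphism. -/
def comapOpenNormal {F : Type*} [Group F] [TopologicalSpace F] (π : F →ₜ* G)
    (V : OpenNormalSubgroup G) : OpenNormalSubgroup F where
  toOpenSubgroup := V.toOpenSubgroup.comap (π : F →* G) π.continuous_toFun
  isNormal' := inferInstanceAs (V.toSubgroup.comap (π : F →* G)).Normal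

/-- The algebra homomorphism `θ : Λ_F → Λ_G` induced by a continuous homomorphism `F → G`. -/
def map {F : Type*} [Group F] [TopologicalSpace F] (π : F →ₜ* G) :
    CompletedGroupAlgebra p F →ₐ[ZMod p] CompletedGroupAlgebra p G :=
  AlgHom.codRestrict
    (AlgHom.pi fun V : OpenNormalSubgroup G =>
      (MonoidAlgebra.mapDomainAlgHom (ZMod p) (ZMod p)
        (QuotientGroup.map (comapOpenNormal π V).toSubgroup V.toSubgroup (π : F →* G) le_rfl)).comp
          (proj p (comapOpenNormal π V)))
    (completedGroupSubalgebra p G) (by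
      intro z U V h
      have hz := z.2 (comapOpenNormal π U) (comapOpenNormal π V) (fun y hy => h hy)
      change _ = MonoidAlgebra.mapDomainAlgHom (ZMod p) (ZMod p) _
        (z.1 (comapOpenNormal π V))
      rw [← hz]
      change MonoidAlgebra.mapDomainAlgHom (ZMod p) (ZMod p) _
        (MonoidAlgebra.mapDomainAlgHom (ZMod p) (ZMod p) _ (z.1 (comapOpenNormal π U))) = _
      rw [← AlgHom.comp_apply, ← AlgHom.comp_apply, ← MonoidAlgebra.mapDomainAlgHom_comp,
        ← MonoidAlgebra.mapDomainAlgHom_comp]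
      congr 2
      ext y
      rfl)

end CompletedGroupAlgebra

section Filtration

open MagnusAlgebra

variable {p d : ℕ} [Fact p.Prime] {F : Type*} [Group F] [TopologicalSpace F]
  [IsTopologicalGroup F] {x : Fin d → F} {G : Type*} [Group G] [TopologicalSpace G]

/-- The map `φ : Λ_F → E` extending the Magnus homomorphism by linearity and continuity: modulo
`E_n` it is the composite `Λ_F → 𝔽_p[F/F_n] → E / E_n`. -/
def IsFreeProP.magnusLinear (hF : IsFreeProP p x) :
    CompletedGroupAlgebra p F →ₗ[ZMod p] MagnusAlgebra p d :=
  LinearMap.pi fun w : List (Fin d) =>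
    (truncCoeff (w.length + 1) w (Nat.lt_succ_self _)).comp
      ((MonoidAlgebra.lift (ZMod p) (Trunc p d (w.length + 1)) _
        (QuotientGroup.lift (hF.zassenhaus (w.length + 1)).toSubgroup
          (hF.magnusTrunc (w.length + 1)) le_rfl)).toLinearMap.comp
        (CompletedGroupAlgebra.proj p (hF.zassenhaus (w.length + 1))).toLinearMap)

/-- The filtration `E_{G,n}` of `Λ_G` induced by the valuation of `Λ_F ≃ E`: the elements
`θ(z)` with `z ∈ Λ_F` and `ω(φ(z)) ≥ n`. -/
def inducedFiltration (hF : IsFreeProP p x) (π : F →ₜ* G) (n : ℕ) :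
    Submodule (ZMod p) (CompletedGroupAlgebra p G) :=
  ((filtration p d n).comap hF.magnusLinear).map (CompletedGroupAlgebra.map p π).toLinearMap

/-- The graded piece `E_{G,n} / E_{G,n+1}`. -/
abbrev gradedPiece (hF : IsFreeProP p x) (π : F →ₜ* G) (n : ℕ) : Type _ :=
  inducedFiltration hF π n ⧸
    (inducedFiltration hF π (n + 1)).submoduleOf (inducedFiltration hF π n)

/-- The Poincaré series `P_G(t) = ∑ dim (E_{G,n} / E_{G,n+1}) tⁿ`. -/
def poincareSeries (hF : IsFreeProP p x) (π : F →ₜ* G) : PowerSeries ℤ :=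
  PowerSeries.mk fun n => (Module.finrank (ZMod p) (gradedPiece hF π n) : ℤ)

end Filtration

/-! ### The module `R / R^p[R,R]` -/

/-- The closed subgroup `R^p[R,R]` of a topological group `R`. -/
def pCommutator (p : ℕ) (R : Type*) [Group R] [TopologicalSpace R] [IsTopologicalGroup R] :
    Subgroup R :=
  (Subgroup.closure (Set.range fun r : R => r ^ p) ⊔ commutator R).topologicalClosure

theorem commutator_le_pCommutator (p : ℕ) (R : Type*) [Group R] [TopologicalSpace R]
    [IsTopologicalGroup R] : commutator R ≤ pCommutator p R :=
  le_sup_right.trans (Subgroup.le_topologicalClosure _)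

instance (p : ℕ) (R : Type*) [Group R] [TopologicalSpace R] [IsTopologicalGroup R] :
    (pCommutator p R).Normal :=
  Subgroup.Normal.of_commutator_le R (commutator_le_pCommutator p R)

/-- The topological abelian group `R / R^p[R,R]`, written additively. -/
def RelationModule (p : ℕ) (R : Type*) [Group R] [TopologicalSpace R] [IsTopologicalGroup R] :
    Type _ :=
  Additive (R ⧸ pCommutator p R)

namespace RelationModule

variable (p : ℕ) {R : Type*} [Group R] [TopologicalSpace R] [IsTopologicalGroup R]

instance : AddCommGroup (RelationModule p R) where
  __ := (inferInstance : AddGroup (Additive (R ⧸ pCommutator p R)))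
  add_comm a b := by
    have := (Subgroup.Normal.quotient_commutative_iff_commutator_le
      (N := pCommutator p R)).2 (commutator_le_pCommutator p R)
    exact congrArg Additive.ofMul (this.is_comm.comm a.toMul b.toMul)

instance : TopologicalSpace (RelationModule p R) :=
  inferInstanceAs (TopologicalSpace (R ⧸ pCommutator p R))

/-- The class of `r ∈ R` in `R / R^p[R,R]`. -/
def mk (r : R) : RelationModule p R := Additive.ofMul (r : R ⧸ pCommutator p R)

end RelationModule

/-! ### Cohomology -/

instance (p : ℕ) : ContinuousSMul (ZMod p) (ULift (ZMod p)) := ⟨continuous_of_discreteTopology⟩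

/-- The continuous cohomology group `H^n(G) = H^n(G, 𝔽_p)`, with trivial action on the discrete
module `𝔽_p`. -/
abbrev modPCohomology.{u} (p : ℕ) (G : Type u) [Group G] [TopologicalSpace G]
    [IsTopologicalGroup G] (n : ℕ) : TopModuleCat.{u} (ZMod p) :=
  continuousCohomology n
    (TopRep.of (ContRepresentation.trivial (ZMod p) G (ULift.{u} (ZMod p))))

/-- The `p`-rank `d_p G = dim H^1(G)`. -/
def pRank (p : ℕ) (G : Type*) [Group G] [TopologicalSpace G] [IsTopologicalGroup G] : ℕ :=
  Module.finrank (ZMod p) (modPCohomology p G 1)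

/-- The cohomological dimension of a pro-`p` group: the least `n ≤ ∞` such that `H^i(G) = 0` for
every `i > n`. -/
def cohomologicalDimension (p : ℕ) (G : Type*) [Group G] [TopologicalSpace G]
    [IsTopologicalGroup G] : ℕ∞ :=
  sInf {n : ℕ∞ | ∀ i : ℕ, n < i → Subsingleton (modPCohomology p G i)}

/-! ### Combinatorially free families -/

/-- A family of monomials is combinatorially free if no member is a submonomial of another one, and
no proper nontrivial left factor of a member is a proper right factor of a member (the same or
another one). -/
def CombinatoriallyFree {d : ℕ} {I : Type*} (α : I → List (Fin d)) : Prop :=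
  (∀ i j, i ≠ j → ¬ α i <:+: α j) ∧
  ∀ i j, ∀ u v u' v' : List (Fin d), u ≠ [] → v ≠ [] → u' ≠ [] → v' ≠ [] →
    α i = u ++ v → α j = u' ++ v' → u ≠ v'

end

/-!
Let `f_i = φ(ρ_i - 1)`, and call a word normal if no highest term `α_i` is a factor of it. The
shortest prefix of a word that is not normal has the form `u α_i` with `u` normal; since the `α_i`
do not overlap, conversely every word `u α_i v` with `u` normal has `u α_i` as this prefix. Hence
the monomials `X_w`, `w` normal, and the series `X_u f_i X_v`, `u` normal, have distinct highest
terms, which exhaust the monomials, and they form a topological basis of `E`. This has three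
consequences for the closed two-sided ideal `J` generated by the `f_i`, which turns out to be the
kernel of `E → Λ_G`.

* The normal words form a topological basis of `Λ_G`, and a letter appended to a normal word
  gives either a normal word or a word `u α_i`: this count is the formula for the Poincaré series.
* Writing `M` for the augmentation ideal, every element of `J` is uniquely `∑ h_i f_i` modulo `J M`
  with `h_i ∈ Λ_G`. The map `r ↦ (h_i)` for `φ(r - 1)` is thus a homomorphism
  `R / R^p[R,R] → ∏ Λ_G`, and it is an isomorphism.
* The Jacobian `(∂_j f_i)` extends the resolution `Λ_G^d → Λ_G → 𝔽_p` to the left by `∏ Λ_G`.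
  Dually, `0 → 𝔽_p → C(G, 𝔽_p) → C(G, 𝔽_p^d) → C(G, 𝔽_p^{(I)}) → 0` is exact, and dimension
  shifting gives `cd(G) ≤ 2`.
-/

noncomputable section

/-! ### Normal words -/

section NormalWords

variable {A I : Type*} {α : I → List A}

/-- A word is normal with respect to the family `α` if no `α i` is a factor of it. -/
def IsNormalWord (α : I → List A) (w : List A) : Prop := ∀ i, ¬ α i <:+: w

theorem IsNormalWord.of_isInfix {u w : List A} (hw : IsNormalWord α w) (h : u <:+: w) :
    IsNormalWord α u := fun i hi => hw i (hi.trans h)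

theorem not_isNormalWord_append (u : List A) (i : I) (v : List A) :
    ¬ IsNormalWord α (u ++ α i ++ v) := fun h => h i ⟨u, v, rfl⟩

theorem isNormalWord_nil (hα : ∀ i, α i ≠ []) : IsNormalWord α [] :=
  fun i h => hα i (List.infix_nil.1 h)

theorem exists_append_singleton_eq (hα : ∀ i, α i ≠ []) {w : List A} {a : A}
    (hw : IsNormalWord α w) (h : ¬ IsNormalWord α (w ++ [a])) :
    ∃ u i, IsNormalWord α u ∧ w ++ [a] = u ++ α i := by
  simp only [IsNormalWord, not_forall, not_not, List.infix_concat_iff, hw _, or_false] at h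
  obtain ⟨i, u, hu⟩ := h
  refine ⟨u, i, hw.of_isInfix (List.IsPrefix.isInfix ?_), hu.symm⟩
  refine List.prefix_of_prefix_length_le ⟨α i, hu⟩ (List.prefix_append w [a]) ?_
  have := congrArg List.length hu
  have := List.length_pos_iff.2 (hα i)
  simp only [List.length_append, List.length_singleton] at *
  omega

theorem exists_eq_append_of_not_isNormalWord (hα : ∀ i, α i ≠ []) {w : List A}
    (h : ¬ IsNormalWord α w) : ∃ u i v, IsNormalWord α u ∧ w = u ++ α i ++ v := by
  induction w using List.reverseRecOn with
  | nil => exact absurd (isNormalWord_nil hα) h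
  | append_singleton w a ih =>
    by_cases hw : IsNormalWord α w
    · obtain ⟨u, i, hu, hui⟩ := exists_append_singleton_eq hα hw h
      exact ⟨u, i, [], hu, by rw [hui, List.append_nil]⟩
    · obtain ⟨u, i, v, hu, rfl⟩ := ih hw
      exact ⟨u, i, v ++ [a], hu, by simp only [List.append_assoc]⟩

end NormalWords

namespace CombinatoriallyFree

variable {d : ℕ} {I : Type*} {α : I → List (Fin d)} (hfree : CombinatoriallyFree α)

include hfree

theorem eq_of_isInfix {i k : I} (h : α i <:+: α k) : i = k :=
  not_imp_not.1 (hfree.1 i k) h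

theorem injective : Function.Injective α :=
  fun _ _ h => hfree.eq_of_isInfix (h ▸ List.infix_rfl)

theorem comp {J : Type*} {e : J → I} (he : Function.Injective e) :
    CombinatoriallyFree (α ∘ e) :=
  ⟨fun _ _ h => hfree.1 _ _ (he.ne h), fun _ _ => hfree.2 _ _⟩

theorem eq_of_append_eq_append {i k : I} {v v' : List (Fin d)} (h : α i ++ v = α k ++ v') :
    i = k ∧ v = v' := by
  have hik : i = k := by
    rcases List.prefix_or_prefix_of_prefix ⟨v, rfl⟩ ⟨v', h.symm⟩ with h' | h'
    · exact hfree.eq_of_isInfix h'.isInfix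
    · exact (hfree.eq_of_isInfix h'.isInfix).symm
  subst hik
  exact ⟨rfl, List.append_cancel_left h⟩

theorem eq_nil_of_append_eq {i k : I} {s v v' : List (Fin d)} (hs : ¬ α i <:+: s)
    (h : α i ++ v = s ++ (α k ++ v')) : s = [] := by
  rcases List.append_eq_append_iff.1 h with ⟨t, rfl, -⟩ | ⟨t, hi, ht⟩
  · exact absurd (List.prefix_append _ _).isInfix hs
  by_contra hs0
  have not_infix : ¬ α k <:+: t := fun hk => by
    have hki := hfree.eq_of_isInfix (hk.trans (hi ▸ (List.suffix_append s t).isInfix))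
    have hlen := hk.length_le
    rw [hki, hi, List.length_append] at hlen
    exact hs0 (List.length_eq_zero_iff.1 (by omega))
  rcases List.append_eq_append_iff.1 ht with ⟨q, rfl, -⟩ | ⟨q, hk, -⟩
  · exact not_infix (List.prefix_append _ _).isInfix
  have ht0 : t ≠ [] := by
    rintro rfl
    exact hs (by rw [hi, List.append_nil])
  have hq0 : q ≠ [] := by
    rintro rfl
    exact not_infix (by rw [hk, List.append_nil])
  exact hfree.2 k i t q s t ht0 hq0 hs0 ht0 hk hi rfl

theorem append_unique {u u' v v' : List (Fin d)} {i k : I} (hu : IsNormalWord α u)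
    (hu' : IsNormalWord α u') (h : u ++ α i ++ v = u' ++ α k ++ v') :
    u = u' ∧ i = k ∧ v = v' := by
  rw [List.append_assoc, List.append_assoc] at h
  have huu' : u = u' := by
    rcases List.append_eq_append_iff.1 h with ⟨s, rfl, hs⟩ | ⟨s, rfl, hs⟩
    · rw [hfree.eq_nil_of_append_eq
        (fun hi => hu' i (hi.trans (List.suffix_append u s).isInfix)) hs, List.append_nil]
    · rw [hfree.eq_nil_of_append_eq
        (fun hk => hu k (hk.trans (List.suffix_append u' s).isInfix)) hs, List.append_nil]
  subst huu'
  exact ⟨rfl, hfree.eq_of_append_eq_append (List.append_cancel_left h)⟩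

theorem isNormalWord_of_append_singleton (hα : ∀ i, α i ≠ []) {u w : List (Fin d)} {i : I}
    {j : Fin d} (hu : IsNormalWord α u) (h : w ++ [j] = u ++ α i) : IsNormalWord α w := by
  by_contra hw
  obtain ⟨u', k, v, hu', rfl⟩ := exists_eq_append_of_not_isNormalWord hα hw
  have hnil : [] = v ++ [j] :=
    (hfree.append_unique hu hu' (by rw [← h, List.append_nil, List.append_assoc _ v])).2.2
  simp at hnil

end CombinatoriallyFree

/-! ### Counting normal words -/

/-- The normal words of length `n`. -/
def normalWords {A I : Type*} (α : I → List A) (n : ℕ) : Set (List A) :=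
  {w | IsNormalWord α w ∧ w.length = n}

/-- The pairs `(u, i)` with `u` normal and `|u α_i| = n`. When `α` is combinatorially free, they
parametrize the words of length `n` that are not normal but whose proper prefixes are. -/
def normalPairs {A I : Type*} (α : I → List A) (n : ℕ) : Set (List A × I) :=
  {q | IsNormalWord α q.1 ∧ q.1.length + (α q.2).length = n}

section Counting

variable {A I : Type*} {α : I → List A}

theorem finite_normalWords [Finite A] (α : I → List A) (n : ℕ) : (normalWords α n).Finite :=
  (List.finite_length_eq A n).subset fun _ h => h.2

theorem ncard_normalWords_zero (hα : ∀ i, α i ≠ []) : (normalWords α 0).ncard = 1 := by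
  rw [Set.ncard_eq_one]
  refine ⟨[], Set.ext fun w => ⟨fun h => List.length_eq_zero_iff.1 h.2, ?_⟩⟩
  rintro rfl
  exact ⟨isNormalWord_nil hα, rfl⟩

theorem disjoint_normalWords_image_normalPairs (n : ℕ) :
    Disjoint (normalWords α n) ((fun q => q.1 ++ α q.2) '' normalPairs α n) := by
  rw [Set.disjoint_left]
  rintro _ h ⟨⟨u, i⟩, -, rfl⟩
  exact h.1 i (List.suffix_append u (α i)).isInfix

theorem ncard_image_append_singleton {d : ℕ} (W : Set (List (Fin d))) :
    ((fun q : List (Fin d) × Fin d => q.1 ++ [q.2]) '' (W ×ˢ Set.univ)).ncard = d * W.ncard := by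
  rw [Set.ncard_image_of_injective, Set.ncard_prod, Set.ncard_univ, Nat.card_eq_fintype_card,
    Fintype.card_fin, mul_comm]
  rintro ⟨w, j⟩ ⟨w', j'⟩ h
  obtain ⟨hw, hj⟩ := List.append_inj' h rfl
  exact Prod.ext hw (List.singleton_inj.1 hj)

end Counting

namespace CombinatoriallyFree

variable {d : ℕ} {I : Type*} {α : I → List (Fin d)} (hfree : CombinatoriallyFree α)

include hfree

theorem finite_length_le (n : ℕ) : {i | (α i).length ≤ n}.Finite :=
  (List.finite_length_le (Fin d) n).preimage hfree.injective.injOn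

theorem finite_length_eq (n : ℕ) : {i | (α i).length = n}.Finite :=
  (hfree.finite_length_le n).subset fun _ h => h.le

theorem finite_normalPairs (n : ℕ) : (normalPairs α n).Finite :=
  ((List.finite_length_le (Fin d) n).prod (hfree.finite_length_le n)).subset
    fun _ h => ⟨le_of_add_le_left h.2.le, le_of_add_le_right h.2.le⟩

theorem injOn_normalPairs (n : ℕ) :
    Set.InjOn (fun q : List (Fin d) × I => q.1 ++ α q.2) (normalPairs α n) := by
  rintro ⟨u, i⟩ hu ⟨u', k⟩ hu' h
  obtain ⟨prefix_eq, index_eq, -⟩ :=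
    hfree.append_unique hu.1 hu'.1 (v := []) (v' := []) (by simpa only [List.append_nil] using h)
  exact Prod.ext prefix_eq index_eq

theorem ncard_normalPairs (n : ℕ) :
    (normalPairs α n).ncard = ∑ k ∈ Finset.HasAntidiagonal.antidiagonal n,
      (normalWords α k.1).ncard * {i | (α i).length = k.2}.ncard := by
  classical
  rw [Set.ncard_eq_toFinset_card _ (hfree.finite_normalPairs n),
    Finset.card_eq_sum_card_fiberwise (f := fun q => (q.1.length, (α q.2).length))
      (t := Finset.HasAntidiagonal.antidiagonal n) (fun q hq => by
        simpa only [Finset.mem_coe, Finset.HasAntidiagonal.mem_antidiagonal] using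
          ((Set.Finite.mem_toFinset _).1 hq).2)]
  refine Finset.sum_congr rfl fun k hk => ?_
  rw [← Set.ncard_prod, ← Set.ncard_coe_finset]
  congr 1
  ext q
  simp only [Finset.coe_filter, Set.Finite.mem_toFinset, Set.mem_ofPred_eq, Set.mem_prod,
    normalWords, normalPairs, Prod.ext_iff]
  rw [Finset.HasAntidiagonal.mem_antidiagonal] at hk
  grind

theorem image_append_singleton_normalWords (hα : ∀ i, α i ≠ []) (n : ℕ) :
    (fun q : List (Fin d) × Fin d => q.1 ++ [q.2]) '' (normalWords α n ×ˢ Set.univ) =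
      normalWords α (n + 1) ∪ (fun q => q.1 ++ α q.2) '' normalPairs α (n + 1) := by
  apply Set.Subset.antisymm
  · rintro _ ⟨⟨w, j⟩, ⟨⟨hw, rfl⟩, -⟩, rfl⟩
    by_cases h : IsNormalWord α (w ++ [j])
    · exact Or.inl ⟨h, List.length_append⟩
    · obtain ⟨u, i, hu, hui⟩ := exists_append_singleton_eq hα hw h
      refine Or.inr ⟨(u, i), ⟨hu, ?_⟩, hui.symm⟩
      rw [← List.length_append, ← hui, List.length_append, List.length_singleton]
  · suffices h : ∀ w : List (Fin d), w.length = n + 1 →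
        (∀ v j, w = v ++ [j] → IsNormalWord α v) →
        w ∈ (fun q : List (Fin d) × Fin d => q.1 ++ [q.2]) '' (normalWords α n ×ˢ Set.univ) by
      rintro _ (⟨hw, hlen⟩ | ⟨⟨u, i⟩, ⟨hu, hlen⟩, rfl⟩)
      · exact h _ hlen fun v j hv => hw.of_isInfix (hv ▸ (List.prefix_append v [j]).isInfix)
      · exact h _ (by rw [List.length_append, hlen])
          fun v j hv => hfree.isNormalWord_of_append_singleton hα hu hv.symm
    intro w hlen hw
    rcases List.eq_nil_or_concat' w with rfl | ⟨v, j, rfl⟩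
    · exact absurd hlen (Nat.succ_ne_zero n).symm
    · rw [List.length_append, List.length_singleton, Nat.succ_inj] at hlen
      exact ⟨(v, j), ⟨⟨hw v j rfl, hlen⟩, trivial⟩, rfl⟩

theorem card_mul_ncard_normalWords (hα : ∀ i, α i ≠ []) (n : ℕ) :
    d * (normalWords α n).ncard = (normalWords α (n + 1)).ncard +
      ∑ k ∈ Finset.HasAntidiagonal.antidiagonal (n + 1),
        (normalWords α k.1).ncard * {i | (α i).length = k.2}.ncard := by
  rw [← ncard_image_append_singleton, hfree.image_append_singleton_normalWords hα,
    Set.ncard_union_eq (disjoint_normalWords_image_normalPairs _) (finite_normalWords α _)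
      ((hfree.finite_normalPairs _).image _),
    (hfree.injOn_normalPairs _).ncard_image, hfree.ncard_normalPairs]

theorem mk_ncard_normalWords_mul (hα : ∀ i, α i ≠ []) :
    (PowerSeries.mk fun n : ℕ => ((normalWords α n).ncard : ℤ)) *
      (1 - PowerSeries.C (d : ℤ) * PowerSeries.X +
        PowerSeries.mk fun n : ℕ => ({i | (α i).length = n}.ncard : ℤ)) = 1 := by
  set N : PowerSeries ℤ := PowerSeries.mk fun n : ℕ => ((normalWords α n).ncard : ℤ) with hN
  set L : PowerSeries ℤ := PowerSeries.mk fun n : ℕ => ({i | (α i).length = n}.ncard : ℤ) with hL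
  have expand : N * (1 - PowerSeries.C (d : ℤ) * PowerSeries.X + L) =
      N - PowerSeries.C (d : ℤ) * (N * PowerSeries.X) + N * L := by ring
  rw [expand]
  ext n
  rw [map_add, map_sub, PowerSeries.coeff_C_mul, PowerSeries.coeff_mul n N L]
  cases n with
  | zero => simp [hN, hL, ncard_normalWords_zero hα, hα]
  | succ n =>
    have count := congrArg (Nat.cast : ℕ → ℤ) (hfree.card_mul_ncard_normalWords hα n)
    push_cast at count
    rw [PowerSeries.coeff_succ_mul_X, PowerSeries.coeff_one, if_neg (Nat.succ_ne_zero n)]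
    simp only [hN, hL, PowerSeries.coeff_mk, count]
    ring

end CombinatoriallyFree

/-! ### Triangular families of series -/

namespace MagnusAlgebra

variable {p d : ℕ}

instance : T2Space (MagnusAlgebra p d) := inferInstanceAs (T2Space (_ → ZMod p))

instance [Fact p.Prime] : CompactSpace (MagnusAlgebra p d) :=
  inferInstanceAs (CompactSpace (_ → ZMod p))

theorem continuous_coeff (w : List (Fin d)) : Continuous fun a : MagnusAlgebra p d => a w :=
  continuous_apply w

theorem continuous_iff_coeff {Y : Type*} [TopologicalSpace Y] {f : Y → MagnusAlgebra p d} :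
    Continuous f ↔ ∀ w, Continuous fun y => f y w := continuous_pi_iff

instance : IsTopologicalRing (MagnusAlgebra p d) where
  continuous_add := continuous_iff_coeff.2 fun w =>
    ((continuous_coeff w).comp continuous_fst).add ((continuous_coeff w).comp continuous_snd)
  continuous_mul := continuous_iff_coeff.2 fun w => by
    simp only [mul_apply]
    exact continuous_finsetSum _ fun k _ => ((continuous_coeff _).comp continuous_fst).mul
      ((continuous_coeff _).comp continuous_snd)
  continuous_neg := continuous_iff_coeff.2 fun w => (continuous_coeff w).neg

/-- The words of length at most `n`. -/
def wordsLE (d n : ℕ) : Finset (List (Fin d)) := (List.finite_length_le (Fin d) n).toFinset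

@[simp] theorem mem_wordsLE {n : ℕ} {w : List (Fin d)} : w ∈ wordsLE d n ↔ w.length ≤ n := by
  simp [wordsLE]

theorem monomial_apply (w v : List (Fin d)) :
    (monomial w : MagnusAlgebra p d) v = if v = w then 1 else 0 := rfl

theorem monomial_nil : (monomial [] : MagnusAlgebra p d) = 1 := rfl

theorem sum_apply {ι : Type*} (s : Finset ι) (f : ι → MagnusAlgebra p d) (w : List (Fin d)) :
    (∑ i ∈ s, f i) w = ∑ i ∈ s, f i w := Finset.sum_apply w s f

theorem monomial_mul_apply_append (u v : List (Fin d)) (a : MagnusAlgebra p d) :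
    (monomial u * a : MagnusAlgebra p d) (u ++ v) = a v := by
  rw [mul_apply, Finset.sum_eq_single u.length]
  · simp [monomial_apply]
  · intro k hk hne
    rw [monomial_apply, if_neg, zero_mul]
    intro h
    have := congrArg List.length h
    simp only [List.length_take, Finset.mem_range] at this hk
    omega
  · simp

theorem monomial_mul_apply_of_not_isPrefix {u w : List (Fin d)} (a : MagnusAlgebra p d)
    (h : ¬ u <+: w) : (monomial u * a : MagnusAlgebra p d) w = 0 := by
  rw [mul_apply]
  refine Finset.sum_eq_zero fun k _ => ?_
  rw [monomial_apply, if_neg, zero_mul]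
  rintro rfl
  exact h ⟨_, List.take_append_drop _ _⟩

theorem mul_monomial_apply_append (u v : List (Fin d)) (a : MagnusAlgebra p d) :
    (a * monomial v : MagnusAlgebra p d) (u ++ v) = a u := by
  rw [mul_apply, Finset.sum_eq_single u.length]
  · simp [monomial_apply]
  · intro k hk hne
    rw [monomial_apply, if_neg, mul_zero]
    intro h
    have := congrArg List.length h
    simp only [List.length_drop, List.length_append, Finset.mem_range] at this hk
    omega
  · simp

theorem mul_monomial_apply_of_not_isSuffix {v w : List (Fin d)} (a : MagnusAlgebra p d)
    (h : ¬ v <:+ w) : (a * monomial v : MagnusAlgebra p d) w = 0 := by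
  rw [mul_apply]
  refine Finset.sum_eq_zero fun k _ => ?_
  rw [monomial_apply, if_neg, mul_zero]
  rintro rfl
  exact h (List.drop_suffix _ _)

theorem monomial_mul_monomial (u v : List (Fin d)) :
    (monomial u * monomial v : MagnusAlgebra p d) = monomial (u ++ v) := by
  ext w
  by_cases h : u <+: w
  · obtain ⟨w, rfl⟩ := h
    rw [monomial_mul_apply_append]
    simp [monomial_apply]
  · rw [monomial_mul_apply_of_not_isPrefix _ h, monomial_apply, if_neg]
    rintro rfl
    exact h (List.prefix_append _ _)

theorem monomial_mul_X (u : List (Fin d)) (j : Fin d) :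
    (monomial u * X j : MagnusAlgebra p d) = monomial (u ++ [j]) := monomial_mul_monomial u [j]

theorem mem_filtration {n : ℕ} {a : MagnusAlgebra p d} :
    a ∈ filtration p d n ↔ ∀ w, w.length < n → a w = 0 := le_valuation_iff

theorem tendsto_of_sub_mem_filtration {u : ℕ → MagnusAlgebra p d} {a : MagnusAlgebra p d}
    (h : ∀ n, u n - a ∈ filtration p d n) : Filter.Tendsto u Filter.atTop (nhds a) := by
  refine tendsto_pi_nhds.2 fun w => tendsto_const_nhds.congr' ?_
  filter_upwards [Filter.eventually_gt_atTop w.length] with n hn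
  exact (sub_eq_zero.1 (mem_filtration.1 (h n) w hn)).symm

theorem mul_mem_filtration {m n : ℕ} {a b : MagnusAlgebra p d} (ha : a ∈ filtration p d m)
    (hb : b ∈ filtration p d n) : a * b ∈ filtration p d (m + n) := by
  rw [mem_filtration] at *
  intro w hw
  rw [mul_apply]
  refine Finset.sum_eq_zero fun k hk => ?_
  rw [Finset.mem_range] at hk
  by_cases h : k < m
  · rw [ha _ (by simp; omega), zero_mul]
  · rw [hb _ (by simp; omega), mul_zero]

/-- The polynomial obtained from a series by dropping the terms of degree greater than `n`. -/
def truncate (n : ℕ) (a : MagnusAlgebra p d) : MagnusAlgebra p d :=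
  fun w => if w.length ≤ n then a w else 0

theorem truncate_eq_sum (n : ℕ) (a : MagnusAlgebra p d) :
    truncate n a = ∑ w ∈ wordsLE d n, a w • (monomial w : MagnusAlgebra p d) := by
  ext v
  simp only [truncate, sum_apply, smul_apply, monomial_apply, mul_ite, mul_one, mul_zero]
  refine Eq.trans ?_ (Finset.sum_ite_eq (wordsLE d n) v fun w => a w).symm
  simp only [mem_wordsLE]

theorem tendsto_truncate (a : MagnusAlgebra p d) :
    Filter.Tendsto (fun n => truncate n a) Filter.atTop (nhds a) :=
  tendsto_of_sub_mem_filtration fun n => mem_filtration.2 fun w hw => by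
    simp [truncate, hw.le]

variable {Y : Type*} [AddCommGroup Y] [Module (ZMod p) Y] [TopologicalSpace Y]

theorem map_mem_of_monomial (L : MagnusAlgebra p d →ₗ[ZMod p] Y) (hL : Continuous L)
    (S : Submodule (ZMod p) Y) (hS : IsClosed (S : Set Y)) (A : Set (List (Fin d)))
    (h : ∀ w ∈ A, L (monomial w) ∈ S) {c : MagnusAlgebra p d} (hc : ∀ w ∉ A, c w = 0) :
    L c ∈ S := by
  refine hS.mem_of_tendsto ((hL.tendsto c).comp (tendsto_truncate c)) (.of_forall fun n => ?_)
  simp only [Function.comp_apply, truncate_eq_sum, map_sum, map_smul]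
  refine S.sum_mem fun w _ => ?_
  by_cases hw : w ∈ A
  · exact S.smul_mem _ (h w hw)
  · simp [hc w hw]

theorem map_eq_zero_of_monomial [T1Space Y] (L : MagnusAlgebra p d →ₗ[ZMod p] Y)
    (hL : Continuous L) (A : Set (List (Fin d))) (h : ∀ w ∈ A, L (monomial w) = 0)
    {c : MagnusAlgebra p d} (hc : ∀ w ∉ A, c w = 0) : L c = 0 := by
  have := map_mem_of_monomial L hL ⊥ (by simp) A (by simpa using h) hc
  simpa using this

theorem linearMap_ext [T2Space Y] [IsTopologicalAddGroup Y]
    {L L' : MagnusAlgebra p d →ₗ[ZMod p] Y} (hL : Continuous L) (hL' : Continuous L')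
    (h : ∀ w, L (monomial w) = L' (monomial w)) : L = L' := by
  ext c
  have := map_eq_zero_of_monomial (L - L') (hL.sub hL') Set.univ (by simp [h]) (c := c) (by simp)
  simpa [sub_eq_zero] using this

theorem MonomialLE.length_le {v w : List (Fin d)} (h : MonomialLE v w) : w.length ≤ v.length := by
  rcases h with h | h <;> omega

theorem MonomialLE.refl (w : List (Fin d)) : MonomialLE w w := Or.inr ⟨rfl, le_refl _⟩

theorem MonomialLE.trans {u v w : List (Fin d)} (h : MonomialLE u v) (h' : MonomialLE v w) :
    MonomialLE u w := by
  rcases h with h | ⟨h, hle⟩ <;> rcases h' with h' | ⟨h', hle'⟩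
  · exact Or.inl (by omega)
  · exact Or.inl (by omega)
  · exact Or.inl (by omega)
  · exact Or.inr ⟨by omega, le_trans hle hle'⟩

theorem MonomialLE.antisymm {v w : List (Fin d)} (h : MonomialLE v w) (h' : MonomialLE w v) :
    v = w := by
  rcases h with h | ⟨h, hle⟩ <;> rcases h' with h' | ⟨h', hle'⟩
  · omega
  · omega
  · omega
  · exact le_antisymm hle hle'

theorem append_right_lt {v w : List (Fin d)} (t : List (Fin d)) (hl : v.length = w.length)
    (h : v < w) : v ++ t < w ++ t := by
  induction v generalizing w with
  | nil => exact absurd h (by simp [List.length_eq_zero_iff.1 hl.symm])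
  | cons a v ih =>
    cases w with
    | nil => simp at hl
    | cons b w =>
      simp only [List.cons_append, List.cons_lt_cons_iff] at h ⊢
      exact h.imp_right fun h => ⟨h.1, ih (by simpa using hl) h.2⟩

theorem MonomialLE.append (a b : List (Fin d)) {v w : List (Fin d)} (h : MonomialLE v w) :
    MonomialLE (a ++ v ++ b) (a ++ w ++ b) := by
  rcases h with h | ⟨h, hle⟩
  · exact Or.inl (by simp only [List.length_append]; omega)
  · rcases hle.eq_or_lt with rfl | hlt
    · exact MonomialLE.refl _
    · exact Or.inr ⟨by simp [h],
        (append_right_lt b (by simp [h]) (List.append_left_lt hlt)).le⟩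

theorem isHighestTerm_monomial [Nontrivial (ZMod p)] (w : List (Fin d)) :
    (monomial w : MagnusAlgebra p d).IsHighestTerm w := by
  refine ⟨by simp [monomial_apply], fun v hv => ?_⟩
  rw [monomial_apply] at hv
  split_ifs at hv with h
  · exact h ▸ MonomialLE.refl _
  · exact absurd rfl hv

theorem IsHighestTerm.monomial_mul_mul {f : MagnusAlgebra p d} {w : List (Fin d)}
    (hf : f.IsHighestTerm w) (u v : List (Fin d)) :
    (monomial u * f * monomial v : MagnusAlgebra p d).IsHighestTerm (u ++ w ++ v) := by
  constructor
  · rw [mul_monomial_apply_append, monomial_mul_apply_append]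
    exact hf.1
  · intro m hm
    have suffix_m : v <:+ m := by
      by_contra h
      exact hm (mul_monomial_apply_of_not_isSuffix _ h)
    obtain ⟨m, rfl⟩ := suffix_m
    rw [mul_monomial_apply_append] at hm
    have prefix_m : u <+: m := by
      by_contra h
      exact hm (monomial_mul_apply_of_not_isPrefix _ h)
    obtain ⟨m, rfl⟩ := prefix_m
    rw [monomial_mul_apply_append] at hm
    exact (hf.2 m hm).append u v

theorem IsHighestTerm.valuation_eq {f : MagnusAlgebra p d} {w : List (Fin d)}
    (hf : f.IsHighestTerm w) : f.valuation = w.length := by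
  refine le_antisymm (iInf₂_le w hf.1) (le_valuation_iff.2 fun v hv => ?_)
  by_contra h
  have := (hf.2 v h).length_le
  omega

theorem IsHighestTerm.mem_filtration_iff {f : MagnusAlgebra p d} {w : List (Fin d)}
    (hf : f.IsHighestTerm w) {n : ℕ} : f ∈ filtration p d n ↔ n ≤ w.length := by
  change (n : ℕ∞) ≤ f.valuation ↔ _
  rw [hf.valuation_eq, Nat.cast_le]

theorem exists_isHighestTerm {a : MagnusAlgebra p d} (ha : a ≠ 0) : ∃ w, a.IsHighestTerm w := by
  classical
  have exists_degree : ∃ n, ∃ w : List (Fin d), w.length = n ∧ a w ≠ 0 := by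
    by_contra! h
    exact ha (ext fun w => h _ w rfl)
  let n := Nat.find exists_degree
  obtain ⟨w₀, hw₀, hw₀'⟩ := Nat.find_spec exists_degree
  let s := (wordsLE d n).filter fun w => a w ≠ 0
  have hs : s.Nonempty := ⟨w₀, by simp [s, hw₀', n, hw₀]⟩
  obtain ⟨w, hw, hmax⟩ := s.exists_maximal hs
  have hlen : ∀ v, a v ≠ 0 → n ≤ v.length := fun v hv => Nat.find_min' exists_degree ⟨v, rfl, hv⟩
  simp only [s, Finset.mem_filter, mem_wordsLE] at hw hmax
  refine ⟨w, hw.2, fun v hv => ?_⟩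
  have := hlen w hw.2
  rcases (hlen v hv).eq_or_lt with length_eq | length_lt
  · exact Or.inr ⟨by omega, (le_total v w).elim id fun h => hmax ⟨length_eq.ge, hv⟩ h⟩
  · exact Or.inl (by omega)

/-- The series `∑ c_w t_w`, for a family of series `t` indexed by words such that `ω(t_w) ≥ |w|`.
The coefficient at `v` only involves the words of length at most `|v|`, so the sum is finite. -/
def linearComb (t : List (Fin d) → MagnusAlgebra p d) :
    MagnusAlgebra p d →ₗ[ZMod p] MagnusAlgebra p d where
  toFun c := fun v => ∑ w ∈ wordsLE d v.length, c w * t w v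
  map_add' a b := by
    ext v
    refine Eq.trans ?_ (Finset.sum_add_distrib (s := wordsLE d v.length))
    simp [add_mul]
  map_smul' r a := by
    ext v
    refine Eq.trans ?_ (Finset.mul_sum (wordsLE d v.length) _ _).symm
    simp [mul_assoc]

theorem linearComb_apply (t : List (Fin d) → MagnusAlgebra p d) (c : MagnusAlgebra p d)
    (v : List (Fin d)) : linearComb t c v = ∑ w ∈ wordsLE d v.length, c w * t w v := rfl

theorem continuous_linearComb (t : List (Fin d) → MagnusAlgebra p d) : Continuous (linearComb t) :=
  continuous_iff_coeff.2 fun v => by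
    simp only [linearComb_apply]
    exact continuous_finsetSum _ fun w _ => (continuous_coeff w).mul continuous_const

variable {t : List (Fin d) → MagnusAlgebra p d} (ht : ∀ w, (t w).IsHighestTerm w)

include ht

theorem linearComb_monomial (w : List (Fin d)) : linearComb t (monomial w) = t w := by
  ext v
  rw [linearComb_apply]
  simp only [monomial_apply, ite_mul, one_mul, zero_mul, Finset.sum_ite_eq', mem_wordsLE]
  split_ifs with h
  · rfl
  · by_contra h'
    exact h ((ht w).2 v (Ne.symm h')).length_le

theorem IsHighestTerm.linearComb [Fact p.Prime] {c : MagnusAlgebra p d} {w : List (Fin d)}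
    (hc : c.IsHighestTerm w) : (linearComb t c).IsHighestTerm w := by
  constructor
  · rw [linearComb_apply, Finset.sum_eq_single w]
    · exact mul_ne_zero hc.1 (ht w).1
    · intro v _ hv
      by_contra h
      exact hv ((hc.2 v (left_ne_zero_of_mul h)).antisymm ((ht v).2 w (right_ne_zero_of_mul h)))
    · simp
  · intro v hv
    obtain ⟨u, -, hu⟩ := Finset.exists_ne_zero_of_sum_ne_zero hv
    exact ((ht u).2 v (right_ne_zero_of_mul hu)).trans (hc.2 u (left_ne_zero_of_mul hu))

theorem linearComb_injective [Fact p.Prime] : Function.Injective (linearComb t) := by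
  rw [injective_iff_map_eq_zero]
  intro c hc
  by_contra h
  obtain ⟨w, hw⟩ := exists_isHighestTerm h
  exact (hw.linearComb ht).1 (by rw [hc]; rfl)

theorem mem_filtration_of_linearComb_mem [Fact p.Prime] {n : ℕ} {c : MagnusAlgebra p d}
    (hc : linearComb t c ∈ filtration p d n) : c ∈ filtration p d n := by
  by_cases h : c = 0
  · exact h ▸ zero_mem _
  · obtain ⟨w, hw⟩ := exists_isHighestTerm h
    exact hw.mem_filtration_iff.2 ((hw.linearComb ht).mem_filtration_iff.1 hc)

/- Modulo `E_n` the map `c ↦ ∑ c_w t_w` is an injective self-map of a finite set. -/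
theorem exists_linearComb_sub_mem_filtration [Fact p.Prime] (n : ℕ) (a : MagnusAlgebra p d) :
    ∃ c, linearComb t c - a ∈ filtration p d n := by
  have toTrunc_eq_iff_sub_mem (b c : MagnusAlgebra p d) :
      toTrunc p d n b = toTrunc p d n c ↔ b - c ∈ filtration p d n := by
    simp only [toTrunc_eq_iff, mem_filtration, sub_apply, sub_eq_zero]
  let lift : Trunc p d n → MagnusAlgebra p d := Function.surjInv (toTrunc_surjective n)
  have toTrunc_lift (q : Trunc p d n) : toTrunc p d n (lift q) = q := Function.surjInv_eq _ q
  have injective : Function.Injective fun q => toTrunc p d n (linearComb t (lift q)) := by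
    intro q q' h
    rw [← toTrunc_lift q, ← toTrunc_lift q', toTrunc_eq_iff_sub_mem]
    refine mem_filtration_of_linearComb_mem ht ?_
    rw [map_sub]
    exact (toTrunc_eq_iff_sub_mem _ _).1 h
  obtain ⟨q, hq⟩ := Finite.surjective_of_injective injective (toTrunc p d n a)
  exact ⟨lift q, (toTrunc_eq_iff_sub_mem _ _).1 hq⟩

theorem linearComb_surjective [Fact p.Prime] : Function.Surjective (linearComb t) := by
  intro a
  choose c hc using fun n => exists_linearComb_sub_mem_filtration ht n a
  exact (isCompact_range (continuous_linearComb t)).isClosed.mem_of_tendsto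
    (tendsto_of_sub_mem_filtration hc) (.of_forall fun n => Set.mem_range_self (c n))

/-- The automorphism `c ↦ ∑ c_w t_w` of the space of series attached to a family `t` such that
`X_w` is the highest term of `t_w`. -/
def linearCombEquiv [Fact p.Prime] : MagnusAlgebra p d ≃ₗ[ZMod p] MagnusAlgebra p d :=
  LinearEquiv.ofBijective (linearComb t) ⟨linearComb_injective ht, linearComb_surjective ht⟩

theorem linearCombEquiv_apply [Fact p.Prime] (c : MagnusAlgebra p d) :
    linearCombEquiv ht c = linearComb t c := rfl

theorem continuous_linearCombEquiv_symm [Fact p.Prime] : Continuous (linearCombEquiv ht).symm :=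
  ((continuous_linearComb t).homeoOfEquivCompactToT2
    (f := (linearCombEquiv ht).toEquiv)).symm.continuous

theorem linearCombEquiv_symm_mem_filtration [Fact p.Prime] {n : ℕ} {a : MagnusAlgebra p d}
    (ha : a ∈ filtration p d n) : (linearCombEquiv ht).symm a ∈ filtration p d n :=
  mem_filtration_of_linearComb_mem ht
    (by rwa [← linearCombEquiv_apply ht, LinearEquiv.apply_symm_apply])

end MagnusAlgebra

namespace MagnusAlgebra

variable {p d : ℕ}

/-- The restriction of a series to the monomials `X_w` with `w ∈ A`. -/
def restrict (A : Set (List (Fin d))) : MagnusAlgebra p d →ₗ[ZMod p] MagnusAlgebra p d where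
  toFun a := A.indicator a
  map_add' a b := Set.indicator_add A a b
  map_smul' r a := Set.indicator_const_smul A r a

theorem restrict_apply_of_mem {A : Set (List (Fin d))} {w : List (Fin d)} (hw : w ∈ A)
    (a : MagnusAlgebra p d) : restrict A a w = a w := Set.indicator_of_mem hw a

theorem restrict_apply_of_notMem {A : Set (List (Fin d))} {w : List (Fin d)} (hw : w ∉ A)
    (a : MagnusAlgebra p d) : restrict A a w = 0 := Set.indicator_of_notMem hw a

theorem continuous_restrict (A : Set (List (Fin d))) :
    Continuous (restrict A : MagnusAlgebra p d → MagnusAlgebra p d) :=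
  continuous_iff_coeff.2 fun w => by
    by_cases hw : w ∈ A
    · simpa only [restrict_apply_of_mem hw] using continuous_coeff w
    · simpa only [restrict_apply_of_notMem hw] using continuous_const

/-- The right quotient `∑_w a_{wv} X_w` of a series `a` by the monomial `X_v`. -/
def rightQuotient (v : List (Fin d)) : MagnusAlgebra p d →ₗ[ZMod p] MagnusAlgebra p d where
  toFun a := fun w => a (w ++ v)
  map_add' _ _ := rfl
  map_smul' _ _ := rfl

theorem continuous_rightQuotient (v : List (Fin d)) :
    Continuous (rightQuotient v : MagnusAlgebra p d → MagnusAlgebra p d) :=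
  continuous_iff_coeff.2 fun w => continuous_coeff (w ++ v)

/-- The right derivative: the coefficient of `X_j` in the decomposition
`a = a_∅ + ∑_j (∂_j a) X_j`. -/
def deriv (j : Fin d) : MagnusAlgebra p d →ₗ[ZMod p] MagnusAlgebra p d := rightQuotient [j]

theorem deriv_apply (j : Fin d) (a : MagnusAlgebra p d) (w : List (Fin d)) :
    deriv j a w = a (w ++ [j]) := rfl

theorem continuous_deriv (j : Fin d) :
    Continuous (deriv j : MagnusAlgebra p d → MagnusAlgebra p d) := continuous_rightQuotient [j]

theorem mul_X_apply_append (a : MagnusAlgebra p d) (w : List (Fin d)) (i j : Fin d) :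
    (a * X j : MagnusAlgebra p d) (w ++ [i]) = if i = j then a w else 0 := by
  split_ifs with h
  · subst h
    exact mul_monomial_apply_append w [i] a
  · refine mul_monomial_apply_of_not_isSuffix a fun hs => h ?_
    rw [List.singleton_suffix_iff_getLast?_eq_some] at hs
    simpa using hs

theorem mul_X_apply_nil (a : MagnusAlgebra p d) (j : Fin d) :
    (a * X j : MagnusAlgebra p d) [] = 0 :=
  mul_monomial_apply_of_not_isSuffix a (by simp)

theorem eq_sum_deriv_mul_X {a : MagnusAlgebra p d} (ha : a [] = 0) :
    a = ∑ j, deriv j a * X j := by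
  ext w
  rw [sum_apply]
  rcases List.eq_nil_or_concat w with rfl | ⟨w, i, rfl⟩
  · simp only [mul_X_apply_nil, ha, Finset.sum_const_zero]
  · simp only [List.concat_eq_append, mul_X_apply_append]
    exact ((Finset.sum_ite_eq Finset.univ i fun j => deriv j a w).trans
      (if_pos (Finset.mem_univ i))).symm

theorem deriv_mul_X (a : MagnusAlgebra p d) (i j : Fin d) :
    deriv i (a * X j) = if i = j then a else 0 := by
  ext w
  rw [deriv_apply, mul_X_apply_append]
  split_ifs <;> rfl

end MagnusAlgebra

/-! ### Combinatorially free relators -/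

/-- A family of series `rel i` whose highest terms `lead i` are nontrivial and combinatorially
free: the images `φ(ρ_i - 1)` of the relators. -/
structure FreeRelators (p d : ℕ) (I : Type*) where
  lead : I → List (Fin d)
  rel : I → MagnusAlgebra p d
  isHighestTerm : ∀ i, (rel i).IsHighestTerm (lead i)
  lead_ne_nil : ∀ i, lead i ≠ []
  free : CombinatoriallyFree lead

namespace FreeRelators

open MagnusAlgebra

variable {p d : ℕ} {I : Type*} (S : FreeRelators p d I)

theorem rel_nil (i : I) : S.rel i [] = 0 := by
  by_contra h
  have := ((S.isHighestTerm i).2 [] h).length_le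
  exact S.lead_ne_nil i (List.length_eq_zero_iff.1 (by simpa using this))

theorem finite_length_lead_le (n : ℕ) : {i | (S.lead i).length ≤ n}.Finite :=
  ((List.finite_length_le (Fin d) n).preimage S.free.injective.injOn)

theorem rel_mem_filtration {n : ℕ} {i : I} (h : n ≤ (S.lead i).length) :
    S.rel i ∈ filtration p d n := (S.isHighestTerm i).mem_filtration_iff.2 h

open Classical in
/-- The series with highest term `w`: `X_w` itself for a normal word, and `X_u f_i X_v` for
`w = u α_i v` with `u` normal. -/
def basis (w : List (Fin d)) : MagnusAlgebra p d :=
  if h : ∃ u i v, IsNormalWord S.lead u ∧ w = u ++ S.lead i ++ v then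
    monomial h.choose * S.rel h.choose_spec.choose * monomial h.choose_spec.choose_spec.choose
  else monomial w

theorem basis_of_isNormalWord {w : List (Fin d)} (hw : IsNormalWord S.lead w) :
    S.basis w = monomial w := by
  rw [basis, dif_neg]
  rintro ⟨u, i, v, -, rfl⟩
  exact not_isNormalWord_append u i v hw

theorem basis_append {u : List (Fin d)} (hu : IsNormalWord S.lead u) (i : I) (v : List (Fin d)) :
    S.basis (u ++ S.lead i ++ v) = monomial u * S.rel i * monomial v := by
  have h : ∃ u' i' v', IsNormalWord S.lead u' ∧ u ++ S.lead i ++ v = u' ++ S.lead i' ++ v' :=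
    ⟨u, i, v, hu, rfl⟩
  rw [basis, dif_pos h]
  obtain ⟨hu', huv⟩ := h.choose_spec.choose_spec.choose_spec
  obtain ⟨u_eq, i_eq, v_eq⟩ := S.free.append_unique hu hu' huv
  congr
  · exact u_eq.symm
  · exact i_eq.symm
  · exact v_eq.symm

variable [Fact p.Prime]

theorem isHighestTerm_basis (w : List (Fin d)) : (S.basis w).IsHighestTerm w := by
  by_cases hw : IsNormalWord S.lead w
  · rw [S.basis_of_isNormalWord hw]
    exact isHighestTerm_monomial w
  · obtain ⟨u, i, v, hu, rfl⟩ := exists_eq_append_of_not_isNormalWord S.lead_ne_nil hw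
    rw [S.basis_append hu]
    exact (S.isHighestTerm i).monomial_mul_mul u v

/-- The coordinates of a series with respect to the topological basis `S.basis`. -/
def coord : MagnusAlgebra p d ≃ₗ[ZMod p] MagnusAlgebra p d :=
  (linearCombEquiv S.isHighestTerm_basis).symm

theorem continuous_coord : Continuous S.coord := continuous_linearCombEquiv_symm _

theorem continuous_coord_symm : Continuous S.coord.symm := continuous_linearComb _

theorem coord_symm_monomial (w : List (Fin d)) : S.coord.symm (monomial w) = S.basis w :=
  linearComb_monomial S.isHighestTerm_basis w

theorem coord_basis (w : List (Fin d)) : S.coord (S.basis w) = monomial w := by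
  rw [← S.coord_symm_monomial, LinearEquiv.apply_symm_apply]

theorem coord_mem_filtration {n : ℕ} {a : MagnusAlgebra p d} (ha : a ∈ filtration p d n) :
    S.coord a ∈ filtration p d n := linearCombEquiv_symm_mem_filtration _ ha

/-- The normal part `∑ c_w X_w` of a series with coordinates `c`, the sum being over the normal
words `w`: a representative modulo the closed ideal generated by the relators. -/
def normalPart : MagnusAlgebra p d →ₗ[ZMod p] MagnusAlgebra p d :=
  (restrict {w | IsNormalWord S.lead w}).comp S.coord.toLinearMap

theorem normalPart_apply_of_isNormalWord (a : MagnusAlgebra p d) {w : List (Fin d)}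
    (hw : IsNormalWord S.lead w) : S.normalPart a w = S.coord a w := restrict_apply_of_mem hw _

theorem normalPart_apply_of_not_isNormalWord (a : MagnusAlgebra p d) {w : List (Fin d)}
    (hw : ¬ IsNormalWord S.lead w) : S.normalPart a w = 0 := restrict_apply_of_notMem hw _

theorem continuous_normalPart : Continuous S.normalPart :=
  (continuous_restrict _).comp S.continuous_coord

/-- The closed two-sided ideal generated by the relators, described as the subspace of the series
without normal part. -/
def ideal : Submodule (ZMod p) (MagnusAlgebra p d) := S.normalPart.ker

theorem mem_ideal {a : MagnusAlgebra p d} :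
    a ∈ S.ideal ↔ ∀ w, IsNormalWord S.lead w → S.coord a w = 0 := by
  rw [ideal, LinearMap.mem_ker]
  constructor
  · intro h w hw
    rw [← S.normalPart_apply_of_isNormalWord a hw, h, zero_apply]
  · intro h
    ext w
    by_cases hw : IsNormalWord S.lead w
    · rw [S.normalPart_apply_of_isNormalWord a hw, h w hw, zero_apply]
    · rw [S.normalPart_apply_of_not_isNormalWord a hw, zero_apply]

theorem isClosed_ideal : IsClosed (S.ideal : Set (MagnusAlgebra p d)) :=
  isClosed_singleton.preimage S.continuous_normalPart

theorem monomial_mul_rel_mul_monomial_mem {u : List (Fin d)} (hu : IsNormalWord S.lead u) (i : I)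
    (v : List (Fin d)) : monomial u * S.rel i * monomial v ∈ S.ideal := by
  rw [← S.basis_append hu, mem_ideal, coord_basis]
  intro w hw
  rw [monomial_apply, if_neg]
  rintro rfl
  exact not_isNormalWord_append u i v hw

theorem map_mem_of_mem_ideal {Y : Type*} [AddCommGroup Y] [Module (ZMod p) Y] [TopologicalSpace Y]
    (L : MagnusAlgebra p d →ₗ[ZMod p] Y) (hL : Continuous L)
    (T : Submodule (ZMod p) Y) (hT : IsClosed (T : Set Y))
    (h : ∀ u, IsNormalWord S.lead u → ∀ i v, L (monomial u * S.rel i * monomial v) ∈ T)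
    {a : MagnusAlgebra p d} (ha : a ∈ S.ideal) : L a ∈ T := by
  have := map_mem_of_monomial (L.comp S.coord.symm.toLinearMap) (hL.comp S.continuous_coord_symm)
    T hT {w | ¬ IsNormalWord S.lead w} ?_ (c := S.coord a) ?_
  · simpa using this
  · intro w hw
    obtain ⟨u, i, v, hu, rfl⟩ := exists_eq_append_of_not_isNormalWord S.lead_ne_nil hw
    rw [LinearMap.comp_apply, LinearEquiv.coe_coe, coord_symm_monomial, S.basis_append hu]
    exact h u hu i v
  · intro w hw
    exact S.mem_ideal.1 ha w (by simpa using hw)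

theorem coord_symm_normalPart (a : MagnusAlgebra p d) :
    S.coord.symm (S.normalPart a) = S.normalPart a := by
  have := map_eq_zero_of_monomial (S.coord.symm.toLinearMap - LinearMap.id)
    (S.continuous_coord_symm.sub continuous_id) {w | IsNormalWord S.lead w} ?_
    (c := S.normalPart a) (fun w hw => S.normalPart_apply_of_not_isNormalWord a hw)
  · simpa [sub_eq_zero] using this
  · intro w hw
    simp [coord_symm_monomial, S.basis_of_isNormalWord hw]

theorem coord_normalPart (a : MagnusAlgebra p d) : S.coord (S.normalPart a) = S.normalPart a := by
  conv_lhs => rw [← S.coord_symm_normalPart, LinearEquiv.apply_symm_apply]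

theorem coord_of_support_isNormalWord {c : MagnusAlgebra p d}
    (hc : ∀ w, ¬ IsNormalWord S.lead w → c w = 0) : S.coord c = c := by
  have : S.normalPart (S.coord.symm c) = c := by
    ext w
    by_cases hw : IsNormalWord S.lead w
    · rw [S.normalPart_apply_of_isNormalWord _ hw, LinearEquiv.apply_symm_apply]
    · rw [S.normalPart_apply_of_not_isNormalWord _ hw, hc w hw]
  rw [← this, S.coord_normalPart]

theorem sub_normalPart_mem (a : MagnusAlgebra p d) : a - S.normalPart a ∈ S.ideal := by
  rw [mem_ideal]
  intro w hw
  rw [map_sub, coord_normalPart, sub_apply, S.normalPart_apply_of_isNormalWord a hw, sub_self]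

theorem mul_mem_ideal_right {a : MagnusAlgebra p d} (ha : a ∈ S.ideal) (b : MagnusAlgebra p d) :
    a * b ∈ S.ideal := by
  refine map_mem_of_monomial (LinearMap.mulLeft (ZMod p) a) (continuous_const_mul a) S.ideal
    S.isClosed_ideal Set.univ (fun m _ => ?_) (c := b) (by simp)
  refine S.map_mem_of_mem_ideal (LinearMap.mulRight (ZMod p) (monomial m))
    (continuous_mul_const _) S.ideal S.isClosed_ideal (fun u hu i v => ?_) ha
  rw [LinearMap.mulRight_apply, mul_assoc, monomial_mul_monomial]
  exact S.monomial_mul_rel_mul_monomial_mem hu i _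

theorem mul_rel_mem_ideal (a : MagnusAlgebra p d) (i : I) : a * S.rel i ∈ S.ideal := by
  have sub_mem : (a - S.normalPart a) * S.rel i ∈ S.ideal :=
    S.mul_mem_ideal_right (S.sub_normalPart_mem a) _
  have normalPart_mem : S.normalPart a * S.rel i ∈ S.ideal := by
    refine map_mem_of_monomial (LinearMap.mulRight (ZMod p) (S.rel i)) (continuous_mul_const _)
      S.ideal S.isClosed_ideal {w | IsNormalWord S.lead w} (fun u hu => ?_)
      (fun w hw => S.normalPart_apply_of_not_isNormalWord a hw)
    have := S.monomial_mul_rel_mul_monomial_mem hu i []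
    rwa [monomial_nil, mul_one] at this
  have := S.ideal.add_mem sub_mem normalPart_mem
  rwa [← add_mul, sub_add_cancel] at this

theorem mul_mem_ideal_left (a : MagnusAlgebra p d) {b : MagnusAlgebra p d} (hb : b ∈ S.ideal) :
    a * b ∈ S.ideal := by
  refine S.map_mem_of_mem_ideal (LinearMap.mulLeft (ZMod p) a) (continuous_const_mul a) S.ideal
    S.isClosed_ideal (fun u _ i v => ?_) hb
  rw [LinearMap.mulLeft_apply, ← mul_assoc, ← mul_assoc]
  exact S.mul_mem_ideal_right (S.mul_rel_mem_ideal _ i) _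

theorem rel_mem_ideal (i : I) : S.rel i ∈ S.ideal := by
  simpa using S.mul_rel_mem_ideal 1 i

/-- The `i`-th coordinate `h_i` of an element of the ideal `J` of the relators, written
`∑_i h_i f_i` modulo `J M` with `h_i` a combination of normal words, `M` being the augmentation
ideal. -/
def relCoeff (i : I) : MagnusAlgebra p d →ₗ[ZMod p] MagnusAlgebra p d :=
  (restrict {w | IsNormalWord S.lead w}).comp
    ((rightQuotient (S.lead i)).comp S.coord.toLinearMap)

theorem relCoeff_apply_of_isNormalWord (i : I) (a : MagnusAlgebra p d) {w : List (Fin d)}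
    (hw : IsNormalWord S.lead w) : S.relCoeff i a w = S.coord a (w ++ S.lead i) :=
  restrict_apply_of_mem hw _

theorem relCoeff_apply_of_not_isNormalWord (i : I) (a : MagnusAlgebra p d) {w : List (Fin d)}
    (hw : ¬ IsNormalWord S.lead w) : S.relCoeff i a w = 0 := restrict_apply_of_notMem hw _

theorem continuous_relCoeff (i : I) : Continuous (S.relCoeff i) :=
  (continuous_restrict _).comp ((continuous_rightQuotient _).comp S.continuous_coord)

open Classical in
theorem relCoeff_monomial_mul_rel {u : List (Fin d)} (hu : IsNormalWord S.lead u) (i k : I) :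
    S.relCoeff k (monomial u * S.rel i) = if k = i then monomial u else 0 := by
  have eq_basis : monomial u * S.rel i = S.basis (u ++ S.lead i) := by
    have := S.basis_append hu i []
    rw [List.append_nil, monomial_nil, mul_one] at this
    exact this.symm
  rw [eq_basis]
  ext w
  by_cases hw : IsNormalWord S.lead w
  · rw [S.relCoeff_apply_of_isNormalWord k _ hw, coord_basis, monomial_apply]
    split_ifs with h h' h'
    · subst h'
      rw [monomial_apply, if_pos (List.append_inj_left' h rfl)]
    · exact absurd (S.free.append_unique hw hu (v := []) (v' := []) (by simpa using h)).2.1 h'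
    · subst h'
      rw [monomial_apply, if_neg]
      rintro rfl
      exact h rfl
    · rfl
  · rw [S.relCoeff_apply_of_not_isNormalWord k _ hw]
    split_ifs
    · rw [monomial_apply, if_neg]
      rintro rfl
      exact hw hu
    · rfl

theorem relCoeff_mul_X {g : MagnusAlgebra p d} (hg : g ∈ S.ideal) (j : Fin d) (k : I) :
    S.relCoeff k (g * X j) = 0 := by
  have := S.map_mem_of_mem_ideal ((S.relCoeff k).comp (LinearMap.mulRight (ZMod p) (X j)))
    ((S.continuous_relCoeff k).comp (continuous_mul_const _)) ⊥ (by simp) ?_ hg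
  · simpa using this
  · intro u hu i v
    rw [LinearMap.comp_apply, LinearMap.mulRight_apply, mul_assoc, monomial_mul_X,
      ← S.basis_append hu, Submodule.mem_bot]
    ext w
    by_cases hw : IsNormalWord S.lead w
    · rw [S.relCoeff_apply_of_isNormalWord k _ hw, coord_basis, monomial_apply, if_neg, zero_apply]
      intro h
      have := (S.free.append_unique hw hu (v := []) (v' := v ++ [j]) (by simpa using h)).2.2
      simp at this
    · exact S.relCoeff_apply_of_not_isNormalWord k _ hw

theorem relCoeff_mul_of_mem {g b : MagnusAlgebra p d} (hg : g ∈ S.ideal) (hb : b [] = 0) (k : I) :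
    S.relCoeff k (g * b) = 0 := by
  rw [eq_sum_deriv_mul_X hb, Finset.mul_sum, map_sum]
  refine Finset.sum_eq_zero fun j _ => ?_
  rw [← mul_assoc]
  exact S.relCoeff_mul_X (S.mul_mem_ideal_right hg _) j k

open Classical in
theorem relCoeff_mul_rel (a : MagnusAlgebra p d) (i k : I) :
    S.relCoeff k (a * S.rel i) = if k = i then S.normalPart a else 0 := by
  have eq_normalPart : S.relCoeff k (a * S.rel i) =
      S.relCoeff k (S.normalPart a * S.rel i) := by
    rw [← sub_eq_zero, ← map_sub, ← sub_mul]
    exact S.relCoeff_mul_of_mem (S.sub_normalPart_mem a) (S.rel_nil i) k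
  rw [eq_normalPart]
  have := map_eq_zero_of_monomial ((S.relCoeff k).comp (LinearMap.mulRight (ZMod p) (S.rel i)) -
    if k = i then LinearMap.id else 0) ?_ {w | IsNormalWord S.lead w} ?_
    (c := S.normalPart a) (fun w hw => S.normalPart_apply_of_not_isNormalWord a hw)
  · rw [LinearMap.sub_apply, sub_eq_zero] at this
    refine this.trans ?_
    split_ifs <;> rfl
  · refine ((S.continuous_relCoeff k).comp (continuous_mul_const _)).sub ?_
    split_ifs
    · exact continuous_id
    · exact continuous_const
  · intro w hw
    rw [LinearMap.sub_apply, sub_eq_zero]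
    refine (S.relCoeff_monomial_mul_rel hw i k).trans ?_
    split_ifs <;> rfl

theorem mul_relCoeff_sub_relCoeff_mul_mem (a : MagnusAlgebra p d) {g : MagnusAlgebra p d}
    (hg : g ∈ S.ideal) (k : I) :
    a * S.relCoeff k g - S.relCoeff k (a * g) ∈ S.ideal := by
  classical
  refine S.map_mem_of_mem_ideal ((LinearMap.mulLeft (ZMod p) a).comp (S.relCoeff k) -
    (S.relCoeff k).comp (LinearMap.mulLeft (ZMod p) a))
    (((continuous_const_mul a).comp (S.continuous_relCoeff k)).sub
      ((S.continuous_relCoeff k).comp (continuous_const_mul a))) S.ideal S.isClosed_ideal ?_ hg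
  intro u hu i v
  simp only [LinearMap.sub_apply, LinearMap.comp_apply, LinearMap.mulLeft_apply]
  by_cases hv : v = []
  · subst hv
    rw [monomial_nil, mul_one, S.relCoeff_monomial_mul_rel hu, ← mul_assoc, S.relCoeff_mul_rel]
    split_ifs
    · exact S.sub_normalPart_mem _
    · simp
  · have monomial_nil_eq_zero : (monomial v : MagnusAlgebra p d) [] = 0 := by
      rw [monomial_apply, if_neg (Ne.symm hv)]
    rw [← mul_assoc a, S.relCoeff_mul_of_mem
      (S.mul_mem_ideal_left a (S.mul_rel_mem_ideal _ i)) monomial_nil_eq_zero,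
      S.relCoeff_mul_of_mem (S.mul_rel_mem_ideal _ i) monomial_nil_eq_zero]
    simp

end FreeRelators

/-! ### Finite `p`-groups acting on finite modules in characteristic `p` -/

section GroupAlgebra

variable {p : ℕ} {P : Type*} [Group P]

theorem natCast_monoidAlgebra_zmod : (p : MonoidAlgebra (ZMod p) P) = 0 := by
  rw [← map_natCast (algebraMap (ZMod p) (MonoidAlgebra (ZMod p) P)), ZMod.natCast_self, map_zero]

variable {N : Type*} [AddCommGroup N] [Module (MonoidAlgebra (ZMod p) P) N]

variable (N) in
/-- The submodule of the elements of an `𝔽_p[P]`-module that are fixed by `P`. -/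
def fixedSubmodule : Submodule (MonoidAlgebra (ZMod p) P) N where
  carrier := {m | ∀ g : P, MonoidAlgebra.of (ZMod p) P g • m = m}
  add_mem' hm hm' g := by rw [smul_add, hm g, hm' g]
  zero_mem' g := smul_zero _
  smul_mem' a m hm := by
    intro g
    induction a using MonoidAlgebra.induction_on with
    | of h => rw [hm h, hm g]
    | add a b ha hb => rw [add_smul, smul_add, ha, hb]
    | smul r a ha =>
      rw [← algebraMap_smul (MonoidAlgebra (ZMod p) P) r a, smul_eq_mul, mul_smul, ← mul_smul,
        ← Algebra.commutes, mul_smul, ha]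

variable [Fact p.Prime]

theorem fixedSubmodule_ne_bot (hP : IsPGroup p P) [Finite N] [Nontrivial N] :
    fixedSubmodule (p := p) (P := P) N ≠ ⊥ := by
  let _ : MulAction P N := MulAction.compHom N (MonoidAlgebra.of (ZMod p) P)
  obtain ⟨m, hm⟩ := exists_ne (0 : N)
  have smul_eq_zero : p • m = 0 := by
    rw [← Nat.cast_smul_eq_nsmul (MonoidAlgebra (ZMod p) P), natCast_monoidAlgebra_zmod, zero_smul]
  have dvd_card : p ∣ Nat.card N :=
    (addOrderOf_eq_prime smul_eq_zero hm).symm.dvd.trans (addOrderOf_dvd_natCard m)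
  obtain ⟨b, hb, hb0⟩ := hP.exists_fixed_point_of_prime_dvd_card_of_fixed_point N dvd_card
    (a := 0) fun g => smul_zero (MonoidAlgebra.of (ZMod p) P g)
  exact (Submodule.ne_bot_iff _).2 ⟨b, hb, hb0.symm⟩

theorem exists_prod_of_sub_one_smul_eq_zero (hP : IsPGroup p P) [Finite N] :
    ∃ n, ∀ l : List P, n ≤ l.length →
      ∀ m : N, (l.map fun g => MonoidAlgebra.of (ZMod p) P g - 1).prod • m = 0 := by
  induction h : Nat.card N using Nat.strong_induction_on generalizing N with
  | _ c ih =>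
    subst h
    rcases subsingleton_or_nontrivial N with _ | _
    · exact ⟨0, fun _ _ _ => Subsingleton.elim _ _⟩
    let K := fixedSubmodule (p := p) (P := P) N
    have : Finite (N ⧸ K) := Finite.of_surjective _ (Submodule.mkQ_surjective K)
    have card_lt : Nat.card (N ⧸ K) < Nat.card N := by
      have := (Submodule.nontrivial_iff_ne_bot (p := K)).2 (fixedSubmodule_ne_bot hP)
      rw [K.toAddSubgroup.card_eq_card_quotient_mul_card_addSubgroup]
      exact lt_mul_of_one_lt_right Nat.card_pos (Finite.one_lt_card (α := K))
    obtain ⟨n, hn⟩ := ih _ card_lt (N := N ⧸ K) rfl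
    refine ⟨n + 1, fun l hl m => ?_⟩
    obtain _ | ⟨g, l⟩ := l
    · simp at hl
    have mem_fixed : (l.map fun g => MonoidAlgebra.of (ZMod p) P g - 1).prod • m ∈ K := by
      rw [← Submodule.Quotient.mk_eq_zero, Submodule.Quotient.mk_smul]
      exact hn l (by simpa using hl) _
    rw [List.map_cons, List.prod_cons, mul_smul, sub_smul, one_smul, mem_fixed g, sub_self]

instance [Finite P] : Finite (MonoidAlgebra (ZMod p) P) :=
  Finite.of_injective (fun a : MonoidAlgebra (ZMod p) P => (a.coeff : P → ZMod p))
    fun a b h => by cases a; cases b; congr; exact DFunLike.coe_injective h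

theorem exists_prod_of_sub_one_eq_zero [Finite P] (hP : IsPGroup p P) :
    ∃ n, ∀ l : List P, n ≤ l.length →
      (l.map fun g => MonoidAlgebra.of (ZMod p) P g - 1).prod = 0 := by
  obtain ⟨n, hn⟩ := exists_prod_of_sub_one_smul_eq_zero (N := MonoidAlgebra (ZMod p) P) hP
  exact ⟨n, fun l hl => by simpa only [smul_eq_mul, mul_one] using hn l hl 1⟩

end GroupAlgebra

/-! ### Evaluation of series at nilpotent families -/

namespace MagnusAlgebra

variable {p d : ℕ} {A : Type*} [Ring A] [Algebra (ZMod p) A]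

/-- The evaluation of a series at a family for which all words of length `> n` vanish. -/
def evalLinear (a : Fin d → A) (n : ℕ) : MagnusAlgebra p d →ₗ[ZMod p] A where
  toFun c := ∑ w ∈ wordsLE d n, c w • (w.map a).prod
  map_add' b c := by simp [add_smul, Finset.sum_add_distrib]
  map_smul' r c := by simp [Finset.smul_sum, mul_smul]

theorem evalLinear_apply (a : Fin d → A) (n : ℕ) (c : MagnusAlgebra p d) :
    evalLinear a n c = ∑ w ∈ wordsLE d n, c w • (w.map a).prod := rfl

theorem continuous_evalLinear [TopologicalSpace A] [IsTopologicalRing A] (a : Fin d → A) (n : ℕ) :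
    Continuous (evalLinear a n : MagnusAlgebra p d →ₗ[ZMod p] A) :=
  continuous_finsetSum _ fun w _ =>
    (continuous_of_discreteTopology (f := fun r : ZMod p => r • (w.map a).prod)).comp
      (continuous_coeff w)

variable (a : Fin d → A) {n : ℕ} (hn : ∀ w : List (Fin d), n < w.length → (w.map a).prod = 0)

include hn in
theorem evalLinear_monomial (w : List (Fin d)) :
    evalLinear a n (monomial w : MagnusAlgebra p d) = (w.map a).prod := by
  simp only [evalLinear_apply, monomial_apply, ite_smul, one_smul, zero_smul]
  rw [Finset.sum_ite_eq']
  split_ifs with h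
  · rfl
  · exact (hn w (by simpa using h)).symm

include hn in
theorem evalLinear_mul (b c : MagnusAlgebra p d) :
    evalLinear a n (b * c) = evalLinear a n b * evalLinear a n c := by
  let _ : TopologicalSpace A := ⊥
  have : DiscreteTopology A := ⟨rfl⟩
  have map_monomial_mul : ∀ u, (evalLinear a n).comp (LinearMap.mulLeft (ZMod p) (monomial u)) =
      (LinearMap.mulLeft (ZMod p) (evalLinear a n (monomial u : MagnusAlgebra p d))).comp
        (evalLinear a n) := by
    intro u
    refine linearMap_ext ((continuous_evalLinear a n).comp (continuous_const_mul _))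
      ((continuous_const_mul _).comp (continuous_evalLinear a n)) fun v => ?_
    simp [monomial_mul_monomial, evalLinear_monomial a hn]
  have map_mul_right : (evalLinear a n).comp (LinearMap.mulRight (ZMod p) c) =
      (LinearMap.mulRight (ZMod p) (evalLinear a n c)).comp (evalLinear a n) := by
    refine linearMap_ext ((continuous_evalLinear a n).comp (continuous_mul_const _))
      ((continuous_mul_const _).comp (continuous_evalLinear a n)) fun v => ?_
    exact LinearMap.congr_fun (map_monomial_mul v) c
  exact LinearMap.congr_fun map_mul_right b

/-- The evaluation of a series at a family for which all words of length `> n` vanish, as an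
algebra homomorphism. -/
def eval : MagnusAlgebra p d →ₐ[ZMod p] A :=
  AlgHom.ofLinearMap (evalLinear a n)
    (by rw [← monomial_nil, evalLinear_monomial a hn]; simp) (evalLinear_mul a hn)

theorem eval_monomial (w : List (Fin d)) : (eval a hn : MagnusAlgebra p d →ₐ[ZMod p] A)
    (monomial w) = (w.map a).prod := evalLinear_monomial a hn w

theorem eval_X (j : Fin d) : (eval a hn : MagnusAlgebra p d →ₐ[ZMod p] A) (X j) = a j := by
  simp [X, eval_monomial a hn]

theorem continuous_eval [TopologicalSpace A] [IsTopologicalRing A] :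
    Continuous (eval a hn : MagnusAlgebra p d →ₐ[ZMod p] A) := continuous_evalLinear a n

theorem eval_eq_zero_of_mem_filtration {c : MagnusAlgebra p d} (hc : c ∈ filtration p d (n + 1)) :
    eval a hn c = 0 := by
  refine Finset.sum_eq_zero fun w hw => ?_
  rw [mem_filtration.1 hc w (by simpa [Nat.lt_succ_iff] using hw), zero_smul]

end MagnusAlgebra

/-! ### Generation of free pro-`p` groups -/

section Generation

variable {p : ℕ} {F : Type*} [Group F] [TopologicalSpace F] [IsTopologicalGroup F]

theorem IsProP.exists_openNormalSubgroup_subset (hF : IsProP p F) {W : Set F} (hW : IsOpen W)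
    (one_mem : (1 : F) ∈ W) : ∃ U : OpenNormalSubgroup F, (U : Set F) ⊆ W := by
  have := hF.compactSpace
  have := hF.totallyDisconnectedSpace
  exact ProfiniteGrp.exist_openNormalSubgroup_sub_open_nhds_of_one hW one_mem

theorem IsProP.finite_quotient (hF : IsProP p F) (U : OpenNormalSubgroup F) :
    Finite (F ⧸ U.toSubgroup) := by
  have := hF.compactSpace
  exact U.toSubgroup.quotient_finite_of_isOpen U.isOpen'

theorem exists_normal_ne_top_ge {P : Type*} [Group P] [Group.IsNilpotent P]
    [IsCoatomic (Subgroup P)] {H : Subgroup P} (hH : H ≠ ⊤) :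
    ∃ M : Subgroup P, M.Normal ∧ M ≠ ⊤ ∧ H ≤ M := by
  obtain ⟨M, hM, hHM⟩ := (eq_top_or_exists_le_coatom H).resolve_left hH
  exact ⟨M, Subgroup.NormalizerCondition.normal_of_coatom M
    Group.normalizerCondition_of_isNilpotent hM, hM.1, hHM⟩

variable [Fact p.Prime]

theorem IsProP.exists_openNormalSubgroup_ne_top_ge (hF : IsProP p F) {H : Subgroup F}
    (hH : IsClosed (H : Set F)) (hne : H ≠ ⊤) :
    ∃ U : OpenNormalSubgroup F, U.toSubgroup ≠ ⊤ ∧ H ≤ U.toSubgroup := by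
  obtain ⟨y, -, hy⟩ := SetLike.exists_of_lt hne.lt_top
  obtain ⟨U, hU⟩ := hF.exists_openNormalSubgroup_subset
    (W := {u | y * u ∉ H}) (hH.isOpen_compl.preimage (continuous_const_mul y)) (by simpa using hy)
  let q := QuotientGroup.mk' U.toSubgroup
  have map_ne_top : H.map q ≠ ⊤ := by
    intro h
    obtain ⟨z, hz, hzy⟩ : q y ∈ H.map q := h ▸ Subgroup.mem_top _
    exact hU (show y⁻¹ * z ∈ U.toSubgroup from QuotientGroup.eq.1 hzy.symm) (by simpa using hz)
  have := hF.finite_quotient U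
  have := (hF.isPGroup_quotient U).isNilpotent
  obtain ⟨M, hM, hMtop, hle⟩ := exists_normal_ne_top_ge map_ne_top
  refine ⟨⟨⟨M.comap q, Subgroup.isOpen_mono (fun u hu => ?_) U.isOpen'⟩, inferInstance⟩, ?_,
    Subgroup.map_le_iff_le_comap.1 hle⟩
  · rw [Subgroup.mem_comap, show q u = 1 from (QuotientGroup.eq_one_iff u).2 hu]
    exact M.one_mem
  · intro h
    exact hMtop (Subgroup.comap_injective (QuotientGroup.mk'_surjective _)
      (h.trans (Subgroup.comap_top q).symm))

variable {d : ℕ} {x : Fin d → F}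

theorem IsFreeProP.eq_top_of_isClosed (hF : IsFreeProP p x) {H : Subgroup F}
    (hH : IsClosed (H : Set F)) (hx : ∀ j, x j ∈ H) : H = ⊤ := by
  by_contra hne
  obtain ⟨U, hU, hHU⟩ := hF.toIsProP.exists_openNormalSubgroup_ne_top_ge hH hne
  have := hF.toIsProP.finite_quotient U
  have : DiscreteTopology (F ⧸ U.toSubgroup) := QuotientGroup.discreteTopology U.isOpen'
  let Q := Shrink.{0} (F ⧸ U.toSubgroup)
  let _ : TopologicalSpace Q := ⊥
  have : DiscreteTopology Q := ⟨rfl⟩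
  let e : F ⧸ U.toSubgroup ≃* Q := Shrink.mulEquiv.symm
  let q : F →ₜ* Q := ⟨e.toMonoidHom.comp (QuotientGroup.mk' U.toSubgroup),
    (continuous_of_discreteTopology (f := e)).comp QuotientGroup.continuous_mk⟩
  have q_eq_one_iff (y : F) : q y = 1 ↔ y ∈ U.toSubgroup :=
    e.map_eq_one_iff.trans (QuotientGroup.eq_one_iff y)
  have q_eq_one : q = 1 :=
    (hF.existsUnique_hom Q ((hF.isPGroup_quotient U).of_equiv e) fun _ => 1).unique
      (fun i => (q_eq_one_iff _).2 (hHU (hx i))) fun i => rfl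
  exact hU (eq_top_iff.2 fun y _ => (q_eq_one_iff y).1 (DFunLike.congr_fun q_eq_one y))

theorem IsFreeProP.monoidHom_ext (hF : IsFreeProP p x) {N : Type*} [Monoid N] [TopologicalSpace N]
    [T2Space N] {f g : F →* N} (hf : Continuous f) (hg : Continuous g)
    (h : ∀ j, f (x j) = g (x j)) : f = g := by
  have : f.eqLocus g = ⊤ := hF.eq_top_of_isClosed (isClosed_eq hf hg) h
  exact MonoidHom.eq_of_eqOn_top fun y _ => (this ▸ Subgroup.mem_top y : y ∈ f.eqLocus g)

theorem IsFreeProP.magnus_nil (hF : IsFreeProP p x) (y : F) : hF.magnus y [] = 1 := by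
  let ε : F →* ZMod p :=
    { toFun := fun y => hF.magnus y []
      map_one' := by simp [MagnusAlgebra.one_apply]
      map_mul' := fun y z => by rw [map_mul, MagnusAlgebra.mul_nil] }
  have : ε = 1 := hF.monoidHom_ext
    ((MagnusAlgebra.continuous_coeff []).comp hF.continuous_magnus) continuous_const fun j => by
      simp [ε, hF.magnus_generator, MagnusAlgebra.one_apply, MagnusAlgebra.X,
        MagnusAlgebra.monomial]
  exact DFunLike.congr_fun this y

theorem IsFreeProP.magnus_sub_one_nil (hF : IsFreeProP p x) (y : F) : (hF.magnus y - 1) [] = 0 := by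
  rw [MagnusAlgebra.sub_apply, hF.magnus_nil, MagnusAlgebra.one_apply, if_pos rfl, sub_self]

end Generation

/-! ### Topology of completed group algebras -/

local instance (p : ℕ) (P : Type*) : TopologicalSpace (MonoidAlgebra (ZMod p) P) := ⊥

local instance (p : ℕ) (P : Type*) : DiscreteTopology (MonoidAlgebra (ZMod p) P) := ⟨rfl⟩

namespace CompletedGroupAlgebra

variable {p : ℕ} {G : Type*} [Group G] [TopologicalSpace G]

@[ext] theorem ext {a b : CompletedGroupAlgebra p G} (h : ∀ V, proj p V a = proj p V b) : a = b :=
  Subtype.ext (funext h)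

theorem continuous_rng_iff {Y : Type*} [TopologicalSpace Y] {f : Y → CompletedGroupAlgebra p G} :
    Continuous f ↔ ∀ V, Continuous fun y => proj p V (f y) := by
  rw [continuous_iInf_rng]
  exact forall_congr' fun V => continuous_induced_rng

theorem continuous_proj (V : OpenNormalSubgroup G) :
    Continuous (proj p V : CompletedGroupAlgebra p G → _) :=
  continuous_rng_iff.1 continuous_id V

instance : T2Space (CompletedGroupAlgebra p G) where
  t2 a b hab := by
    obtain ⟨V, hV⟩ : ∃ V, proj p V a ≠ proj p V b := by
      by_contra! h
      exact hab (ext h)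
    exact separated_by_continuous (continuous_proj V) hV

instance : IsTopologicalRing (CompletedGroupAlgebra p G) where
  continuous_add := continuous_rng_iff.2 fun V => by
    simp only [map_add]
    exact ((continuous_proj V).comp continuous_fst).add ((continuous_proj V).comp continuous_snd)
  continuous_mul := continuous_rng_iff.2 fun V => by
    simp only [map_mul]
    exact ((continuous_proj V).comp continuous_fst).mul ((continuous_proj V).comp continuous_snd)
  continuous_neg := continuous_rng_iff.2 fun V => by
    simp only [map_neg]
    exact (continuous_proj V).neg

theorem proj_of (V : OpenNormalSubgroup G) (g : G) :
    proj p V (of p g) = MonoidAlgebra.of (ZMod p) (G ⧸ V.toSubgroup) g := rfl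

theorem of_mul (g h : G) : of p (g * h) = of p g * of p h :=
  ext fun V => by simp only [map_mul, proj_of, QuotientGroup.mk_mul]

theorem of_one : of p (1 : G) = 1 :=
  ext fun V => by simp only [map_one, proj_of, QuotientGroup.mk_one]

theorem mapDomain_proj (z : CompletedGroupAlgebra p G) {U V : OpenNormalSubgroup G} (h : U ≤ V) :
    MonoidAlgebra.mapDomainAlgHom (ZMod p) (ZMod p)
      (QuotientGroup.map U.toSubgroup V.toSubgroup (MonoidHom.id G) h) (proj p U z) = proj p V z :=
  z.2 U V h

variable {F : Type*} [Group F] [TopologicalSpace F] (π : F →ₜ* G)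

theorem proj_map (V : OpenNormalSubgroup G) (z : CompletedGroupAlgebra p F) :
    proj p V (map p π z) = MonoidAlgebra.mapDomainAlgHom (ZMod p) (ZMod p)
        (QuotientGroup.map (comapOpenNormal π V).toSubgroup V.toSubgroup (π : F →* G) le_rfl)
          (proj p (comapOpenNormal π V) z) := rfl

theorem map_of (y : F) : map p π (of p y) = of p (π y) :=
  ext fun V => by
    rw [proj_map, proj_of, proj_of, MonoidAlgebra.of_apply, MonoidAlgebra.mapDomainAlgHom_apply,
      MonoidAlgebra.mapDomain_single]
    rfl

theorem continuous_map : Continuous (map p π) :=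
  continuous_rng_iff.2 fun V => by
    simp only [proj_map]
    exact continuous_of_discreteTopology.comp (continuous_proj _)

theorem exists_openNormalSubgroup_forall_mul_eq [IsTopologicalGroup G] (hG : IsProP p G)
    {Y : Type*} [TopologicalSpace Y] [DiscreteTopology Y] {f : G → Y} (hf : Continuous f) :
    ∃ V : OpenNormalSubgroup G, ∀ g, ∀ v ∈ V.toSubgroup, f (g * v) = f g := by
  have := hG.compactSpace
  have eventually_mul_eq : ∀ᶠ v in nhds (1 : G), ∀ g ∈ (Set.univ : Set G), f (g * v) = f g := by
    refine isCompact_univ.eventually_forall_of_forall_eventually fun g _ => ?_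
    have isOpen_eq : IsOpen {z : G × G | f (z.2 * z.1) = f z.2} :=
      (isOpen_discrete {q : Y × Y | q.1 = q.2}).preimage
        (f := fun z : G × G => (f (z.2 * z.1), f z.2)) (by fun_prop)
    exact isOpen_eq.mem_nhds (by simp)
  obtain ⟨W, hW, isOpen_W, one_mem_W⟩ := mem_nhds_iff.1 eventually_mul_eq
  obtain ⟨V, hV⟩ := hG.exists_openNormalSubgroup_subset isOpen_W one_mem_W
  exact ⟨V, fun g v hv => hW (hV hv) g trivial⟩

theorem exists_linearMap_of_continuous [IsTopologicalGroup G] (hG : IsProP p G)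
    {Y : Type*} [AddCommGroup Y] [Module (ZMod p) Y] [TopologicalSpace Y] [DiscreteTopology Y]
    {f : G → Y} (hf : Continuous f) :
    ∃ L : CompletedGroupAlgebra p G →ₗ[ZMod p] Y, Continuous L ∧ ∀ g, L (of p g) = f g := by
  obtain ⟨V, hV⟩ := exists_openNormalSubgroup_forall_mul_eq hG hf
  let f' : G ⧸ V.toSubgroup → Y := Quotient.lift f fun a b hab => by
    simpa using (hV a _ (QuotientGroup.leftRel_apply.1 hab)).symm
  let L : MonoidAlgebra (ZMod p) (G ⧸ V.toSubgroup) →ₗ[ZMod p] Y :=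
    (Finsupp.linearCombination (ZMod p) f').comp
      (MonoidAlgebra.coeffLinearEquiv (ZMod p)).toLinearMap
  refine ⟨L.comp (proj p V).toLinearMap,
    (continuous_of_discreteTopology (f := L)).comp (continuous_proj V), fun g => ?_⟩
  change L (proj p V (of p g)) = f g
  rw [proj_of, MonoidAlgebra.of_apply]
  change Finsupp.linearCombination (ZMod p) f' (MonoidAlgebra.single _ 1).coeff = _
  rw [MonoidAlgebra.coeff_single, Finsupp.linearCombination_single, one_smul]
  rfl

end CompletedGroupAlgebra

/-! ### The homomorphism from the Magnus algebra to the completed group algebra -/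

namespace IsFreeProP

open MagnusAlgebra CompletedGroupAlgebra

variable {p d : ℕ} [Fact p.Prime] {F : Type*} [Group F] [TopologicalSpace F]
  [IsTopologicalGroup F] {x : Fin d → F} (hF : IsFreeProP p x)

include hF in
theorem eq_top_of_magnus_mem {T : Submodule (ZMod p) (MagnusAlgebra p d)}
    (hT : IsClosed (T : Set (MagnusAlgebra p d))) (h : ∀ y, hF.magnus y ∈ T) : T = ⊤ := by
  have monomial_mul_mem : ∀ (w : List (Fin d)) (y : F), monomial w * hF.magnus y ∈ T := by
    intro w
    induction w using List.reverseRecOn with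
    | nil => simpa [monomial_nil] using h
    | append_singleton w j ih =>
      intro y
      have : (monomial (w ++ [j]) : MagnusAlgebra p d) * hF.magnus y =
          monomial w * hF.magnus (x j * y) - monomial w * hF.magnus y := by
        rw [← monomial_mul_X, map_mul, hF.magnus_generator]
        noncomm_ring
      rw [this]
      exact T.sub_mem (ih _) (ih _)
  refine eq_top_iff.2 fun c _ => ?_
  exact map_mem_of_monomial LinearMap.id continuous_id T hT Set.univ
    (fun w _ => by simpa using monomial_mul_mem w 1) (by simp)

theorem linearMap_ext_magnus {Y : Type*} [AddCommGroup Y] [Module (ZMod p) Y] [TopologicalSpace Y]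
    [T2Space Y] {L L' : MagnusAlgebra p d →ₗ[ZMod p] Y} (hL : Continuous L) (hL' : Continuous L')
    (h : ∀ y, L (hF.magnus y) = L' (hF.magnus y)) : L = L' :=
  LinearMap.eqLocus_eq_top.1 (hF.eq_top_of_magnus_mem (T := LinearMap.eqLocus L L')
    (isClosed_eq hL hL') h)

variable {G : Type*} [Group G] [TopologicalSpace G] [IsTopologicalGroup G] (hG : IsProP p G)
  (π : F →ₜ* G)

include hG in
theorem exists_prod_sub_one_eq_zero (V : OpenNormalSubgroup G) (g : Fin d → G) :
    ∃ n, ∀ w : List (Fin d), n < w.length → (w.map fun j =>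
      MonoidAlgebra.of (ZMod p) (G ⧸ V.toSubgroup) (g j : G ⧸ V.toSubgroup) - 1).prod = 0 := by
  have := hG.finite_quotient V
  obtain ⟨n, hn⟩ := exists_prod_of_sub_one_eq_zero (hG.isPGroup_quotient V)
  refine ⟨n, fun w hw => ?_⟩
  have := hn (w.map fun j => (g j : G ⧸ V.toSubgroup)) (by simpa using hw.le)
  rwa [List.map_map] at this

/-- The algebra homomorphism `E → 𝔽_p[G/V]`, `1 + X_j ↦ π(x_j)`. -/
def magnusQuotient (x : Fin d → F) (V : OpenNormalSubgroup G) :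
    MagnusAlgebra p d →ₐ[ZMod p] MonoidAlgebra (ZMod p) (G ⧸ V.toSubgroup) :=
  eval _ (exists_prod_sub_one_eq_zero hG V fun j => π (x j)).choose_spec

omit [IsTopologicalGroup F] in
theorem continuous_magnusQuotient (V : OpenNormalSubgroup G) :
    Continuous (magnusQuotient hG π x V) := continuous_eval _ _

theorem magnusQuotient_magnus (V : OpenNormalSubgroup G) (y : F) :
    magnusQuotient hG π x V (hF.magnus y) =
      MonoidAlgebra.of (ZMod p) (G ⧸ V.toSubgroup) (π y : G ⧸ V.toSubgroup) := by
  have : DiscreteTopology (G ⧸ V.toSubgroup) := QuotientGroup.discreteTopology V.isOpen'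
  refine DFunLike.congr_fun (hF.monoidHom_ext
    (f := (magnusQuotient hG π x V : MagnusAlgebra p d →* _).comp hF.magnus)
    (g := (MonoidAlgebra.of (ZMod p) (G ⧸ V.toSubgroup)).comp
      ((QuotientGroup.mk' V.toSubgroup).comp (π : F →* G))) ?_ ?_ ?_) y
  · exact (continuous_magnusQuotient hG π V).comp hF.continuous_magnus
  · exact (continuous_of_discreteTopology (f := MonoidAlgebra.of (ZMod p) (G ⧸ V.toSubgroup))).comp
      (QuotientGroup.continuous_mk.comp π.continuous_toFun)
  · intro j
    change magnusQuotient hG π x V (hF.magnus (x j)) = MonoidAlgebra.of _ _ _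
    rw [hF.magnus_generator, map_add, map_one, magnusQuotient, eval_X, add_sub_cancel]
    rfl

/-- The homomorphism `ψ : E → Λ_G` corresponding to `Λ_F → Λ_G` under the Magnus isomorphism. -/
def toCompleted : MagnusAlgebra p d →ₐ[ZMod p] CompletedGroupAlgebra p G :=
  AlgHom.codRestrict (AlgHom.pi fun V => magnusQuotient hG π x V)
    (completedGroupSubalgebra p G) (by
      intro c U V h
      change ((MonoidAlgebra.mapDomainAlgHom (ZMod p) (ZMod p) _).toLinearMap.comp
        (magnusQuotient hG π x U).toLinearMap) c = (magnusQuotient hG π x V).toLinearMap c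
      congr 1
      refine hF.linearMap_ext_magnus
        ((continuous_of_discreteTopology (f := MonoidAlgebra.mapDomainAlgHom (ZMod p) (ZMod p)
          (QuotientGroup.map U.toSubgroup V.toSubgroup (MonoidHom.id G) h))).comp
          (continuous_magnusQuotient hG π U))
        (continuous_magnusQuotient hG π V) fun y => ?_
      simp only [LinearMap.comp_apply, AlgHom.toLinearMap_apply, hF.magnusQuotient_magnus]
      rw [MonoidAlgebra.of_apply, MonoidAlgebra.mapDomainAlgHom_apply,
        MonoidAlgebra.mapDomain_single]
      rfl)

theorem proj_toCompleted (V : OpenNormalSubgroup G) (c : MagnusAlgebra p d) :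
    proj p V (hF.toCompleted hG π c) = magnusQuotient hG π x V c := rfl

theorem continuous_toCompleted : Continuous (hF.toCompleted hG π) :=
  continuous_rng_iff.2 fun V => continuous_magnusQuotient hG π V

theorem toCompleted_magnus (y : F) : hF.toCompleted hG π (hF.magnus y) = of p (π y) :=
  CompletedGroupAlgebra.ext fun V => by
    rw [proj_toCompleted, hF.magnusQuotient_magnus, proj_of]

include hF in
theorem magnusQuotient_surjective (hπ : Function.Surjective π) (V : OpenNormalSubgroup G) :
    Function.Surjective (magnusQuotient hG π x V) := by
  intro q
  induction q using MonoidAlgebra.induction_on with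
  | of g =>
    obtain ⟨g, rfl⟩ := QuotientGroup.mk_surjective g
    obtain ⟨y, rfl⟩ := hπ g
    exact ⟨_, hF.magnusQuotient_magnus hG π V y⟩
  | add a b ha hb =>
    obtain ⟨a, rfl⟩ := ha
    obtain ⟨b, rfl⟩ := hb
    exact ⟨a + b, map_add _ a b⟩
  | smul r a ha =>
    obtain ⟨a, rfl⟩ := ha
    exact ⟨r • a, map_smul _ r a⟩

theorem toCompleted_surjective (hπ : Function.Surjective π) :
    Function.Surjective (hF.toCompleted hG π) := by
  intro z
  let C : OpenNormalSubgroup G → Set (MagnusAlgebra p d) :=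
    fun V => {c | magnusQuotient hG π x V c = proj p V z}
  have isClosed_C : ∀ V, IsClosed (C V) := fun V =>
    isClosed_eq (continuous_magnusQuotient hG π V) continuous_const
  have C_mono : ∀ U V : OpenNormalSubgroup G, U ≤ V → C U ⊆ C V := by
    intro U V h c hc
    change magnusQuotient hG π x V c = _
    rw [← hF.proj_toCompleted, ← mapDomain_proj _ h, ← mapDomain_proj z h, proj_toCompleted]
    exact congrArg _ hc
  have : Nonempty (OpenNormalSubgroup G) :=
    ⟨{ toSubgroup := ⊤, isOpen' := isOpen_univ, isNormal' := inferInstance }⟩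
  obtain ⟨c, hc⟩ := IsCompact.nonempty_iInter_of_directed_nonempty_isCompact_isClosed C
    (fun U V => ⟨U ⊓ V, C_mono _ _ inf_le_left, C_mono _ _ inf_le_right⟩)
    (fun V => hF.magnusQuotient_surjective hG π hπ V _) (fun V => (isClosed_C V).isCompact)
    isClosed_C
  exact ⟨c, CompletedGroupAlgebra.ext fun V => Set.mem_iInter.1 hc V⟩

theorem magnusLinear_apply (z : CompletedGroupAlgebra p F) (w : List (Fin d)) :
    hF.magnusLinear z w = truncCoeff (w.length + 1) w (Nat.lt_succ_self _)
      (MonoidAlgebra.lift (ZMod p) (Trunc p d (w.length + 1)) _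
        (QuotientGroup.lift (hF.zassenhaus (w.length + 1)).toSubgroup
          (hF.magnusTrunc (w.length + 1)) le_rfl)
            (proj p (hF.zassenhaus (w.length + 1)) z)) := rfl

theorem magnusLinear_of (y : F) : hF.magnusLinear (of p y) = hF.magnus y := by
  ext w
  rw [magnusLinear_apply, proj_of, MonoidAlgebra.lift_of]
  rfl

theorem continuous_magnusLinear : Continuous hF.magnusLinear :=
  continuous_iff_coeff.2 fun w => by
    simp only [magnusLinear_apply]
    exact (continuous_of_discreteTopology (f := fun q => truncCoeff (w.length + 1) w
      (Nat.lt_succ_self _) (MonoidAlgebra.lift (ZMod p) (Trunc p d (w.length + 1)) _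
        (QuotientGroup.lift (hF.zassenhaus (w.length + 1)).toSubgroup
          (hF.magnusTrunc (w.length + 1)) le_rfl) q))).comp (continuous_proj _)

theorem magnusLinear_toCompleted (c : MagnusAlgebra p d) :
    hF.magnusLinear (hF.toCompleted hF.toIsProP (ContinuousMonoidHom.id F) c) = c := by
  refine LinearMap.congr_fun (hF.linearMap_ext_magnus
    (L := hF.magnusLinear.comp (hF.toCompleted hF.toIsProP (ContinuousMonoidHom.id F)).toLinearMap)
    (L' := LinearMap.id)
    (hF.continuous_magnusLinear.comp (hF.continuous_toCompleted _ _)) continuous_id fun y => ?_) c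
  change hF.magnusLinear (hF.toCompleted hF.toIsProP (ContinuousMonoidHom.id F) (hF.magnus y)) = _
  rw [toCompleted_magnus]
  exact hF.magnusLinear_of y

theorem map_toCompleted (c : MagnusAlgebra p d) :
    CompletedGroupAlgebra.map p π
      (hF.toCompleted hF.toIsProP (ContinuousMonoidHom.id F) c) = hF.toCompleted hG π c := by
  refine LinearMap.congr_fun (hF.linearMap_ext_magnus
    (L := (CompletedGroupAlgebra.map p π).toLinearMap.comp
      (hF.toCompleted hF.toIsProP (ContinuousMonoidHom.id F)).toLinearMap)
    (L' := (hF.toCompleted hG π).toLinearMap)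
    ((continuous_map π).comp (hF.continuous_toCompleted _ _))
    (hF.continuous_toCompleted hG π) fun y => ?_) c
  change CompletedGroupAlgebra.map p π
    (hF.toCompleted hF.toIsProP (ContinuousMonoidHom.id F) (hF.magnus y)) =
      hF.toCompleted hG π (hF.magnus y)
  rw [toCompleted_magnus, toCompleted_magnus]
  exact map_of π y

theorem inducedFiltration_eq (n : ℕ) :
    inducedFiltration hF π n = (filtration p d n).map (hF.toCompleted hG π).toLinearMap := by
  ext z
  constructor
  · rintro ⟨y, hy, rfl⟩
    obtain ⟨c, rfl⟩ := hF.toCompleted_surjective hF.toIsProP (ContinuousMonoidHom.id F)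
      Function.surjective_id y
    refine ⟨c, ?_, (hF.map_toCompleted hG π c).symm⟩
    have : hF.magnusLinear _ ∈ filtration p d n := hy
    rwa [magnusLinear_toCompleted] at this
  · rintro ⟨c, hc, rfl⟩
    refine ⟨hF.toCompleted hF.toIsProP (ContinuousMonoidHom.id F) c, ?_, hF.map_toCompleted hG π c⟩
    change hF.magnusLinear _ ∈ filtration p d n
    rwa [magnusLinear_toCompleted]

end IsFreeProP

/-! ### Generators of the relation module -/

theorem subsingleton_of_closure_pow_sup_commutator {p : ℕ} [Fact p.Prime] {P : Type*}
    [Group P] [Finite P] (hP : IsPGroup p P)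
    (h : Subgroup.closure (Set.range fun r : P => r ^ p) ⊔ commutator P = ⊤) : Subsingleton P := by
  by_contra not_subsingleton
  rw [not_subsingleton_iff_nontrivial] at not_subsingleton
  have := hP.isNilpotent
  let power : Abelianization P →* Abelianization P := powMonoidHom p
  have range_power : power.range = ⊤ := by
    rw [eq_top_iff, ← Subgroup.map_top_of_surjective (Abelianization.of (G := P))
      QuotientGroup.mk_surjective, ← h, Subgroup.map_sup, sup_le_iff]
    constructor
    · rw [Subgroup.map_le_iff_le_comap, Subgroup.closure_le]
      rintro _ ⟨r, rfl⟩
      exact ⟨Abelianization.of r, by simp [power]⟩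
    · rw [Subgroup.map_le_iff_le_comap, ← Abelianization.ker_of P]
      exact fun r hr => Subgroup.mem_comap.2 ((MonoidHom.mem_ker.1 hr) ▸ one_mem _)
  have power_injective : Function.Injective fun a : Abelianization P => a ^ p :=
    Finite.injective_iff_surjective.2 (MonoidHom.range_eq_top.1 range_power)
  refine (Group.IsSolvable.commutator_lt_top_of_nontrivial P).ne (eq_top_iff.2 fun r _ => ?_)
  rw [← Abelianization.ker_of P, MonoidHom.mem_ker]
  obtain ⟨k, hk⟩ := hP r
  refine power_injective.iterate k ?_
  simp only [pow_iterate, ← map_pow, hk, map_one, one_pow]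

section Relations

variable {p : ℕ} {R : Type*} [Group R] [TopologicalSpace R] [IsTopologicalGroup R]

namespace RelationModule

theorem mk_mul (r s : R) : mk p (r * s) = mk p r + mk p s := rfl

theorem mk_inv (r : R) : mk p r⁻¹ = -mk p r := rfl

theorem mk_surjective : Function.Surjective (mk p : R → RelationModule p R) :=
  QuotientGroup.mk_surjective

theorem isQuotientMap_mk : Topology.IsQuotientMap (mk p : R → RelationModule p R) :=
  QuotientGroup.isQuotientMap_mk _

theorem mk_eq_mk {r s : R} : mk p r = mk p s ↔ r⁻¹ * s ∈ pCommutator p R := QuotientGroup.eq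

theorem mk_eq_zero {r : R} : mk p r = 0 ↔ r ∈ pCommutator p R :=
  QuotientGroup.eq_one_iff r

theorem exists_addSubgroup_mk_mem_iff {K : Subgroup R} (hK : pCommutator p R ≤ K) :
    ∃ A : AddSubgroup (RelationModule p R), ∀ r, mk p r ∈ A ↔ r ∈ K := by
  refine ⟨{ carrier := mk p '' K
            zero_mem' := ⟨1, one_mem _, rfl⟩
            add_mem' := ?_
            neg_mem' := ?_ }, fun r => ⟨?_, fun hr => ⟨r, hr, rfl⟩⟩⟩
  · rintro _ _ ⟨r, hr, rfl⟩ ⟨s, hs, rfl⟩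
    exact ⟨r * s, mul_mem hr hs, mk_mul r s⟩
  · rintro _ ⟨r, hr, rfl⟩
    exact ⟨r⁻¹, inv_mem hr, mk_inv r⟩
  · rintro ⟨s, hs, hsr⟩
    simpa using mul_mem hs (hK (mk_eq_mk.1 hsr))

theorem nsmul_eq_zero (m : RelationModule p R) : p • m = 0 := by
  obtain ⟨r, rfl⟩ := mk_surjective m
  have mk_pow_eq_zero : mk p (r ^ p) = 0 := mk_eq_zero.2 (Subgroup.le_topologicalClosure _
    ((le_sup_left : Subgroup.closure _ ≤ _) (Subgroup.subset_closure ⟨r, rfl⟩)))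
  exact mk_pow_eq_zero

instance : IsTopologicalAddGroup (RelationModule p R) :=
  inferInstanceAs (IsTopologicalAddGroup (Additive (R ⧸ pCommutator p R)))

instance [CompactSpace R] : CompactSpace (RelationModule p R) :=
  inferInstanceAs (CompactSpace (R ⧸ pCommutator p R))

theorem exists_addSubgroup_isOpen_notMem [CompactSpace R] [TotallyDisconnectedSpace R]
    {m : RelationModule p R} (hm : m ≠ 0) :
    ∃ A : AddSubgroup (RelationModule p R), IsOpen (A : Set (RelationModule p R)) ∧ m ∉ A := by
  obtain ⟨r, rfl⟩ := mk_surjective m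
  have isClosed_pCommutator : IsClosed (pCommutator p R : Set R) :=
    Subgroup.isClosed_topologicalClosure _
  obtain ⟨V, hV⟩ := ProfiniteGrp.exist_openNormalSubgroup_sub_open_nhds_of_one
    (isClosed_pCommutator.isOpen_compl.preimage (continuous_const_mul r))
    (by simpa [mk_eq_zero] using hm)
  obtain ⟨A, mk_mem_A⟩ := exists_addSubgroup_mk_mem_iff
    (le_sup_left : pCommutator p R ≤ pCommutator p R ⊔ V.toSubgroup)
  refine ⟨A, ?_, fun hr => ?_⟩
  · rw [← isQuotientMap_mk.isOpen_preimage]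
    convert Subgroup.isOpen_mono (le_sup_right : _ ≤ pCommutator p R ⊔ V.toSubgroup) V.isOpen'
    exact Set.ext mk_mem_A
  · obtain ⟨s, hs, v, hv, rfl⟩ := Subgroup.mem_sup_of_normal_right.1 ((mk_mem_A r).1 hr)
    exact hV (inv_mem hv : v⁻¹ ∈ V.toSubgroup) (by simpa using hs)

section Lift

variable {A : Type*} [AddCommGroup A] [Module (ZMod p) A] [TopologicalSpace A] [T1Space A]
  {f : R →* Multiplicative A} (hf : Continuous fun r => (f r).toAdd)

include hf in
theorem pCommutator_le_ker : pCommutator p R ≤ f.ker := by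
  refine Subgroup.topologicalClosure_minimal _ (sup_le ?_ ?_) ?_
  · rw [Subgroup.closure_le]
    rintro _ ⟨r, rfl⟩
    rw [SetLike.mem_coe, MonoidHom.mem_ker, map_pow]
    exact congrArg Multiplicative.ofAdd (ZModModule.char_nsmul_eq_zero p (f r).toAdd)
  · exact Abelianization.commutator_subset_ker f
  · exact (isClosed_singleton (x := (0 : A))).preimage hf

/-- The additive map on `R / R^p[R,R]` induced by a continuous homomorphism from `R` to a
topological `𝔽_p`-vector space. -/
def lift : RelationModule p R →+ A :=
  MonoidHom.toAdditiveLeft (QuotientGroup.lift (pCommutator p R) f (pCommutator_le_ker hf))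

theorem lift_mk (r : R) : lift (p := p) hf (mk p r) = (f r).toAdd := rfl

theorem continuous_lift : Continuous (lift (p := p) hf) := isQuotientMap_mk.continuous_iff.2 hf

end Lift

end RelationModule

theorem ker_eq_top_of_ker_sup_pCommutator_eq_top [Fact p.Prime] {P : Type*} [Group P] [Finite P]
    (hP : IsPGroup p P) {f : R →* P} (hf : IsOpen (f.ker : Set R))
    (h : f.ker ⊔ pCommutator p R = ⊤) : f.ker = ⊤ := by
  have pCommutator_le : pCommutator p R ≤
      f.ker ⊔ (Subgroup.closure (Set.range fun r : R => r ^ p) ⊔ commutator R) :=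
    Subgroup.topologicalClosure_minimal _ le_sup_right
      (Subgroup.isClosed_of_isOpen _ (Subgroup.isOpen_mono le_sup_left hf))
  have range_generated :
      Subgroup.closure (Set.range fun r : f.range => r ^ p) ⊔ commutator f.range = ⊤ := by
    rw [eq_top_iff, ← Subgroup.map_top_of_surjective f.rangeRestrict f.rangeRestrict_surjective,
      ← h]
    refine (Subgroup.map_mono (sup_le le_sup_left pCommutator_le)).trans ?_
    rw [Subgroup.map_sup, Subgroup.map_sup, sup_le_iff, sup_le_iff]
    refine ⟨?_, ?_, ?_⟩
    · rw [Subgroup.map_le_iff_le_comap]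
      intro r hr
      rw [Subgroup.mem_comap, show f.rangeRestrict r = 1 from Subtype.ext hr]
      exact one_mem _
    · rw [Subgroup.map_le_iff_le_comap, Subgroup.closure_le]
      rintro _ ⟨r, rfl⟩
      exact (le_sup_left : _ ≤ Subgroup.closure (Set.range fun r : f.range => r ^ p) ⊔ _)
        (Subgroup.subset_closure ⟨f.rangeRestrict r, by simp⟩)
    · refine le_trans ?_ le_sup_right
      rw [map_commutator_eq]
      exact Subgroup.commutator_mono le_top le_top
  have := subsingleton_of_closure_pow_sup_commutator (hP.to_subgroup f.range) range_generated
  exact eq_top_iff.2 fun r _ => congrArg Subtype.val (Subsingleton.elim (f.rangeRestrict r) 1)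

variable {F : Type*} [Group F] [TopologicalSpace F] [IsTopologicalGroup F]
  {G : Type*} [Group G] [TopologicalSpace G] {π : F →ₜ* G} {I : Type*} {ρ : I → (π : F →* G).ker}

theorem RelationModule.mk_conjNormal_eq_of_eq {y z : F} (h : π y = π z) (r : (π : F →* G).ker) :
    mk p (MulAut.conjNormal y r) = mk p (MulAut.conjNormal z r) := by
  have mem_ker : y * z⁻¹ ∈ (π : F →* G).ker := by
    change π (y * z⁻¹) = 1
    rw [map_mul, h, ← map_mul, mul_inv_cancel, map_one]
  have conjNormal_eq : MulAut.conjNormal y r =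
      ⟨_, mem_ker⟩ * MulAut.conjNormal z r * (⟨_, mem_ker⟩ : (π : F →* G).ker)⁻¹ := by
    ext
    simp only [MulAut.conjNormal_apply, Subgroup.coe_mul, Subgroup.coe_inv]
    group
  rw [conjNormal_eq, mk_mul, mk_mul, mk_inv]
  abel

theorem IsProP.isQuotientMap [IsTopologicalGroup G] (hF : IsProP p F) (hG : IsProP p G)
    (hπ : Function.Surjective π) : Topology.IsQuotientMap π := by
  have := hF.compactSpace
  have := hG.t2Space
  exact π.continuous_toFun.isClosedMap.isQuotientMap π.continuous_toFun hπ

/-- The classes of the relations `ρ_i` generate `R / R^p[R,R]` topologically as a module over the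
completed group algebra. It is equivalent, and needs no module structure, to ask that the
conjugates of these classes generate a dense subgroup. -/
def GeneratesRelationModule (p : ℕ) (ρ : I → (π : F →* G).ker) : Prop :=
  Dense (AddSubgroup.closure
    {m | ∃ (y : F) (i : I), m = RelationModule.mk p (MulAut.conjNormal y (ρ i))} :
      Set (RelationModule p (π : F →* G).ker))

theorem GeneratesRelationModule.comp (hρ : GeneratesRelationModule p ρ) {J : Type*} {e : J → I}
    (he : Function.Surjective e) : GeneratesRelationModule p (ρ ∘ e) := by
  rw [GeneratesRelationModule] at hρ ⊢
  simpa only [Function.comp_apply, he.exists] using hρ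

theorem GeneratesRelationModule.eq_top_of_isClosed (hρ : GeneratesRelationModule p ρ)
    {A : AddSubgroup (RelationModule p (π : F →* G).ker)}
    (hA : IsClosed (A : Set (RelationModule p (π : F →* G).ker)))
    (h : ∀ y i, RelationModule.mk p (MulAut.conjNormal y (ρ i)) ∈ A) : A = ⊤ := by
  have closure_le : AddSubgroup.closure
      {m | ∃ (y : F) (i : I), m = RelationModule.mk p (MulAut.conjNormal y (ρ i))} ≤ A := by
    rw [AddSubgroup.closure_le]
    rintro _ ⟨y, i, rfl⟩
    exact h y i
  exact eq_top_iff.2 fun m _ => hA.closure_subset_iff.2 closure_le (hρ m)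

theorem GeneratesRelationModule.ker_le [Fact p.Prime] (hρ : GeneratesRelationModule p ρ)
    (hF : IsProP p F) (U : OpenNormalSubgroup F) (hU : ∀ i, (ρ i : F) ∈ U.toSubgroup) :
    (π : F →* G).ker ≤ U.toSubgroup := by
  have := hF.finite_quotient U
  let f : (π : F →* G).ker →* F ⧸ U.toSubgroup :=
    (QuotientGroup.mk' U.toSubgroup).comp (π : F →* G).ker.subtype
  have mem_ker_f (r) : r ∈ f.ker ↔ (r : F) ∈ U.toSubgroup := QuotientGroup.eq_one_iff _
  have isOpen_ker_f : IsOpen (f.ker : Set (π : F →* G).ker) := by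
    convert U.isOpen'.preimage continuous_subtype_val using 1
    exact Set.ext mem_ker_f
  let K := f.ker ⊔ pCommutator p (π : F →* G).ker
  obtain ⟨A, mk_mem_A⟩ :=
    RelationModule.exists_addSubgroup_mk_mem_iff (le_sup_right : pCommutator p _ ≤ K)
  have isClosed_A : IsClosed (A : Set (RelationModule p (π : F →* G).ker)) := by
    rw [← RelationModule.isQuotientMap_mk.isClosed_preimage]
    convert Subgroup.isClosed_of_isOpen K (Subgroup.isOpen_mono le_sup_left isOpen_ker_f) using 1
    exact Set.ext mk_mem_A
  have A_eq_top : A = ⊤ := hρ.eq_top_of_isClosed isClosed_A fun y i => by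
    refine (mk_mem_A _).2 ((le_sup_left : _ ≤ K) ((mem_ker_f _).2 ?_))
    rw [MulAut.conjNormal_apply]
    exact U.isNormal'.conj_mem _ (hU i) y
  have K_eq_top : K = ⊤ :=
    eq_top_iff.2 fun r _ => (mk_mem_A r).1 (A_eq_top ▸ AddSubgroup.mem_top _)
  have ker_f := ker_eq_top_of_ker_sup_pCommutator_eq_top (hF.isPGroup_quotient U) isOpen_ker_f
    K_eq_top
  exact fun r hr => (mem_ker_f ⟨r, hr⟩).1 (ker_f ▸ Subgroup.mem_top _)

end Relations

/-! ### The kernel of the map from series to the completed group algebra -/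

namespace MagnusAlgebra

variable {p d : ℕ}

theorem isOpen_filtration (n : ℕ) : IsOpen (filtration p d n : Set (MagnusAlgebra p d)) := by
  have : (filtration p d n : Set (MagnusAlgebra p d)) =
      ⋂ w ∈ {w : List (Fin d) | w.length < n}, (fun a : MagnusAlgebra p d => a w) ⁻¹' {0} := by
    ext a
    simp [mem_filtration]
  rw [this]
  exact (List.finite_length_lt (Fin d) n).isOpen_biInter fun w _ =>
    (isOpen_discrete _).preimage (continuous_coeff w)

theorem continuous_mkQ_of_isOpen {T : Submodule (ZMod p) (MagnusAlgebra p d)}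
    (hT : IsOpen (T : Set (MagnusAlgebra p d))) [TopologicalSpace (MagnusAlgebra p d ⧸ T)]
    [DiscreteTopology (MagnusAlgebra p d ⧸ T)] : Continuous T.mkQ := by
  refine continuous_of_continuousAt_zero T.mkQ ?_
  rw [ContinuousAt, map_zero, nhds_discrete (MagnusAlgebra p d ⧸ T), Filter.tendsto_pure]
  filter_upwards [hT.mem_nhds (zero_mem _)] with a ha
  exact (Submodule.Quotient.mk_eq_zero _).2 ha

end MagnusAlgebra

namespace FreeRelators

open MagnusAlgebra

variable {p d : ℕ} [Fact p.Prime] {I : Type*} (S : FreeRelators p d I)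
  {F : Type*} [Group F] [TopologicalSpace F] [IsTopologicalGroup F] {x : Fin d → F}
  (hF : IsFreeProP p x)

/-- The subspace `J + E_n`, where `J` is the ideal of the relators. -/
def idealSup (n : ℕ) : Submodule (ZMod p) (MagnusAlgebra p d) := S.ideal ⊔ filtration p d n

theorem ideal_le_idealSup (n : ℕ) : S.ideal ≤ S.idealSup n := le_sup_left

theorem mul_mem_idealSup_left {n : ℕ} (a : MagnusAlgebra p d) {b : MagnusAlgebra p d}
    (hb : b ∈ S.idealSup n) : a * b ∈ S.idealSup n := by
  obtain ⟨g, hg, c, hc, rfl⟩ := Submodule.mem_sup.1 hb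
  rw [mul_add]
  refine Submodule.add_mem_sup (S.mul_mem_ideal_left a hg) ?_
  simpa using mul_mem_filtration (m := 0) (mem_filtration.2 (by simp)) hc

theorem mul_mem_idealSup_right {n : ℕ} {a : MagnusAlgebra p d} (ha : a ∈ S.idealSup n)
    (b : MagnusAlgebra p d) : a * b ∈ S.idealSup n := by
  obtain ⟨g, hg, c, hc, rfl⟩ := Submodule.mem_sup.1 ha
  rw [add_mul]
  refine Submodule.add_mem_sup (S.mul_mem_ideal_right hg b) ?_
  simpa using mul_mem_filtration (n := 0) hc (mem_filtration.2 (by simp))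

theorem mem_ideal_of_forall_mem_idealSup {a : MagnusAlgebra p d} (h : ∀ n, a ∈ S.idealSup n) :
    a ∈ S.ideal := by
  rw [mem_ideal]
  intro w hw
  obtain ⟨g, hg, c, hc, rfl⟩ := Submodule.mem_sup.1 (h (w.length + 1))
  rw [map_add, add_apply, S.mem_ideal.1 hg w hw, zero_add]
  exact mem_filtration.1 (S.coord_mem_filtration hc) w (Nat.lt_succ_self _)

theorem isOpen_idealSup (n : ℕ) : IsOpen (S.idealSup n : Set (MagnusAlgebra p d)) :=
  AddSubgroup.isOpen_mono (H₁ := (filtration p d n).toAddSubgroup)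
    (H₂ := (S.idealSup n).toAddSubgroup) (le_sup_right : _ ≤ S.idealSup n) (isOpen_filtration n)

/-- The open normal subgroup of the elements congruent to `1` modulo `J + E_n`. -/
def congruenceSubgroup (n : ℕ) : OpenNormalSubgroup F where
  carrier := {y | hF.magnus y - 1 ∈ S.idealSup n}
  one_mem' := by simp
  mul_mem' {y z} hy hz := by
    have magnus_mul_sub_one :
        hF.magnus (y * z) - 1 = (hF.magnus y - 1) * hF.magnus z + (hF.magnus z - 1) := by
      rw [map_mul]; noncomm_ring
    rw [Set.mem_ofPred_eq, magnus_mul_sub_one]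
    exact add_mem (S.mul_mem_idealSup_right hy _) hz
  inv_mem' {y} hy := by
    have magnus_inv_sub_one : hF.magnus y⁻¹ - 1 = -(hF.magnus y⁻¹ * (hF.magnus y - 1)) := by
      rw [mul_sub, ← map_mul, inv_mul_cancel, map_one]; noncomm_ring
    rw [Set.mem_ofPred_eq, magnus_inv_sub_one]
    exact neg_mem (S.mul_mem_idealSup_left _ hy)
  isOpen' := (S.isOpen_idealSup n).preimage (hF.continuous_magnus.sub continuous_const)
  isNormal' := ⟨fun y hy z => by
    have magnus_conj_sub_one :
        hF.magnus (z * y * z⁻¹) - 1 = hF.magnus z * (hF.magnus y - 1) * hF.magnus z⁻¹ := by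
      rw [mul_sub, sub_mul, mul_one, ← map_mul, ← map_mul, ← map_mul, mul_inv_cancel, map_one]
    change hF.magnus (z * y * z⁻¹) - 1 ∈ S.idealSup n
    rw [magnus_conj_sub_one]
    exact S.mul_mem_idealSup_right (S.mul_mem_idealSup_left _ hy) _⟩

variable {G : Type*} [Group G] [TopologicalSpace G] {π : F →ₜ* G} {ρ : I → (π : F →* G).ker}

theorem magnus_sub_one_mem_ideal (hS : ∀ i, S.rel i = hF.magnus (ρ i) - 1)
    (hρ : GeneratesRelationModule p ρ) {r : F} (hr : r ∈ (π : F →* G).ker) :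
    hF.magnus r - 1 ∈ S.ideal := by
  refine S.mem_ideal_of_forall_mem_idealSup fun n => ?_
  refine hρ.ker_le hF.toIsProP (S.congruenceSubgroup hF n) (fun i => ?_) hr
  change hF.magnus (ρ i) - 1 ∈ S.idealSup n
  rw [← hS]
  exact S.ideal_le_idealSup n (S.rel_mem_ideal i)

theorem magnus_sub_magnus_mem_ideal
    (hmem : ∀ r ∈ (π : F →* G).ker, hF.magnus r - 1 ∈ S.ideal) {y z : F} (h : π y = π z) :
    hF.magnus y - hF.magnus z ∈ S.ideal := by
  have mem_ker : y * z⁻¹ ∈ (π : F →* G).ker := by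
    change π (y * z⁻¹) = 1
    rw [map_mul, h, ← map_mul, mul_inv_cancel, map_one]
  have magnus_sub_magnus :
      hF.magnus y - hF.magnus z = (hF.magnus (y * z⁻¹) - 1) * hF.magnus z := by
    rw [sub_mul, ← map_mul, inv_mul_cancel_right, one_mul]
  rw [magnus_sub_magnus]
  exact S.mul_mem_ideal_right (hmem _ mem_ker) _

variable [IsTopologicalGroup G] (hG : IsProP p G)

theorem toCompleted_rel (hS : ∀ i, S.rel i = hF.magnus (ρ i) - 1) (i : I) :
    hF.toCompleted hG π (S.rel i) = 0 := by
  rw [hS, map_sub, hF.toCompleted_magnus, map_one, show π (ρ i : F) = 1 from (ρ i).2,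
    CompletedGroupAlgebra.of_one, sub_self]

theorem toCompleted_eq_zero_of_mem_ideal (hS : ∀ i, hF.toCompleted hG π (S.rel i) = 0)
    {c : MagnusAlgebra p d} (hc : c ∈ S.ideal) : hF.toCompleted hG π c = 0 := by
  simpa using S.map_mem_of_mem_ideal (hF.toCompleted hG π).toLinearMap
    (hF.continuous_toCompleted hG π) ⊥ (by simp) (fun u _ i v => by simp [hS]) hc

/-- Modulo the open subspace `J + E_n`, the Magnus homomorphism factors through `G`, hence the
projection of `E` factors through `Λ_G`. -/
theorem mem_idealSup_of_toCompleted_eq_zero (hπ : Function.Surjective π)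
    (hmem : ∀ r ∈ (π : F →* G).ker, hF.magnus r - 1 ∈ S.ideal) {c : MagnusAlgebra p d}
    (hc : hF.toCompleted hG π c = 0) (n : ℕ) : c ∈ S.idealSup n := by
  let Y := MagnusAlgebra p d ⧸ S.idealSup n
  let _ : TopologicalSpace Y := ⊥
  have : DiscreteTopology Y := ⟨rfl⟩
  let q : MagnusAlgebra p d →ₗ[ZMod p] Y := (S.idealSup n).mkQ
  have continuous_q : Continuous q := continuous_mkQ_of_isOpen (S.isOpen_idealSup n)
  let f : G → Y := fun g => q (hF.magnus (Function.surjInv hπ g))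
  have f_apply (y) : f (π y) = q (hF.magnus y) := by
    rw [← sub_eq_zero, ← map_sub]
    exact (Submodule.Quotient.mk_eq_zero _).2 (S.ideal_le_idealSup n
      (S.magnus_sub_magnus_mem_ideal hF hmem (Function.surjInv_eq hπ _)))
  have continuous_f : Continuous f := by
    rw [(hF.toIsProP.isQuotientMap hG hπ).continuous_iff]
    exact (continuous_q.comp hF.continuous_magnus).congr fun y => (f_apply y).symm
  obtain ⟨L, hL, L_of⟩ := CompletedGroupAlgebra.exists_linearMap_of_continuous hG continuous_f
  have L_comp : L.comp (hF.toCompleted hG π).toLinearMap = q :=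
    hF.linearMap_ext_magnus (hL.comp (hF.continuous_toCompleted hG π)) continuous_q fun y => by
      change L (hF.toCompleted hG π (hF.magnus y)) = _
      rw [hF.toCompleted_magnus, L_of, f_apply]
  refine (Submodule.Quotient.mk_eq_zero _).1 ?_
  change q c = 0
  rw [← L_comp, LinearMap.comp_apply, AlgHom.toLinearMap_apply, hc, map_zero]

theorem toCompleted_eq_zero_iff (hπ : Function.Surjective π)
    (hS : ∀ i, S.rel i = hF.magnus (ρ i) - 1) (hρ : GeneratesRelationModule p ρ)
    {c : MagnusAlgebra p d} : hF.toCompleted hG π c = 0 ↔ c ∈ S.ideal :=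
  ⟨fun hc => S.mem_ideal_of_forall_mem_idealSup
      (S.mem_idealSup_of_toCompleted_eq_zero hF hG hπ
        (fun _ => S.magnus_sub_one_mem_ideal hF hS hρ) hc),
    S.toCompleted_eq_zero_of_mem_ideal hF hG (S.toCompleted_rel hF hG hS)⟩

end FreeRelators

/-! ### The graded pieces -/

namespace FreeRelators

open MagnusAlgebra

variable {p d : ℕ} [Fact p.Prime] {I : Type*} (S : FreeRelators p d I)
  {F : Type*} [Group F] [TopologicalSpace F] [IsTopologicalGroup F] {x : Fin d → F}
  (hF : IsFreeProP p x) {G : Type*} [Group G] [TopologicalSpace G] [IsTopologicalGroup G]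
  (hG : IsProP p G) (π : F →ₜ* G)

/-- The series supported on normal words of length `n` with prescribed coefficients. -/
def extendNormal (n : ℕ) : (normalWords S.lead n → ZMod p) →ₗ[ZMod p] MagnusAlgebra p d :=
  Function.ExtendByZero.linearMap (ZMod p) Subtype.val

theorem extendNormal_apply {n : ℕ} (c : normalWords S.lead n → ZMod p)
    (w : normalWords S.lead n) : S.extendNormal n c w = c w :=
  Function.Injective.extend_apply Subtype.val_injective (g := c)
    (e' := (0 : List (Fin d) → ZMod p)) w

theorem extendNormal_apply_of_notMem {n : ℕ} (c : normalWords S.lead n → ZMod p)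
    {w : List (Fin d)} (h : w ∉ normalWords S.lead n) : S.extendNormal n c w = 0 :=
  Function.extend_apply' c (0 : List (Fin d) → ZMod p) w fun ⟨v, hv⟩ => h (hv ▸ v.2)

theorem extendNormal_mem_filtration {n : ℕ} (c : normalWords S.lead n → ZMod p) :
    S.extendNormal n c ∈ filtration p d n :=
  mem_filtration.2 fun _ hw => S.extendNormal_apply_of_notMem c fun h => hw.ne h.2

theorem coord_extendNormal {n : ℕ} (c : normalWords S.lead n → ZMod p) :
    S.coord (S.extendNormal n c) = S.extendNormal n c :=
  S.coord_of_support_isNormalWord fun _ hw => S.extendNormal_apply_of_notMem c fun h => hw h.1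

theorem extendNormal_coord_sub_normalPart_mem {n : ℕ} {a : MagnusAlgebra p d}
    (ha : a ∈ filtration p d n) :
    S.extendNormal n (fun w => S.coord a w) - S.normalPart a ∈ filtration p d (n + 1) := by
  refine mem_filtration.2 fun w hw => ?_
  rw [MagnusAlgebra.sub_apply, sub_eq_zero]
  by_cases hn : IsNormalWord S.lead w
  · rw [S.normalPart_apply_of_isNormalWord a hn]
    by_cases hl : w.length = n
    · exact S.extendNormal_apply _ ⟨w, hn, hl⟩
    · rw [S.extendNormal_apply_of_notMem _ fun h => hl h.2,
        mem_filtration.1 (S.coord_mem_filtration ha) w (by omega)]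
  · rw [S.normalPart_apply_of_not_isNormalWord a hn,
      S.extendNormal_apply_of_notMem _ fun h => hn h.1]

/-- The map sending a function on the normal words of length `n` to the class, in the graded piece
of degree `n`, of the image of the series with these coefficients. -/
def toGradedPiece (n : ℕ) : (normalWords S.lead n → ZMod p) →ₗ[ZMod p] gradedPiece hF π n :=
  (Submodule.mkQ _).comp
    (((hF.toCompleted hG π).toLinearMap.comp (S.extendNormal n)).codRestrict
      (inducedFiltration hF π n) fun c => by
        rw [hF.inducedFiltration_eq hG π n]
        exact ⟨_, S.extendNormal_mem_filtration c, rfl⟩)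

variable {π} (hker : ∀ c, hF.toCompleted hG π c = 0 ↔ c ∈ S.ideal)

include hker

theorem toCompleted_normalPart (a : MagnusAlgebra p d) :
    hF.toCompleted hG π (S.normalPart a) = hF.toCompleted hG π a := by
  rw [eq_comm, ← sub_eq_zero, ← map_sub, hker]
  exact S.sub_normalPart_mem a

theorem toGradedPiece_injective (n : ℕ) : Function.Injective (S.toGradedPiece hF hG π n) := by
  rw [injective_iff_map_eq_zero]
  intro c hc
  have mem_induced : hF.toCompleted hG π (S.extendNormal n c) ∈ inducedFiltration hF π (n + 1) :=
    (Submodule.Quotient.mk_eq_zero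
      ((inducedFiltration hF π (n + 1)).submoduleOf (inducedFiltration hF π n))).1 hc
  rw [hF.inducedFiltration_eq hG π] at mem_induced
  obtain ⟨b, hb, toCompleted_b⟩ := mem_induced
  have sub_mem_ideal : S.extendNormal n c - b ∈ S.ideal := by
    rw [← hker, map_sub, sub_eq_zero]
    exact toCompleted_b.symm
  ext w
  have coord_sub := S.mem_ideal.1 sub_mem_ideal w w.2.1
  rwa [map_sub, MagnusAlgebra.sub_apply, coord_extendNormal, extendNormal_apply,
    mem_filtration.1 (S.coord_mem_filtration hb) w (by rw [w.2.2]; exact Nat.lt_succ_self n),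
    sub_zero] at coord_sub

theorem toGradedPiece_surjective (n : ℕ) : Function.Surjective (S.toGradedPiece hF hG π n) := by
  intro q
  obtain ⟨⟨z, hz⟩, rfl⟩ := Submodule.mkQ_surjective _ q
  have hz' := hz
  rw [hF.inducedFiltration_eq hG π] at hz'
  obtain ⟨a, ha, rfl⟩ := hz'
  refine ⟨fun w => S.coord a w, ?_⟩
  refine (Submodule.Quotient.eq _).2 ?_
  change hF.toCompleted hG π (S.extendNormal n fun w => S.coord a w) - hF.toCompleted hG π a ∈
    inducedFiltration hF π (n + 1)
  rw [hF.inducedFiltration_eq hG π]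
  refine ⟨S.extendNormal n (fun w => S.coord a w) - S.normalPart a,
    S.extendNormal_coord_sub_normalPart_mem ha, ?_⟩
  rw [AlgHom.toLinearMap_apply, map_sub, S.toCompleted_normalPart hF hG hker]

theorem finite_gradedPiece (n : ℕ) : Module.Finite (ZMod p) (gradedPiece hF π n) := by
  have := (finite_normalWords S.lead n).to_subtype
  exact Module.Finite.of_surjective _ (S.toGradedPiece_surjective hF hG hker n)

theorem finrank_gradedPiece (n : ℕ) :
    Module.finrank (ZMod p) (gradedPiece hF π n) = (normalWords S.lead n).ncard := by
  have := (finite_normalWords S.lead n).fintype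
  rw [← (LinearEquiv.ofBijective _ ⟨S.toGradedPiece_injective hF hG hker n,
      S.toGradedPiece_surjective hF hG hker n⟩).finrank_eq,
    Module.finrank_fintype_fun_eq_card, ← Nat.card_eq_fintype_card, Nat.card_coe_set_eq]

theorem poincareSeries_mul :
    poincareSeries hF π * (1 - PowerSeries.C (d : ℤ) * PowerSeries.X +
      PowerSeries.mk fun n : ℕ => ({i | (S.lead i).length = n}.ncard : ℤ)) = 1 := by
  refine Eq.trans ?_ (S.free.mk_ncard_normalWords_mul S.lead_ne_nil)
  congr 1
  ext n
  rw [poincareSeries, PowerSeries.coeff_mk, PowerSeries.coeff_mk,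
    S.finrank_gradedPiece hF hG hker]

end FreeRelators

/-! ### The structure of the relation module -/

section RelationModule

open MagnusAlgebra CompletedGroupAlgebra

variable {p : ℕ} [Fact p.Prime] {F : Type*} [Group F] [TopologicalSpace F] [IsTopologicalGroup F]
  {G : Type*} [Group G] [TopologicalSpace G] [IsTopologicalGroup G] {π : F →ₜ* G}

omit [Fact p.Prime] in
theorem IsProP.compactSpace_ker (hF : IsProP p F) (hG : IsProP p G) :
    CompactSpace (π : F →* G).ker := by
  have := hF.compactSpace
  have := hG.t2Space
  exact isCompact_iff_compactSpace.1
    (isClosed_singleton (x := (1 : G)) |>.preimage π.continuous_toFun).isCompact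

theorem continuous_conjNormal_apply {N : Subgroup F} [N.Normal] (r : N) :
    Continuous fun y : F => MulAut.conjNormal y r :=
  ((continuous_id.mul continuous_const).mul continuous_inv).subtype_mk
    fun y => (MulAut.conjNormal y r).2

omit [Fact p.Prime] [IsTopologicalGroup G] in
theorem RelationModule.exists_openNormalSubgroup_map_mk_eq_zero (hF : IsProP p F) {Q : Type*}
    [AddCommGroup Q] [TopologicalSpace Q] [DiscreteTopology Q]
    {q : RelationModule p (π : F →* G).ker →+ Q} (hq : Continuous q) :
    ∃ U : OpenNormalSubgroup F,
      ∀ r : (π : F →* G).ker, (r : F) ∈ U.toSubgroup → q (mk p r) = 0 := by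
  obtain ⟨W, hW, preimage_W⟩ := isOpen_induced_iff.1
    ((isOpen_discrete ({0} : Set Q)).preimage (hq.comp isQuotientMap_mk.continuous))
  have one_mem_W : ((1 : (π : F →* G).ker) : F) ∈ W := preimage_W.superset (map_zero q)
  obtain ⟨U, hU⟩ := hF.exists_openNormalSubgroup_subset hW one_mem_W
  exact ⟨U, fun r hr => preimage_W.subset (hU hr)⟩

theorem RelationModule.exists_linearMap_mk_conjNormal (hF : IsProP p F) (hG : IsProP p G)
    (hπ : Function.Surjective π) {Q : Type*} [AddCommGroup Q] [Module (ZMod p) Q]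
    [TopologicalSpace Q] [DiscreteTopology Q] {q : RelationModule p (π : F →* G).ker →+ Q}
    (hq : Continuous q) (r : (π : F →* G).ker) :
    ∃ L : CompletedGroupAlgebra p G →ₗ[ZMod p] Q, Continuous L ∧
      ∀ y, L (of p (π y)) = q (mk p (MulAut.conjNormal y r)) := by
  let f : G → Q := fun g => q (mk p (MulAut.conjNormal (Function.surjInv hπ g) r))
  have f_apply (y) : f (π y) = q (mk p (MulAut.conjNormal y r)) :=
    congrArg q (mk_conjNormal_eq_of_eq (Function.surjInv_eq hπ _) r)
  have continuous_f : Continuous f := by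
    rw [(hF.isQuotientMap hG hπ).continuous_iff]
    exact (hq.comp (isQuotientMap_mk.continuous.comp (continuous_conjNormal_apply r))).congr
      fun y => (f_apply y).symm
  obtain ⟨L, hL, L_of⟩ := exists_linearMap_of_continuous hG continuous_f
  exact ⟨L, hL, fun y => (L_of _).trans (f_apply y)⟩

theorem eq_top_of_isClosed_of_forall_single_mem {I : Type*} [DecidableEq I]
    {M : I → Type*} [∀ i, AddCommGroup (M i)] [∀ i, TopologicalSpace (M i)]
    {A : AddSubgroup (∀ i, M i)} (hA : IsClosed (A : Set (∀ i, M i)))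
    (h : ∀ i m, Pi.single i m ∈ A) : A = ⊤ := by
  refine eq_top_iff.2 fun c _ => ?_
  have hasSum_single : HasSum (fun i => Pi.single i (c i)) c := Pi.hasSum.2 fun k => by
    simpa using hasSum_single (f := fun i => (Pi.single i (c i) : ∀ i, M i) k) k
      fun i hi => Pi.single_eq_of_ne hi.symm _
  exact hA.mem_of_tendsto hasSum_single (.of_forall fun s => A.sum_mem fun i _ => h i _)

theorem IsFreeProP.exists_filtration_le {d : ℕ} {x : Fin d → F} (hF : IsFreeProP p x)
    (U : OpenNormalSubgroup F) :
    ∃ n, ∀ y, hF.magnus y - 1 ∈ filtration p d n → y ∈ U.toSubgroup := by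
  obtain ⟨n, hn⟩ : ∃ n, ∀ c ∈ filtration p d n,
      magnusQuotient hF.toIsProP (ContinuousMonoidHom.id F) x U c = 0 :=
    ⟨_, fun _ => eval_eq_zero_of_mem_filtration _ _⟩
  refine ⟨n, fun y hy => ?_⟩
  have magnusQuotient_eq_zero := hn _ hy
  rw [map_sub, map_one, hF.magnusQuotient_magnus, sub_eq_zero, ← map_one
    (MonoidAlgebra.of (ZMod p) (F ⧸ U.toSubgroup))] at magnusQuotient_eq_zero
  exact (QuotientGroup.eq_one_iff y).1 (MonoidAlgebra.of_injective magnusQuotient_eq_zero)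

end RelationModule

namespace FreeRelators

open MagnusAlgebra CompletedGroupAlgebra

variable {p d : ℕ} [Fact p.Prime] {I : Type*} (S : FreeRelators p d I)
  {F : Type*} [Group F] [TopologicalSpace F] [IsTopologicalGroup F] {x : Fin d → F}
  (hF : IsFreeProP p x) {G : Type*} [Group G] [TopologicalSpace G] [IsTopologicalGroup G]
  (hG : IsProP p G) {π : F →ₜ* G}

/-- The coefficient in `Λ_G` of the relation `k` in a series, modulo `J M`. -/
def completedCoeff (π : F →ₜ* G) (k : I) :
    MagnusAlgebra p d →ₗ[ZMod p] CompletedGroupAlgebra p G :=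
  (hF.toCompleted hG π).toLinearMap.comp (S.relCoeff k)

theorem continuous_completedCoeff (k : I) : Continuous (S.completedCoeff hF hG π k) :=
  (hF.continuous_toCompleted hG π).comp (S.continuous_relCoeff k)

theorem completedCoeff_mul_of_mem {g b : MagnusAlgebra p d} (hg : g ∈ S.ideal) (hb : b [] = 0)
    (k : I) : S.completedCoeff hF hG π k (g * b) = 0 := by
  rw [completedCoeff, LinearMap.comp_apply, S.relCoeff_mul_of_mem hg hb, map_zero]

section

variable (hker : ∀ c, hF.toCompleted hG π c = 0 ↔ c ∈ S.ideal)

include hker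

theorem completedCoeff_mul (a : MagnusAlgebra p d) {g : MagnusAlgebra p d} (hg : g ∈ S.ideal)
    (k : I) : S.completedCoeff hF hG π k (a * g) =
      hF.toCompleted hG π a * S.completedCoeff hF hG π k g := by
  have toCompleted_sub := (hker _).2 (S.mul_relCoeff_sub_relCoeff_mul_mem a hg k)
  rw [map_sub, map_mul, sub_eq_zero] at toCompleted_sub
  exact toCompleted_sub.symm

open Classical in
theorem completedCoeff_mul_rel (a : MagnusAlgebra p d) (i k : I) :
    S.completedCoeff hF hG π k (a * S.rel i) = if k = i then hF.toCompleted hG π a else 0 := by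
  rw [completedCoeff, LinearMap.comp_apply, S.relCoeff_mul_rel]
  split_ifs
  · exact S.toCompleted_normalPart hF hG hker a
  · exact map_zero _

end

variable (hmem : ∀ r ∈ (π : F →* G).ker, hF.magnus r - 1 ∈ S.ideal)

/-- The homomorphism `R → ∏ Λ_G` given by the coefficients of `r - 1`. -/
def relHom : (π : F →* G).ker →* Multiplicative (I → CompletedGroupAlgebra p G) where
  toFun r := Multiplicative.ofAdd fun k => S.completedCoeff hF hG π k (hF.magnus r - 1)
  map_one' := by
    rw [OneMemClass.coe_one, map_one, sub_self]
    simp only [map_zero]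
    rfl
  map_mul' r s := by
    have magnus_mul_sub_one : hF.magnus ((r * s : (π : F →* G).ker) : F) - 1 =
        (hF.magnus r - 1) + (hF.magnus s - 1) + (hF.magnus r - 1) * (hF.magnus s - 1) := by
      rw [Subgroup.coe_mul, map_mul]
      noncomm_ring
    rw [magnus_mul_sub_one]
    simp only [map_add, add_zero,
      S.completedCoeff_mul_of_mem hF hG (hmem r r.2) (hF.magnus_sub_one_nil s)]
    rfl

theorem continuous_relHom :
    Continuous fun r : (π : F →* G).ker => (S.relHom hF hG hmem r).toAdd :=
  continuous_pi fun k => (S.continuous_completedCoeff hF hG k).comp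
    ((hF.continuous_magnus.comp continuous_subtype_val).sub continuous_const)

/-- The homomorphism `R / R^p[R,R] → ∏ Λ_G` given by the coefficients of `r - 1`. -/
def relMap : RelationModule p (π : F →* G).ker →+ (I → CompletedGroupAlgebra p G) :=
  RelationModule.lift (S.continuous_relHom hF hG hmem)

theorem relMap_mk (r : (π : F →* G).ker) (k : I) :
    S.relMap hF hG hmem (RelationModule.mk p r) k =
      S.completedCoeff hF hG π k (hF.magnus r - 1) := by
  rw [relMap, RelationModule.lift_mk]
  rfl

theorem continuous_relMap : Continuous (S.relMap hF hG hmem) :=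
  RelationModule.continuous_lift _

variable (hker : ∀ c, hF.toCompleted hG π c = 0 ↔ c ∈ S.ideal)

include hker

theorem relMap_conj (y : F) (r : (π : F →* G).ker) :
    S.relMap hF hG hmem (RelationModule.mk p (MulAut.conjNormal y r)) =
      of p (π y) • S.relMap hF hG hmem (RelationModule.mk p r) := by
  have magnus_conj_sub_one : hF.magnus (y * r * y⁻¹) - 1 = hF.magnus y * (hF.magnus r - 1) +
      hF.magnus y * (hF.magnus r - 1) * (hF.magnus y⁻¹ - 1) := by
    have magnus_mul_magnus_inv : hF.magnus y * hF.magnus y⁻¹ = 1 := by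
      rw [← map_mul, mul_inv_cancel, map_one]
    rw [map_mul, map_mul]
    conv_lhs => rw [← magnus_mul_magnus_inv]
    noncomm_ring
  funext k
  rw [Pi.smul_apply, smul_eq_mul, relMap_mk, relMap_mk, ← hF.toCompleted_magnus hG π,
    ← S.completedCoeff_mul hF hG hker _ (hmem r r.2), MulAut.conjNormal_apply,
    magnus_conj_sub_one, map_add,
    S.completedCoeff_mul_of_mem hF hG (S.mul_mem_ideal_left _ (hmem r r.2))
      (hF.magnus_sub_one_nil _), add_zero]

variable {ρ : I → (π : F →* G).ker} (hS : ∀ i, S.rel i = hF.magnus (ρ i) - 1)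

include hS

open Classical in
theorem relMap_generator (y : F) (i : I) :
    S.relMap hF hG hmem (RelationModule.mk p (MulAut.conjNormal y (ρ i))) =
      (Pi.single i (of p (π y)) : I → CompletedGroupAlgebra p G) := by
  rw [S.relMap_conj hF hG hmem hker]
  funext k
  have completedCoeff_rel := S.completedCoeff_mul_rel hF hG hker 1 i k
  rw [one_mul, map_one, hS] at completedCoeff_rel
  rw [Pi.smul_apply, relMap_mk, completedCoeff_rel, Pi.single_apply, smul_eq_mul, mul_ite,
    mul_one, mul_zero]

open Classical in
theorem single_mem_range_relMap (hπ : Function.Surjective π)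
    (hrange : IsClosed (Set.range (S.relMap hF hG hmem))) (i : I) (z : CompletedGroupAlgebra p G) :
    (Pi.single i z : I → CompletedGroupAlgebra p G) ∈ (S.relMap hF hG hmem).range := by
  obtain ⟨c, rfl⟩ := hF.toCompleted_surjective hG π hπ z
  let L : MagnusAlgebra p d →ₗ[ZMod p] (I → CompletedGroupAlgebra p G) :=
    (LinearMap.single (ZMod p) (fun _ : I => CompletedGroupAlgebra p G) i).comp
      (hF.toCompleted hG π).toLinearMap
  have continuous_L : Continuous L :=
    (continuous_single i).comp (hF.continuous_toCompleted hG π)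
  let T : Submodule (ZMod p) (MagnusAlgebra p d) :=
    (AddSubgroup.toZModSubmodule p (S.relMap hF hG hmem).range).comap L
  have T_eq_top : T = ⊤ := hF.eq_top_of_magnus_mem (hrange.preimage continuous_L) fun y => by
    refine ⟨RelationModule.mk p (MulAut.conjNormal y (ρ i)), ?_⟩
    rw [S.relMap_generator hF hG hmem hker hS, ← hF.toCompleted_magnus hG π]
    rfl
  exact (T_eq_top ▸ Submodule.mem_top : c ∈ T)

theorem relMap_surjective (hπ : Function.Surjective π) :
    Function.Surjective (S.relMap hF hG hmem) := by
  classical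
  have := hG.t2Space
  have : CompactSpace (π : F →* G).ker := hF.toIsProP.compactSpace_ker hG
  have isClosed_range : IsClosed (Set.range (S.relMap hF hG hmem)) :=
    (isCompact_range (S.continuous_relMap hF hG hmem)).isClosed
  exact AddMonoidHom.range_eq_top.1
    (eq_top_of_isClosed_of_forall_single_mem isClosed_range
      (S.single_mem_range_relMap hF hG hmem hker hS hπ isClosed_range))

omit [IsTopologicalGroup G] hker in
theorem finite_notMem_openNormalSubgroup (U : OpenNormalSubgroup F) :
    {i | (ρ i : F) ∉ U.toSubgroup}.Finite := by
  obtain ⟨n, hn⟩ := hF.exists_filtration_le U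
  refine (S.finite_length_lead_le n).subset fun i hi => ?_
  by_contra! hlt
  exact hi (hn _ (hS i ▸ S.rel_mem_filtration (not_le.1 hlt).le))

/-- A homomorphism to a discrete group kills almost all generators, so that it factors through
finitely many of the coefficients. -/
theorem map_eq_zero_of_relMap_eq_zero (hπ : Function.Surjective π)
    (hρ : GeneratesRelationModule p ρ) {Q : Type*} [AddCommGroup Q] [Module (ZMod p) Q]
    [TopologicalSpace Q] [DiscreteTopology Q] {q : RelationModule p (π : F →* G).ker →+ Q}
    (hq : Continuous q) {m : RelationModule p (π : F →* G).ker}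
    (hm : S.relMap hF hG hmem m = 0) : q m = 0 := by
  classical
  obtain ⟨U, hU⟩ := RelationModule.exists_openNormalSubgroup_map_mk_eq_zero hF.toIsProP hq
  choose L continuous_L L_of using fun i =>
    RelationModule.exists_linearMap_mk_conjNormal hF.toIsProP hG hπ hq (ρ i)
  let s : Finset I := (S.finite_notMem_openNormalSubgroup hF hS U).toFinset
  let C : (I → CompletedGroupAlgebra p G) →ₗ[ZMod p] Q :=
    ∑ i ∈ s, (L i).comp (LinearMap.proj i)
  have C_apply (c) : C c = ∑ i ∈ s, L i (c i) := by
    simp only [C, LinearMap.sum_apply, LinearMap.comp_apply, LinearMap.proj_apply]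
  have continuous_C : Continuous C :=
    (continuous_finsetSum s fun i _ => (continuous_L i).comp (continuous_apply i)).congr
      fun c => (C_apply c).symm
  have eqLocus_eq_top : (C.toAddMonoidHom.comp (S.relMap hF hG hmem)).eqLocus q = ⊤ := by
    refine hρ.eq_top_of_isClosed
      (isClosed_eq (continuous_C.comp (S.continuous_relMap hF hG hmem)) hq) fun y i => ?_
    change C (S.relMap hF hG hmem _) = q _
    rw [S.relMap_generator hF hG hmem hker hS, C_apply]
    by_cases hi : i ∈ s
    · rw [Finset.sum_eq_single_of_mem i hi, Pi.single_eq_same, L_of]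
      intro k _ hk
      rw [Pi.single_eq_of_ne hk, map_zero]
    · rw [Finset.sum_eq_zero, hU]
      · rw [MulAut.conjNormal_apply]
        exact U.isNormal'.conj_mem _ (by simpa [s] using hi) y
      · intro k hk
        rw [Pi.single_eq_of_ne (ne_of_mem_of_not_mem hk hi), map_zero]
  have map_eq : C (S.relMap hF hG hmem m) = q m :=
    (eqLocus_eq_top ▸ AddSubgroup.mem_top m :
      m ∈ (C.toAddMonoidHom.comp (S.relMap hF hG hmem)).eqLocus q)
  rw [← map_eq, hm, map_zero]

theorem relMap_injective (hπ : Function.Surjective π) (hρ : GeneratesRelationModule p ρ) :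
    Function.Injective (S.relMap hF hG hmem) := by
  rw [injective_iff_map_eq_zero]
  intro m hm
  by_contra m_ne_zero
  have : CompactSpace (π : F →* G).ker := hF.toIsProP.compactSpace_ker hG
  have := hF.totallyDisconnectedSpace
  obtain ⟨A, isOpen_A, m_notMem⟩ := RelationModule.exists_addSubgroup_isOpen_notMem m_ne_zero
  have : DiscreteTopology (RelationModule p (π : F →* G).ker ⧸ A) :=
    QuotientAddGroup.discreteTopology isOpen_A
  let _ : Module (ZMod p) (RelationModule p (π : F →* G).ker ⧸ A) :=
    QuotientAddGroup.zmodModule fun a => (RelationModule.nsmul_eq_zero a).symm ▸ A.zero_mem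
  exact m_notMem ((QuotientAddGroup.eq_zero_iff m).1
    (S.map_eq_zero_of_relMap_eq_zero hF hG hmem hker hS hπ hρ
      (q := QuotientAddGroup.mk' A) QuotientAddGroup.continuous_mk hm))

include hmem in
theorem exists_module_continuousLinearEquiv (hπ : Function.Surjective π)
    (hρ : GeneratesRelationModule p ρ) :
    ∃ _ : Module (CompletedGroupAlgebra p G) (RelationModule p (π : F →* G).ker),
      (Continuous fun c : CompletedGroupAlgebra p G × RelationModule p (π : F →* G).ker =>
        c.1 • c.2) ∧
      (∀ (y : F) (r : (π : F →* G).ker),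
        of p (π y) • RelationModule.mk p r = RelationModule.mk p (MulAut.conjNormal y r)) ∧
      Nonempty (RelationModule p (π : F →* G).ker ≃L[CompletedGroupAlgebra p G]
        (I → CompletedGroupAlgebra p G)) := by
  have := hG.t2Space
  have : CompactSpace (π : F →* G).ker := hF.toIsProP.compactSpace_ker hG
  let e : RelationModule p (π : F →* G).ker ≃+ (I → CompletedGroupAlgebra p G) :=
    AddEquiv.ofBijective (S.relMap hF hG hmem) ⟨S.relMap_injective hF hG hmem hker hS hπ hρ,
      S.relMap_surjective hF hG hmem hker hS hπ⟩
  have continuous_e : Continuous e := S.continuous_relMap hF hG hmem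
  have continuous_symm : Continuous e.symm :=
    (Continuous.homeoOfEquivCompactToT2 (f := e.toEquiv) continuous_e).continuous_symm
  let _ : Module (CompletedGroupAlgebra p G) (RelationModule p (π : F →* G).ker) :=
    AddEquiv.module (CompletedGroupAlgebra p G) e
  have smul_def (a : CompletedGroupAlgebra p G) (m : RelationModule p (π : F →* G).ker) :
      a • m = e.symm (a • e m) := rfl
  refine ⟨inferInstance, ?_, fun y r => ?_, ⟨?_⟩⟩
  · simp only [smul_def]
    refine continuous_symm.comp (continuous_pi fun k => ?_)
    exact continuous_fst.mul ((continuous_apply k).comp (continuous_e.comp continuous_snd))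
  · rw [smul_def, AddEquiv.symm_apply_eq]
    exact (S.relMap_conj hF hG hmem hker y r).symm
  · exact
      { e with
        map_smul' := fun a m => by
          rw [smul_def]
          exact e.apply_symm_apply _
        continuous_toFun := continuous_e
        continuous_invFun := continuous_symm }

end FreeRelators

/-! ### Cochains of smooth representations -/

section Homology

open CategoryTheory Limits TopModuleCat

theorem subsingleton_homology_of_exact {R : Type*} [Ring R] [TopologicalSpace R]
    (S : ShortComplex (TopModuleCat R)) (hS : ∀ x, S.g.hom x = 0 → ∃ y, S.f.hom y = x) :
    Subsingleton S.homology := by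
  let D : S.LeftHomologyData :=
    ⟨_, _, _, _, kerι_comp S.g, isLimitKer _, comp_cokerπ _, isColimitCoker _⟩
  have : Subsingleton D.H := by
    refine ⟨fun a b => ?_⟩
    obtain ⟨a, rfl⟩ := Submodule.mkQ_surjective _ a
    obtain ⟨b, rfl⟩ := Submodule.mkQ_surjective _ b
    refine (Submodule.Quotient.eq _).2 ?_
    obtain ⟨y, hy⟩ := hS _ (a - b).2
    exact ⟨y, Subtype.ext hy⟩
  exact (ConcreteCategory.bijective_of_isIso D.homologyIso.hom).injective.subsingleton

end Homology

theorem discreteTopology_continuousMap {A B : Type*} [TopologicalSpace A] [CompactSpace A]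
    [TopologicalSpace B] [DiscreteTopology B] : DiscreteTopology C(A, B) := by
  refine discreteTopology_iff_isOpen_singleton.2 fun f => ?_
  have finite_range : (Set.range f).Finite := (isCompact_range f.continuous).finite_of_discrete
  have singleton_eq :
      {f} = ⋂ b ∈ Set.range f, {h : C(A, B) | Set.MapsTo h (f ⁻¹' {b}) {b}} := by
    ext h
    simp only [Set.mem_singleton_iff, Set.mem_iInter, Set.mem_ofPred_eq]
    refine ⟨fun hf b _ a ha => hf ▸ ha, fun mapsTo => ContinuousMap.ext fun a => ?_⟩
    exact mapsTo (f a) ⟨a, rfl⟩ (rfl : f a = f a)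
  rw [singleton_eq]
  refine finite_range.isOpen_biInter fun b _ =>
    ContinuousMap.isOpen_setOfPred_mapsTo ?_ (isOpen_discrete _)
  exact ((isClosed_discrete {b}).preimage f.continuous).isCompact

section Cochains

universe u v w

open CategoryTheory ContRepresentation TopRep

variable {k : Type u} {G : Type v} [Ring k] [TopologicalSpace k] [Group G] [TopologicalSpace G]

/-- A representation on a discrete module in which every stabilizer is open. -/
class IsSmoothRep (X : TopRep.{w} k G) : Prop where
  discreteTopology : DiscreteTopology X
  continuous_orbit : ∀ v : X, Continuous fun g => X.ρ g v

instance isSmoothRep_trivial (V : Type*) [AddCommGroup V] [Module k V] [TopologicalSpace V]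
    [IsTopologicalAddGroup V] [ContinuousSMul k V] [hV : DiscreteTopology V] :
    IsSmoothRep (TopRep.of (ContRepresentation.trivial k G V)) where
  discreteTopology := hV
  continuous_orbit _ := continuous_const

variable [IsTopologicalGroup G]

instance isSmoothRep_coind₁ [CompactSpace G] (X : TopRep.{w} k G) [hX : IsSmoothRep X] :
    IsSmoothRep X.coind₁ where
  discreteTopology := by
    have := hX.discreteTopology
    exact discreteTopology_continuousMap
  continuous_orbit f := by
    have := hX.discreteTopology
    have continuous_action : Continuous fun z : X × G => X.ρ z.2 z.1 := by
      rw [continuous_prod_of_discrete_left]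
      exact hX.continuous_orbit
    let orbit : C(G × G, X) := ⟨fun z => X.ρ z.1 (f (z.1⁻¹ * z.2)),
      continuous_action.comp
        ((f.continuous.comp (continuous_fst.inv.mul continuous_snd)).prodMk continuous_fst)⟩
    exact orbit.curry.continuous

instance isSmoothRep_resolutionX [CompactSpace G] (X : TopRep.{v} k G) [IsSmoothRep X] :
    ∀ n, IsSmoothRep (resolutionX X n)
  | 0 => ‹_›
  | n + 1 => @isSmoothRep_coind₁ _ _ _ _ _ _ _ _ (resolutionX X n) (isSmoothRep_resolutionX X n)

/-- The morphism of homogeneous resolutions induced by a morphism of representations. -/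
def resolutionXMap {X Y : TopRep.{v} k G} (a : X ⟶ Y) :
    ∀ n, resolutionX X n ⟶ resolutionX Y n
  | 0 => a
  | n + 1 => (coind₁Functor k G).map (resolutionXMap a n)

theorem resolutionXMap_succ_apply {X Y : TopRep.{v} k G} (a : X ⟶ Y) (n : ℕ)
    (f : C(G, resolutionX X n)) (g : G) :
    ((resolutionXMap a (n + 1)).hom f : C(G, resolutionX Y n)) g = (resolutionXMap a n).hom (f g) :=
  rfl

theorem resolutionX_d_succ_apply (X : TopRep.{v} k G) (n : ℕ) (f : C(G, resolutionX X n)) (g : G) :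
    ((d X (n + 1)).hom f : C(G, C(G, resolutionX X n))) g = f - (d X n).hom (f g) := rfl

theorem resolutionX_d_d_apply (X : TopRep.{v} k G) (n : ℕ) (x : resolutionX X n) :
    (d X (n + 1)).hom ((d X n).hom x) = 0 :=
  DFunLike.congr_fun (congrArg Hom.hom (d_comp_d X n)) x

theorem resolutionXMap_d {X Y : TopRep.{v} k G} (a : X ⟶ Y) :
    ∀ (n : ℕ) (x : resolutionX X n),
      (resolutionXMap a (n + 1)).hom ((d X n).hom x) = (d Y n).hom ((resolutionXMap a n).hom x)
  | 0, _ => rfl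
  | n + 1, f => by
    refine ContinuousMap.ext fun g => ?_
    refine (resolutionXMap_succ_apply a (n + 1) _ g).trans ?_
    refine Eq.trans ?_ (resolutionX_d_succ_apply Y n _ g).symm
    refine (congrArg _ (resolutionX_d_succ_apply X n f g)).trans ?_
    rw [map_sub]
    exact congrArg _ (resolutionXMap_d a n (f g))

theorem resolutionXMap_injective {X Y : TopRep.{v} k G} {a : X ⟶ Y}
    (ha : Function.Injective a.hom) : ∀ n, Function.Injective (resolutionXMap a n).hom
  | 0 => ha
  | n + 1 => fun _ _ h => ContinuousMap.ext fun g =>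
      resolutionXMap_injective ha n (DFunLike.congr_fun (F := C(G, resolutionX Y n)) h g)

theorem resolutionXMap_zero {X Y : TopRep.{v} k G} :
    ∀ (n : ℕ) (x : resolutionX X n), (resolutionXMap (0 : X ⟶ Y) n).hom x = 0
  | 0, _ => rfl
  | n + 1, f => ContinuousMap.ext fun g => resolutionXMap_zero n (f g)

theorem resolutionXMap_exact [CompactSpace G] {X Y Z : TopRep.{v} k G} [IsSmoothRep Y]
    {a : X ⟶ Y} {b : Y ⟶ Z} (hab : Function.Exact a.hom b.hom) :
    ∀ n, Function.Exact (resolutionXMap a n).hom (resolutionXMap b n).hom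
  | 0 => hab
  | n + 1 => fun f => by
    refine ⟨fun hf => ?_, ?_⟩
    · have := (isSmoothRep_resolutionX Y n).discreteTopology
      have exists_preimage : ∀ y : Set.range (f : C(G, resolutionX Y n)),
          ∃ x, (resolutionXMap a n).hom x = y := by
        rintro ⟨_, g, rfl⟩
        exact (resolutionXMap_exact hab n _).1
          (DFunLike.congr_fun (F := C(G, resolutionX Z n)) hf g)
      choose s hs using exists_preimage
      refine ⟨(⟨fun g => s ⟨(f : C(G, resolutionX Y n)) g, g, rfl⟩, ?_⟩ : C(G, resolutionX X n)),
        ContinuousMap.ext fun g => hs _⟩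
      exact continuous_of_discreteTopology.comp
        ((map_continuous (f : C(G, resolutionX Y n))).subtype_mk fun g => ⟨g, rfl⟩)
    · rintro ⟨f, rfl⟩
      exact ContinuousMap.ext fun g =>
        (resolutionXMap_exact hab n _).2 ⟨(f : C(G, resolutionX X n)) g, rfl⟩

omit [TopologicalSpace G] [IsTopologicalGroup G] in
theorem hom_mem_invariants {X Y : TopRep.{w} k G} (f : X ⟶ Y) {x : X}
    (hx : x ∈ X.ρ.invariants) : f.hom x ∈ Y.ρ.invariants := fun g => by
  rw [← hom_comm_apply, hx g]

theorem mem_invariants_coind₁ {X : TopRep.{w} k G} {f : C(G, X)} :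
    f ∈ X.coind₁.ρ.invariants ↔ ∀ g, f g = X.ρ g (f 1) := by
  refine ⟨fun h g => ?_, fun h g => ContinuousMap.ext fun x => ?_⟩
  · refine (DFunLike.congr_fun (F := C(G, X)) (h g) g).symm.trans ?_
    refine (coind₁_apply_apply X.ρ g f g).trans ?_
    rw [inv_mul_cancel]
  · refine (coind₁_apply_apply X.ρ g f x).trans ?_
    rw [h, h x]
    refine (DFunLike.congr_fun (map_mul X.ρ g (g⁻¹ * x)) (f 1)).symm.trans ?_
    rw [mul_inv_cancel_left]

theorem exists_invariant_resolutionXMap_eq [CompactSpace G] {X Y Z : TopRep.{v} k G}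
    [IsSmoothRep X] [IsSmoothRep Y] {a : X ⟶ Y} {b : Y ⟶ Z}
    (hab : Function.Exact a.hom b.hom) (n : ℕ) {y : resolutionX Y (n + 1)}
    (hy : y ∈ (resolutionX Y (n + 1)).ρ.invariants) (hby : (resolutionXMap b (n + 1)).hom y = 0) :
    ∃ x ∈ (resolutionX X (n + 1)).ρ.invariants, (resolutionXMap a (n + 1)).hom x = y := by
  obtain ⟨x, hx⟩ := (resolutionXMap_exact hab n ((y : C(G, resolutionX Y n)) 1)).1
    (DFunLike.congr_fun (F := C(G, resolutionX Z n)) hby 1)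
  let orbit : C(G, resolutionX X n) := ⟨fun g => (resolutionX X n).ρ g x,
    (isSmoothRep_resolutionX X n).continuous_orbit x⟩
  refine ⟨orbit, mem_invariants_coind₁.2 fun g => ?_, ContinuousMap.ext fun g => ?_⟩
  · change (resolutionX X n).ρ g x = (resolutionX X n).ρ g ((resolutionX X n).ρ 1 x)
    rw [map_one]
    rfl
  · refine Eq.trans ?_ (mem_invariants_coind₁.1 hy g).symm
    rw [← hx]
    exact hom_comm_apply _ g x

/-- Exactness of the complex of homogeneous cochains with values in `X` at the degree `n`, for
`n > 0`: it says that `Hⁿ(G, X) = 0`. -/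
def CochainExact (X : TopRep.{v} k G) (n : ℕ) : Prop :=
  ∀ σ ∈ (resolutionX X (n + 1)).ρ.invariants, (d X (n + 1)).hom σ = 0 →
    ∃ κ ∈ (resolutionX X n).ρ.invariants, (d X n).hom κ = σ

theorem CochainExact.subsingleton_continuousCohomology {X : TopRep.{v} k G} {n : ℕ}
    (h : CochainExact X (n + 1)) : Subsingleton (continuousCohomology (n + 1) X) := by
  have : Subsingleton ((homogeneousCochains X).sc' n (n + 1) (n + 2)).homology := by
    refine subsingleton_homology_of_exact _ fun σ hσ => ?_
    obtain ⟨κ, hκ, d_κ⟩ := h σ.1 σ.2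
      ((homogeneousCochains.d_apply X (n + 1) σ).symm.trans (congrArg Subtype.val hσ))
    exact ⟨⟨κ, hκ⟩, Subtype.ext ((homogeneousCochains.d_apply X n ⟨κ, hκ⟩).trans d_κ)⟩
  exact (ConcreteCategory.bijective_of_isIso
    ((homogeneousCochains X).homologyIsoSc' n (n + 1) (n + 2) (by simp) (by simp)).hom
    ).injective.subsingleton

section Acyclic

variable [CompactSpace G]

/-- The exchange of the two variables of a function in `C(G, C(G, X))`. -/
def coindSwap (X : TopRep.{w} k G) [IsSmoothRep X] : X.coind₁.coind₁ ⟶ X.coind₁.coind₁ :=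
  ofHom
    { toFun := fun f : C(G, C(G, X)) =>
        (⟨fun z : G × G => f z.2 z.1, by fun_prop⟩ : C(G × G, X)).curry
      map_add' := fun _ _ => rfl
      map_smul' := fun _ _ => rfl
      cont := by
        have := (isSmoothRep_coind₁ X.coind₁).discreteTopology
        exact continuous_of_discreteTopology
      isIntertwining' := fun _ => rfl }

/-- The restriction of a function in `C(G, C(G, X))` to the diagonal. -/
def coindDiagonal (X : TopRep.{w} k G) [IsSmoothRep X] : X.coind₁.coind₁ ⟶ X.coind₁ :=
  ofHom
    { toFun := fun f : C(G, C(G, X)) => (⟨fun g => f g g, by fun_prop⟩ : C(G, X))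
      map_add' := fun _ _ => rfl
      map_smul' := fun _ _ => rfl
      cont := by
        have := (isSmoothRep_coind₁ X.coind₁).discreteTopology
        exact continuous_of_discreteTopology
      isIntertwining' := fun _ => rfl }

/-- The extension to the homogeneous resolution of a morphism `C(G, X) → X`, applied to the first
variable after moving it past the others. -/
def resolutionRetraction {X : TopRep.{v} k G} [IsSmoothRep X] (s : X.coind₁ ⟶ X) :
    ∀ n, (resolutionX X n).coind₁ ⟶ resolutionX X n
  | 0 => s
  | n + 1 => coindSwap (resolutionX X n) ≫ (coind₁Functor k G).map (resolutionRetraction s n)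

/-- The function `g ↦ f g g₀`. -/
def evalSecond {Y : Type*} [TopologicalSpace Y] (f : C(G, C(G, Y))) (g₀ : G) : C(G, Y) :=
  ⟨fun g => f g g₀, (continuous_eval_const g₀).comp f.continuous⟩

variable {X : TopRep.{v} k G} [IsSmoothRep X] (s : X.coind₁ ⟶ X)

theorem resolutionRetraction_succ_apply (n : ℕ) (f : C(G, C(G, resolutionX X n))) (g₀ : G) :
    ((resolutionRetraction s (n + 1)).hom f : C(G, resolutionX X n)) g₀ =
      (resolutionRetraction s n).hom (evalSecond f g₀) := rfl

theorem resolutionRetraction_d :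
    ∀ (n : ℕ) (f : C(G, resolutionX X n)),
      (resolutionRetraction s (n + 1)).hom ((coind₁Map (d X n).hom) f) =
        (d X n).hom ((resolutionRetraction s n).hom f)
  | 0, f => rfl
  | n + 1, f => by
    refine ContinuousMap.ext fun g₀ => ?_
    refine (resolutionRetraction_succ_apply s (n + 1) _ g₀).trans ?_
    refine Eq.trans ?_ (resolutionX_d_succ_apply X n _ g₀).symm
    have evalSecond_d : evalSecond (coind₁Map (d X (n + 1)).hom f) g₀ =
        f - coind₁Map (d X n).hom (evalSecond (Y := resolutionX X n) f g₀) := rfl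
    rw [evalSecond_d, map_sub]
    exact congrArg _ (resolutionRetraction_d n _)

variable {s} (hs : ∀ x, s.hom (ContinuousMap.const G x) = x)

include hs

theorem resolutionRetraction_const :
    ∀ (n : ℕ) (z : resolutionX X n),
      (resolutionRetraction s n).hom (ContinuousMap.const G z) = z
  | 0, z => hs z
  | n + 1, z => ContinuousMap.ext fun g₀ =>
      (resolutionRetraction_succ_apply s n _ g₀).trans (resolutionRetraction_const n (z g₀))

theorem CochainExact.of_retraction (n : ℕ) : CochainExact X n := by
  intro f hf hdf
  refine ⟨(resolutionRetraction s n).hom f, hom_mem_invariants (X := (resolutionX X n).coind₁)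
    (resolutionRetraction s n) hf, ?_⟩
  have coind₁Map_d_eq_const : coind₁Map (d X n).hom f = ContinuousMap.const G f :=
    ContinuousMap.ext fun g =>
      (sub_eq_zero.1 (DFunLike.congr_fun (F := C(G, C(G, resolutionX X n))) hdf g)).symm
  rw [← resolutionRetraction_d, coind₁Map_d_eq_const]
  exact resolutionRetraction_const hs (n + 1) f

end Acyclic

theorem CochainExact.coind₁ [CompactSpace G] (Y : TopRep.{0} k G) [IsSmoothRep Y] (n : ℕ) :
    CochainExact Y.coind₁ n :=
  .of_retraction (s := coindDiagonal Y) (fun _ => rfl) n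

/-- Dimension shifting along `0 → A → M₀ → M₁ → M₂ → 0`: a cocycle of `A` is pushed to `M₀`, `M₁`
and `M₂`, where it bounds, and the cochains that it bounds are lifted back one term at a time. -/
theorem CochainExact.of_exact [CompactSpace G] {A M₀ M₁ M₂ : TopRep.{v} k G} [IsSmoothRep A]
    [IsSmoothRep M₀] [IsSmoothRep M₁] [IsSmoothRep M₂] (h₀ : ∀ n, CochainExact M₀ n)
    (h₁ : ∀ n, CochainExact M₁ n) (h₂ : ∀ n, CochainExact M₂ n)
    {a : A ⟶ M₀} {b : M₀ ⟶ M₁} {c : M₁ ⟶ M₂} (ha : Function.Injective a.hom)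
    (hab : Function.Exact a.hom b.hom) (hbc : Function.Exact b.hom c.hom)
    (hc : Function.Surjective c.hom) (n : ℕ) : CochainExact A (n + 3) := by
  intro σ hσ hdσ
  obtain ⟨τ₀, hτ₀, d_τ₀⟩ := h₀ (n + 3) _ (hom_mem_invariants (resolutionXMap a (n + 4)) hσ) (by
    rw [← resolutionXMap_d, hdσ, map_zero])
  obtain ⟨τ₁, hτ₁, d_τ₁⟩ := h₁ (n + 2) _ (hom_mem_invariants (resolutionXMap b (n + 3)) hτ₀) (by
    rw [← resolutionXMap_d, d_τ₀, (resolutionXMap_exact hab _).apply_apply_eq_zero])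
  obtain ⟨τ₂, hτ₂, d_τ₂⟩ := h₂ (n + 1) _ (hom_mem_invariants (resolutionXMap c (n + 2)) hτ₁) (by
    rw [← resolutionXMap_d, d_τ₁, (resolutionXMap_exact hbc _).apply_apply_eq_zero])
  have exact_zero : Function.Exact c.hom (0 : M₂ ⟶ M₂).hom := fun y =>
    ⟨fun _ => hc y, fun _ => rfl⟩
  obtain ⟨υ₁, hυ₁, c_υ₁⟩ := exists_invariant_resolutionXMap_eq exact_zero n hτ₂
    (resolutionXMap_zero _ _)
  obtain ⟨υ₀, hυ₀, b_υ₀⟩ := exists_invariant_resolutionXMap_eq hbc (n + 1)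
    (sub_mem hτ₁ (hom_mem_invariants (d M₁ (n + 1)) hυ₁)) (by
      rw [map_sub, resolutionXMap_d, c_υ₁, d_τ₂, sub_self])
  obtain ⟨κ, hκ, a_κ⟩ := exists_invariant_resolutionXMap_eq hab (n + 2)
    (sub_mem hτ₀ (hom_mem_invariants (d M₀ (n + 2)) hυ₀)) (by
      rw [map_sub, resolutionXMap_d, b_υ₀, map_sub, d_τ₁, resolutionX_d_d_apply, sub_zero,
        sub_self])
  refine ⟨κ, hκ, resolutionXMap_injective ha _ ?_⟩
  rw [resolutionXMap_d, a_κ, map_sub, d_τ₀, resolutionX_d_d_apply, sub_zero]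

/-- A linear map of coinduced modules commuting with left translations, as a morphism of
representations. -/
def coindHomOfTranslation [CompactSpace G] {V W : Type w} [AddCommGroup V] [Module k V]
    [TopologicalSpace V] [IsTopologicalAddGroup V] [ContinuousSMul k V] [DiscreteTopology V]
    [AddCommGroup W] [Module k W] [TopologicalSpace W] [IsTopologicalAddGroup W]
    [ContinuousSMul k W] (T : C(G, V) →ₗ[k] C(G, W))
    (hT : ∀ (f f' : C(G, V)) (g : G), (∀ u, f' u = f (g * u)) → ∀ u, T f' u = T f (g * u)) :
    (TopRep.of (ContRepresentation.trivial k G V)).coind₁ ⟶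
      (TopRep.of (ContRepresentation.trivial k G W)).coind₁ :=
  ofHom
    { toLinearMap := T
      cont := by
        have : DiscreteTopology C(G, V) := discreteTopology_continuousMap
        exact continuous_of_discreteTopology
      isIntertwining' := fun g => ContinuousLinearMap.ext fun f => ContinuousMap.ext fun u =>
        hT f _ g⁻¹ (fun _ => rfl) u }

end Cochains

theorem cohomologicalDimension_le_two_of_cochainExact {p : ℕ} {G : Type*} [Group G]
    [TopologicalSpace G] [IsTopologicalGroup G] (h : ∀ n, CochainExact
      (TopRep.of (ContRepresentation.trivial (ZMod p) G (ULift (ZMod p)))) (n + 3)) :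
    cohomologicalDimension p G ≤ 2 := by
  refine sInf_le fun i hi => ?_
  obtain ⟨n, rfl⟩ := Nat.exists_eq_add_of_le' (by exact_mod_cast hi : 2 < i)
  exact (h n).subsingleton_continuousCohomology

/-! ### Functionals on completed group algebras and on series -/

open MagnusAlgebra

namespace MagnusAlgebra

variable {p d : ℕ}

theorem deriv_mul (j : Fin d) (a : MagnusAlgebra p d) {b : MagnusAlgebra p d} (hb : b [] = 0) :
    deriv j (a * b) = a * deriv j b := by
  conv_lhs => rw [eq_sum_deriv_mul_X hb, Finset.mul_sum, map_sum]
  simp only [← mul_assoc, deriv_mul_X, Finset.sum_ite_eq, Finset.mem_univ, if_true]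

theorem exists_filtration_le_ker {Y : Type*} [AddCommGroup Y] [Module (ZMod p) Y]
    [TopologicalSpace Y] [DiscreteTopology Y] {L : MagnusAlgebra p d →ₗ[ZMod p] Y}
    (hL : Continuous L) : ∃ n, filtration p d n ≤ L.ker := by
  obtain ⟨s, u, hu, hs⟩ := isOpen_pi_iff.1 ((isOpen_discrete {(0 : Y)}).preimage hL) 0 (map_zero L)
  refine ⟨s.sup List.length + 1, fun c hc => hs fun w hw => ?_⟩
  rw [mem_filtration.1 hc w (Nat.lt_succ_of_le (Finset.le_sup (f := List.length) hw))]
  exact (hu w hw).2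

end MagnusAlgebra

namespace CompletedGroupAlgebra

variable {p : ℕ} {G : Type*} [Group G] [TopologicalSpace G]

theorem nhds_hasBasis_proj_eq (z : CompletedGroupAlgebra p G) :
    (nhds z).HasBasis (fun _ : OpenNormalSubgroup G => True)
      fun V => {c | proj p V c = proj p V z} := by
  have : Nonempty (OpenNormalSubgroup G) :=
    ⟨{ toSubgroup := ⊤, isOpen' := isOpen_univ, isNormal' := inferInstance }⟩
  have nhds_eq : nhds z = ⨅ V, Filter.principal {c | proj p V c = proj p V z} := by
    refine nhds_iInf.trans (iInf_congr fun V => ?_)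
    rw [nhds_induced, nhds_discrete, Filter.comap_pure]
    rfl
  rw [nhds_eq]
  have subset_of_le : ∀ {U V : OpenNormalSubgroup G}, U ≤ V →
      {c | proj p U c = proj p U z} ⊆ {c | proj p V c = proj p V z} := fun {U V} hUV c hc => by
    change proj p V c = proj p V z
    rw [← mapDomain_proj c hUV, ← mapDomain_proj z hUV]
    exact congrArg _ hc
  exact Filter.hasBasis_iInf_principal fun U V =>
    ⟨U ⊓ V, subset_of_le inf_le_left, subset_of_le inf_le_right⟩

theorem eq_top_of_of_mem {T : Submodule (ZMod p) (CompletedGroupAlgebra p G)}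
    (hT : IsClosed (T : Set (CompletedGroupAlgebra p G))) (h : ∀ g, of p g ∈ T) : T = ⊤ := by
  have map_proj : ∀ (V : OpenNormalSubgroup G) q, q ∈ T.map (proj p V).toLinearMap := by
    intro V q
    induction q using MonoidAlgebra.induction_on with
    | of g =>
      obtain ⟨g, rfl⟩ := QuotientGroup.mk_surjective g
      exact ⟨of p g, h g, proj_of V g⟩
    | add a b ha hb => exact add_mem ha hb
    | smul r a ha => exact Submodule.smul_mem _ r ha
  refine eq_top_iff.2 fun z _ => hT.closure_subset
    ((mem_closure_iff_nhds_basis (nhds_hasBasis_proj_eq z)).2 fun V _ => ?_)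
  obtain ⟨c, hc, hcz⟩ := map_proj V (proj p V z)
  exact ⟨c, hc, hcz⟩

theorem linearMap_ext_of {Y : Type*} [AddCommGroup Y] [Module (ZMod p) Y] [TopologicalSpace Y]
    [T2Space Y] {L L' : CompletedGroupAlgebra p G →ₗ[ZMod p] Y} (hL : Continuous L)
    (hL' : Continuous L') (h : ∀ g, L (of p g) = L' (of p g)) : L = L' :=
  LinearMap.eqLocus_eq_top.1 (eq_top_of_of_mem (T := LinearMap.eqLocus L L')
    (isClosed_eq hL hL') h)

end CompletedGroupAlgebra

open CompletedGroupAlgebra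

namespace IsProP

variable {p : ℕ} {G : Type*} [Group G] [TopologicalSpace G] [IsTopologicalGroup G]
  (hG : IsProP p G)

/-- The continuous functional on `Λ_G` extending a continuous function on `G`; every continuous
functional arises in this way, which identifies `C(G, 𝔽_p)` with the dual of `Λ_G`. -/
def functional : C(G, ZMod p) →ₗ[ZMod p] CompletedGroupAlgebra p G →ₗ[ZMod p] ZMod p where
  toFun f := (exists_linearMap_of_continuous hG f.continuous).choose
  map_add' f f' := by
    have spec (f : C(G, ZMod p)) :=
      (exists_linearMap_of_continuous hG f.continuous).choose_spec
    exact linearMap_ext_of (spec _).1 ((spec f).1.add (spec f').1) fun g => by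
      rw [LinearMap.add_apply, (spec _).2, (spec f).2, (spec f').2, ContinuousMap.add_apply]
  map_smul' r f := by
    have spec (f : C(G, ZMod p)) :=
      (exists_linearMap_of_continuous hG f.continuous).choose_spec
    exact linearMap_ext_of (spec _).1 ((spec f).1.const_smul r) fun g => by
      rw [RingHom.id_apply, LinearMap.smul_apply, (spec _).2, (spec f).2, ContinuousMap.smul_apply]

theorem continuous_functional (f : C(G, ZMod p)) : Continuous (hG.functional f) :=
  (exists_linearMap_of_continuous hG f.continuous).choose_spec.1

theorem functional_of (f : C(G, ZMod p)) (g : G) : hG.functional f (of p g) = f g :=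
  (exists_linearMap_of_continuous hG f.continuous).choose_spec.2 g

theorem functional_of_mul {f f' : C(G, ZMod p)} {g : G} (h : ∀ u, f' u = f (g * u))
    (z : CompletedGroupAlgebra p G) : hG.functional f (of p g * z) = hG.functional f' z := by
  have : (hG.functional f).comp (LinearMap.mulLeft (ZMod p) (of p g)) = hG.functional f' :=
    linearMap_ext_of ((hG.continuous_functional f).comp (continuous_const_mul _))
      (hG.continuous_functional f') fun u => by
        rw [LinearMap.comp_apply, LinearMap.mulLeft_apply, ← of_mul, hG.functional_of,
          hG.functional_of, h]
  exact LinearMap.congr_fun this z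

end IsProP

/-- The map `C(G, 𝔽_p) → C(G, 𝔽_p^d)` with components `f(g π(x_j)) - f(g)`: the dual of the map
`Λ_G^d → Λ_G`, `e_j ↦ π(x_j) - 1`. -/
def generatorMap {p d : ℕ} {F : Type*} [Group F] [TopologicalSpace F] {G : Type*} [Group G]
    [TopologicalSpace G] [IsTopologicalGroup G] (x : Fin d → F) (π : F →ₜ* G) :
    C(G, ZMod p) →ₗ[ZMod p] C(G, Fin d → ZMod p) where
  toFun f := ⟨fun g j => f (g * π (x j)) - f g, by fun_prop⟩
  map_add' f f' := by
    ext g j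
    exact add_sub_add_comm _ _ _ _
  map_smul' r f := by
    ext g j
    exact (smul_sub r _ _).symm

theorem generatorMap_apply {p d : ℕ} {F : Type*} [Group F] [TopologicalSpace F] {G : Type*}
    [Group G] [TopologicalSpace G] [IsTopologicalGroup G] (x : Fin d → F) (π : F →ₜ* G)
    (f : C(G, ZMod p)) (g : G) (j : Fin d) : generatorMap x π f g j = f (g * π (x j)) - f g := rfl

namespace IsFreeProP

variable {p d : ℕ} [Fact p.Prime] {F : Type*} [Group F] [TopologicalSpace F]
  [IsTopologicalGroup F] {x : Fin d → F} (hF : IsFreeProP p x) {G : Type*} [Group G]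
  [TopologicalSpace G] [IsTopologicalGroup G] {π : F →ₜ* G}

include hF in
theorem eq_of_generatorMap_eq_zero (hπ : Function.Surjective π) {f : C(G, ZMod p)}
    (hf : generatorMap x π f = 0) (g : G) : f g = f 1 := by
  let H : Subgroup F :=
    { carrier := {y | ∀ g, f (g * π y) = f g}
      one_mem' := fun g => by rw [map_one π, mul_one]
      mul_mem' := fun {y z} hy hz g => by rw [map_mul π, ← mul_assoc, hz, hy]
      inv_mem' := fun {y} hy g => by rw [← hy, map_inv π, inv_mul_cancel_right] }
  have isClosed_H : IsClosed (H : Set F) := by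
    have : (H : Set F) = ⋂ g, {y | f (g * π y) = f g} := by
      ext y
      rw [Set.mem_iInter]
      rfl
    rw [this]
    exact isClosed_iInter fun g => isClosed_eq
      (f.continuous.comp (continuous_const.mul π.continuous_toFun)) continuous_const
  have H_eq_top : H = ⊤ := hF.eq_top_of_isClosed isClosed_H fun j g =>
    sub_eq_zero.1 (congrFun (DFunLike.congr_fun hf g) j)
  obtain ⟨y, rfl⟩ := hπ g
  have hy : y ∈ H := H_eq_top ▸ Subgroup.mem_top y
  rw [← hy 1, one_mul]

variable (hG : IsProP p G)

theorem functional_toCompleted {f : C(G, ZMod p)} {L : MagnusAlgebra p d →ₗ[ZMod p] ZMod p}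
    (hL : Continuous L) (h : ∀ y, f (π y) = L (hF.magnus y)) (c : MagnusAlgebra p d) :
    hG.functional f (hF.toCompleted hG π c) = L c := by
  have : (hG.functional f).comp (hF.toCompleted hG π).toLinearMap = L :=
    hF.linearMap_ext_magnus
      ((hG.continuous_functional f).comp (hF.continuous_toCompleted hG π)) hL fun y => by
        rw [LinearMap.comp_apply, AlgHom.toLinearMap_apply, hF.toCompleted_magnus,
          hG.functional_of, h]
  exact LinearMap.congr_fun this c

theorem exists_continuousMap (hπ : Function.Surjective π)
    {L : MagnusAlgebra p d →ₗ[ZMod p] ZMod p} (hL : Continuous L)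
    (hker : ∀ c, hF.toCompleted hG π c = 0 → L c = 0) :
    ∃ f : C(G, ZMod p), ∀ y, f (π y) = L (hF.magnus y) := by
  let f : G → ZMod p := fun g => L (hF.magnus (Function.surjInv hπ g))
  have f_apply : ∀ y, f (π y) = L (hF.magnus y) := fun y => by
    rw [← sub_eq_zero, ← map_sub]
    refine hker _ ?_
    rw [map_sub, hF.toCompleted_magnus, hF.toCompleted_magnus, Function.surjInv_eq hπ, sub_self]
  refine ⟨⟨f, (hF.toIsProP.isQuotientMap hG hπ).continuous_iff.2 ?_⟩, f_apply⟩
  exact (hL.comp hF.continuous_magnus).congr fun y => (f_apply y).symm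

/-- The functional `a ↦ ∑ f_j(∂_j a)` attached to a function `f` with values in `𝔽_p^d`, the
`f_j` being extended to `Λ_G`. It is a primitive of `f`, see `potential_mul_X`. -/
def potential (π : F →ₜ* G) (f : C(G, Fin d → ZMod p)) : MagnusAlgebra p d →ₗ[ZMod p] ZMod p :=
  ∑ j, ((hG.functional ((ContinuousMap.eval j).comp f)).comp
    (hF.toCompleted hG π).toLinearMap).comp (deriv j)

theorem potential_apply (f : C(G, Fin d → ZMod p)) (a : MagnusAlgebra p d) :
    hF.potential hG π f a =
      ∑ j, hG.functional ((ContinuousMap.eval j).comp f) (hF.toCompleted hG π (deriv j a)) := by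
  simp only [potential, LinearMap.sum_apply, LinearMap.comp_apply, AlgHom.toLinearMap_apply]

theorem continuous_potential (f : C(G, Fin d → ZMod p)) : Continuous (hF.potential hG π f) := by
  refine Continuous.congr (continuous_finsetSum _ fun j _ => ?_)
    fun a => (hF.potential_apply hG f a).symm
  exact (hG.continuous_functional _).comp
    ((hF.continuous_toCompleted hG π).comp (continuous_deriv j))

theorem potential_mul_X (f : C(G, Fin d → ZMod p)) (a : MagnusAlgebra p d) (j : Fin d) :
    hF.potential hG π f (a * X j) =
      hG.functional ((ContinuousMap.eval j).comp f) (hF.toCompleted hG π a) := by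
  rw [potential_apply, Finset.sum_eq_single_of_mem j (Finset.mem_univ j)]
  · rw [deriv_mul_X, if_pos rfl]
  · intro k _ hk
    rw [deriv_mul_X, if_neg hk, map_zero, map_zero]

theorem potential_eq {f : C(G, Fin d → ZMod p)} {L : MagnusAlgebra p d →ₗ[ZMod p] ZMod p}
    (hL : Continuous L) (h : ∀ y j, f (π y) j = L (hF.magnus y * X j)) {a : MagnusAlgebra p d}
    (ha : a [] = 0) : hF.potential hG π f a = L a := by
  have functional_eq : ∀ j c, hG.functional ((ContinuousMap.eval j).comp f)
      (hF.toCompleted hG π c) = L (c * X j) := fun j c =>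
    hF.functional_toCompleted hG (L := L.comp (LinearMap.mulRight (ZMod p) (X j)))
      (hL.comp (continuous_mul_const _)) (fun y => h y j) c
  simp only [potential_apply, functional_eq]
  rw [← map_sum, ← eq_sum_deriv_mul_X ha]

theorem magnus_mul_X (y : F) (j : Fin d) :
    hF.magnus y * X j = hF.magnus (y * x j) - hF.magnus y := by
  rw [map_mul, hF.magnus_generator, mul_add, mul_one, add_sub_cancel_left]

theorem potential_generatorMap (f : C(G, ZMod p)) {a : MagnusAlgebra p d} (ha : a [] = 0) :
    hF.potential hG π (generatorMap x π f) a = hG.functional f (hF.toCompleted hG π a) := by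
  refine hF.potential_eq hG
    (L := (hG.functional f).comp (hF.toCompleted hG π).toLinearMap) ?_ (fun y j => ?_) ha
  · exact (hG.continuous_functional f).comp (hF.continuous_toCompleted hG π)
  · rw [hF.magnus_mul_X, LinearMap.comp_apply, AlgHom.toLinearMap_apply, map_sub, map_sub,
      hF.toCompleted_magnus, hF.toCompleted_magnus, hG.functional_of, hG.functional_of,
      map_mul π, generatorMap_apply]

theorem exists_potential_eq (hπ : Function.Surjective π)
    {L : MagnusAlgebra p d →ₗ[ZMod p] ZMod p} (hL : Continuous L)
    (hker : ∀ c, hF.toCompleted hG π c = 0 → ∀ j, L (c * X j) = 0) :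
    ∃ f : C(G, Fin d → ZMod p), ∀ a : MagnusAlgebra p d, a [] = 0 →
      hF.potential hG π f a = L a := by
  choose f hf using fun j : Fin d => hF.exists_continuousMap hG hπ
    (L := L.comp (LinearMap.mulRight (ZMod p) (X j))) (hL.comp (continuous_mul_const _))
    fun c hc => hker c hc j
  exact ⟨ContinuousMap.pi f, fun a ha => hF.potential_eq hG hL (fun y j => hf j y) ha⟩

theorem exists_generatorMap_eq (hπ : Function.Surjective π) {f : C(G, Fin d → ZMod p)}
    (hf : ∀ c, hF.toCompleted hG π c = 0 → hF.potential hG π f c = 0) :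
    ∃ f₀, generatorMap x π f₀ = f := by
  obtain ⟨f₀, hf₀⟩ := hF.exists_continuousMap hG hπ (hF.continuous_potential hG f) hf
  refine ⟨f₀, ?_⟩
  ext g j
  obtain ⟨y, rfl⟩ := hπ g
  rw [generatorMap_apply, ← map_mul π, hf₀, hf₀, ← map_sub, ← hF.magnus_mul_X, potential_mul_X,
    hF.toCompleted_magnus, hG.functional_of]
  rfl

end IsFreeProP

/-! ### The cohomological dimension -/

namespace FreeRelators

open MagnusAlgebra CompletedGroupAlgebra

local instance {p : ℕ} {I : Type*} : TopologicalSpace (I →₀ ZMod p) := ⊥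

local instance {p : ℕ} {I : Type*} : DiscreteTopology (I →₀ ZMod p) := ⟨rfl⟩

local instance {p : ℕ} {I : Type*} : ContinuousSMul (ZMod p) (I →₀ ZMod p) :=
  ⟨continuous_of_discreteTopology⟩

section Jacobian

variable {p d : ℕ} [Fact p.Prime] {I : Type*} (S : FreeRelators p d I)
  {F : Type*} [Group F] [TopologicalSpace F] [IsTopologicalGroup F] {x : Fin d → F}
  (hF : IsFreeProP p x) {G : Type*} [Group G] [TopologicalSpace G] [IsTopologicalGroup G]
  (hG : IsProP p G) {π : F →ₜ* G}

theorem exists_support_subset {Y : Type*} [TopologicalSpace Y] [CompactSpace Y]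
    (h : C(Y, I →₀ ZMod p)) : ∃ s : Finset I, ∀ y, (h y).support ⊆ s := by
  classical
  have finite_range : (Set.range h).Finite := (isCompact_range h.continuous).finite_of_discrete
  exact ⟨finite_range.toFinset.biUnion Finsupp.support, fun y =>
    Finset.subset_biUnion_of_mem Finsupp.support ((Set.Finite.mem_toFinset _).2 ⟨y, rfl⟩)⟩

/-- The value at `g ∈ G` of the `i`-th component of the map `C(G, 𝔽_p^d) → C(G, 𝔽_p^{(I)})` dual
to the map `Λ_G^I → Λ_G^d` given by the Jacobian `(∂_j f_i)` of the relators. -/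
def jacobianCoeff (π : F →ₜ* G) (f : C(G, Fin d → ZMod p)) (g : G) (i : I) : ZMod p :=
  ∑ j, hG.functional ((ContinuousMap.eval j).comp f)
    (of p g * hF.toCompleted hG π (deriv j (S.rel i)))

theorem jacobianCoeff_map (f : C(G, Fin d → ZMod p)) (y : F) (i : I) :
    S.jacobianCoeff hF hG π f (π y) i = hF.potential hG π f (hF.magnus y * S.rel i) := by
  simp only [hF.potential_apply, deriv_mul _ _ (S.rel_nil i), map_mul, hF.toCompleted_magnus]
  rfl

section

variable (hπ : Function.Surjective π)

include hπ

theorem finite_jacobianCoeff (f : C(G, Fin d → ZMod p)) :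
    {i | ∃ g, S.jacobianCoeff hF hG π f g i ≠ 0}.Finite := by
  obtain ⟨n, hn⟩ := exists_filtration_le_ker (hF.continuous_potential hG (π := π) f)
  refine (S.finite_length_lead_le n).subset ?_
  rintro i ⟨g, hg⟩
  by_contra hi
  obtain ⟨y, rfl⟩ := hπ g
  have magnus_mem : hF.magnus y ∈ filtration p d 0 := mem_filtration.2 fun w hw =>
    absurd hw (Nat.not_lt_zero _)
  have mul_mem := mul_mem_filtration magnus_mem (S.rel_mem_filtration (not_le.1 hi).le)
  rw [zero_add] at mul_mem
  exact hg ((S.jacobianCoeff_map hF hG f y i).trans (hn mul_mem))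

theorem continuous_jacobianCoeff (f : C(G, Fin d → ZMod p)) (i : I) :
    Continuous fun g => S.jacobianCoeff hF hG π f g i := by
  refine (hF.toIsProP.isQuotientMap hG hπ).continuous_iff.2
    (Continuous.congr ?_ fun y => (S.jacobianCoeff_map hF hG f y i).symm)
  exact (hF.continuous_potential hG f).comp (hF.continuous_magnus.mul continuous_const)

end

variable (hπ : Function.Surjective π)

/-- The values of `jacobianCoeff`, as finitely supported families. -/
def jacobian (f : C(G, Fin d → ZMod p)) (g : G) : I →₀ ZMod p :=
  Finsupp.ofSupportFinite (S.jacobianCoeff hF hG π f g)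
    ((S.finite_jacobianCoeff hF hG hπ f).subset fun _ hi => ⟨g, hi⟩)

theorem jacobian_apply (f : C(G, Fin d → ZMod p)) (g : G) (i : I) :
    S.jacobian hF hG hπ f g i = S.jacobianCoeff hF hG π f g i := rfl

theorem continuous_jacobian (f : C(G, Fin d → ZMod p)) :
    Continuous (S.jacobian hF hG hπ f) := by
  classical
  let s := (S.finite_jacobianCoeff hF hG hπ f).toFinset
  have sum_single : ∀ g, ∑ i ∈ s, Finsupp.single i (S.jacobianCoeff hF hG π f g i) =
      S.jacobian hF hG hπ f g := fun g => by
    have support_subset : (S.jacobian hF hG hπ f g).support ⊆ s := fun i hi =>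
      (Set.Finite.mem_toFinset _).2 ⟨g, Finsupp.mem_support_iff.1 hi⟩
    exact (Finset.sum_subset support_subset fun i _ hi => by
      rw [← S.jacobian_apply hF hG hπ, Finsupp.notMem_support_iff.1 hi,
        Finsupp.single_zero]).symm.trans (Finsupp.sum_single _)
  refine Continuous.congr (continuous_finsetSum _ fun i _ => ?_) sum_single
  exact (continuous_of_discreteTopology (f := Finsupp.single (M := ZMod p) i)).comp
    (S.continuous_jacobianCoeff hF hG hπ f i)

/-- The map `C(G, 𝔽_p^d) → C(G, 𝔽_p^{(I)})` given by the Jacobian of the relators. -/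
def relatorMap : C(G, Fin d → ZMod p) →ₗ[ZMod p] C(G, I →₀ ZMod p) where
  toFun f := ⟨S.jacobian hF hG hπ f, S.continuous_jacobian hF hG hπ f⟩
  map_add' f f' := by
    ext g i
    have comp_add : ∀ j : Fin d, (ContinuousMap.eval j).comp (f + f') =
        (ContinuousMap.eval j).comp f + (ContinuousMap.eval j).comp f' := fun _ => rfl
    simp only [ContinuousMap.add_apply, Finsupp.add_apply, ContinuousMap.coe_mk, jacobian_apply,
      jacobianCoeff, comp_add, map_add, LinearMap.add_apply, Finset.sum_add_distrib]
  map_smul' r f := by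
    ext g i
    have comp_smul : ∀ j : Fin d, (ContinuousMap.eval j).comp (r • f) =
        r • (ContinuousMap.eval j).comp f := fun _ => rfl
    simp only [ContinuousMap.smul_apply, Finsupp.smul_apply, ContinuousMap.coe_mk, jacobian_apply,
      jacobianCoeff, comp_smul, map_smul, LinearMap.smul_apply, Finset.smul_sum, RingHom.id_apply]

theorem relatorMap_map (f : C(G, Fin d → ZMod p)) (y : F) (i : I) :
    S.relatorMap hF hG hπ f (π y) i = hF.potential hG π f (hF.magnus y * S.rel i) :=
  S.jacobianCoeff_map hF hG f y i

theorem relatorMap_translate (f f' : C(G, Fin d → ZMod p)) (g : G) (h : ∀ u, f' u = f (g * u))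
    (u : G) : S.relatorMap hF hG hπ f' u = S.relatorMap hF hG hπ f (g * u) := by
  ext i
  change S.jacobianCoeff hF hG π f' u i = S.jacobianCoeff hF hG π f (g * u) i
  refine Finset.sum_congr rfl fun j _ => ?_
  rw [of_mul, mul_assoc]
  exact (hG.functional_of_mul (fun v => congrFun (h v) j) _).symm

variable (hker : ∀ c, hF.toCompleted hG π c = 0 ↔ c ∈ S.ideal)

include hker

theorem potential_eq_zero_of_mem {f : C(G, Fin d → ZMod p)} (hf : S.relatorMap hF hG hπ f = 0)
    {a : MagnusAlgebra p d} (ha : a ∈ S.ideal) : hF.potential hG π f a = 0 := by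
  have potential_mul_rel : ∀ a i, hF.potential hG π f (a * S.rel i) = 0 := by
    intro a i
    have : (hF.potential hG π f).comp (LinearMap.mulRight (ZMod p) (S.rel i)) = 0 :=
      hF.linearMap_ext_magnus ((hF.continuous_potential hG f).comp (continuous_mul_const _))
        continuous_const fun y => by
          rw [LinearMap.comp_apply, LinearMap.mulRight_apply, ← S.relatorMap_map hF hG hπ, hf]
          rfl
    exact LinearMap.congr_fun this a
  refine (Submodule.mem_bot (ZMod p)).1 (S.map_mem_of_mem_ideal (hF.potential hG π f)
    (hF.continuous_potential hG f) ⊥ (isClosed_discrete _) (fun u _ i v => ?_) ha)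
  rw [Submodule.mem_bot]
  rcases List.eq_nil_or_concat v with rfl | ⟨v, j, rfl⟩
  · rw [monomial_nil, mul_one, potential_mul_rel]
  · rw [List.concat_eq_append, ← monomial_mul_X, ← mul_assoc, hF.potential_mul_X, (hker _).2
      (S.mul_mem_ideal_right (S.mul_rel_mem_ideal _ i) _), map_zero]

theorem exact_generatorMap_relatorMap :
    Function.Exact (generatorMap x π) (S.relatorMap hF hG hπ) := by
  refine fun f => ⟨fun hf => hF.exists_generatorMap_eq hG hπ fun c hc =>
    S.potential_eq_zero_of_mem hF hG hπ hker hf ((hker c).1 hc), ?_⟩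
  rintro ⟨f, rfl⟩
  ext g i
  obtain ⟨y, rfl⟩ := hπ g
  rw [relatorMap_map, hF.potential_generatorMap hG f (by rw [mul_nil, S.rel_nil, mul_zero]),
    (hker _).2 (S.mul_rel_mem_ideal _ i), map_zero]
  rfl

theorem exists_linearMap_mul_rel (h : C(G, I →₀ ZMod p)) :
    ∃ L : MagnusAlgebra p d →ₗ[ZMod p] ZMod p, Continuous L ∧
      (∀ y i, L (hF.magnus y * S.rel i) = h (π y) i) ∧
      ∀ g ∈ S.ideal, ∀ b : MagnusAlgebra p d, b [] = 0 → L (g * b) = 0 := by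
  classical
  have := hG.compactSpace
  obtain ⟨s, support_subset⟩ := exists_support_subset h
  let component (i : I) : C(G, ZMod p) := ⟨fun g => h g i,
    (continuous_of_discreteTopology (f := fun v : I →₀ ZMod p => v i)).comp h.continuous⟩
  let L : MagnusAlgebra p d →ₗ[ZMod p] ZMod p :=
    ∑ i ∈ s, (hG.functional (component i)).comp (S.completedCoeff hF hG π i)
  have L_apply : ∀ c, L c = ∑ i ∈ s, hG.functional (component i) (S.completedCoeff hF hG π i c) :=
    fun c => LinearMap.sum_apply _ _ _
  refine ⟨L, ?_, fun y i => ?_, fun g hg b hb => ?_⟩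
  · refine Continuous.congr (continuous_finsetSum s fun i _ => ?_) fun c => (L_apply c).symm
    exact (hG.continuous_functional (component i)).comp (S.continuous_completedCoeff hF hG i)
  · have functional_coeff : ∀ k, hG.functional (component k)
        (S.completedCoeff hF hG π k (hF.magnus y * S.rel i)) = if k = i then h (π y) k else 0 := by
      intro k
      rw [S.completedCoeff_mul_rel hF hG hker]
      split_ifs
      · rw [hF.toCompleted_magnus, hG.functional_of]
        rfl
      · exact map_zero _
    simp only [L_apply, functional_coeff, Finset.sum_ite_eq']
    split_ifs with hi
    · rfl
    · exact (Finsupp.notMem_support_iff.1 fun h => hi (support_subset _ h)).symm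
  · rw [L_apply]
    exact Finset.sum_eq_zero fun i _ => by
      rw [S.completedCoeff_mul_of_mem hF hG hg hb, map_zero]

theorem relatorMap_surjective : Function.Surjective (S.relatorMap hF hG hπ) := by
  intro h
  obtain ⟨L, hL, L_mul_rel, L_ideal_mul⟩ := S.exists_linearMap_mul_rel hF hG hker h
  obtain ⟨f, hf⟩ := hF.exists_potential_eq hG hπ hL fun c hc j =>
    L_ideal_mul c ((hker c).1 hc) (X j) (by simp [X, monomial])
  refine ⟨f, ?_⟩
  ext g i
  obtain ⟨y, rfl⟩ := hπ g
  rw [relatorMap_map, hf _ (by rw [mul_nil, S.rel_nil, mul_zero]), L_mul_rel]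

end Jacobian

/-- The inclusion of the constant functions in `C(G, 𝔽_p)`. -/
def constMap (p : ℕ) (G : Type*) [Group G] [TopologicalSpace G] [IsTopologicalGroup G] :
    TopRep.of (ContRepresentation.trivial (ZMod p) G (ULift (ZMod p))) ⟶
      (TopRep.of (ContRepresentation.trivial (ZMod p) G (ZMod p))).coind₁ :=
  TopRep.ofHom
    { toFun := fun r => ContinuousMap.const G r.down
      map_add' := fun _ _ => rfl
      map_smul' := fun _ _ => rfl
      cont := continuous_of_discreteTopology
      isIntertwining' := fun _ => rfl }

theorem cohomologicalDimension_le_two {p d : ℕ} [Fact p.Prime] {I : Type}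
    (S : FreeRelators p d I) {F : Type*} [Group F] [TopologicalSpace F] [IsTopologicalGroup F]
    {x : Fin d → F} (hF : IsFreeProP p x) {G : Type*} [Group G] [TopologicalSpace G]
    [IsTopologicalGroup G] (hG : IsProP p G) {π : F →ₜ* G} (hπ : Function.Surjective π)
    (hker : ∀ c, hF.toCompleted hG π c = 0 ↔ c ∈ S.ideal) : cohomologicalDimension p G ≤ 2 := by
  have := hG.compactSpace
  let b := coindHomOfTranslation (generatorMap (p := p) x π) fun f f' g h u => funext fun j => by
    rw [generatorMap_apply, generatorMap_apply, h, h, mul_assoc]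
  let c := coindHomOfTranslation (S.relatorMap hF hG hπ) (S.relatorMap_translate hF hG hπ)
  have const_injective : Function.Injective (constMap p G).hom := fun r s h =>
    ULift.down_injective (DFunLike.congr_fun (F := C(G, ZMod p)) h 1)
  have exact_const_b : Function.Exact (constMap p G).hom b.hom := fun f => by
    refine ⟨fun hf => ⟨⟨(f : C(G, ZMod p)) 1⟩, ContinuousMap.ext fun g =>
      (hF.eq_of_generatorMap_eq_zero hπ hf g).symm⟩, ?_⟩
    rintro ⟨r, rfl⟩
    exact ContinuousMap.ext fun _ => funext fun _ => sub_self r.down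
  have exact_b_c : Function.Exact b.hom c.hom := S.exact_generatorMap_relatorMap hF hG hπ hker
  have := isSmoothRep_coind₁ (TopRep.of (ContRepresentation.trivial (ZMod p) G (ZMod p)))
  have := isSmoothRep_coind₁ (TopRep.of (ContRepresentation.trivial (ZMod p) G (Fin d → ZMod p)))
  have := isSmoothRep_coind₁ (TopRep.of (ContRepresentation.trivial (ZMod p) G (I →₀ ZMod p)))
  exact cohomologicalDimension_le_two_of_cochainExact <| CochainExact.of_exact
    (CochainExact.coind₁ _) (CochainExact.coind₁ _) (CochainExact.coind₁ _) const_injective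
    exact_const_b exact_b_c (S.relatorMap_surjective hF hG hπ hker)

end FreeRelators

namespace IsFreeProP

variable {p d : ℕ} [Fact p.Prime] {F : Type*} [Group F] [TopologicalSpace F]
  [IsTopologicalGroup F] {x : Fin d → F} (hF : IsFreeProP p x)

/-- The relators `ρ_i - 1` of a presentation whose highest terms are combinatorially free. -/
def freeRelators {I : Type*} {ρ : I → F} {α : I → List (Fin d)}
    (hα : ∀ i, (hF.magnus (ρ i) - 1).IsHighestTerm (α i)) (hfree : CombinatoriallyFree α) :
    FreeRelators p d I where
  lead := α
  rel i := hF.magnus (ρ i) - 1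
  isHighestTerm := hα
  lead_ne_nil i h := (hα i).1 (h ▸ hF.magnus_sub_one_nil (ρ i))
  free := hfree

theorem cohomologicalDimension_le_two {G : Type*} [Group G] [TopologicalSpace G]
    [IsTopologicalGroup G] (hG : IsProP p G) {π : F →ₜ* G} (hπ : Function.Surjective π)
    {I : Type*} {ρ : I → (π : F →* G).ker} (hρ : GeneratesRelationModule p ρ)
    {α : I → List (Fin d)} (hα : ∀ i, (hF.magnus (ρ i) - 1).IsHighestTerm (α i))
    (hfree : CombinatoriallyFree α) : cohomologicalDimension p G ≤ 2 := by
  -- The coefficients `𝔽_p^{(I)}` must live in `Type`, so `I` is replaced by the set of words `α_i`.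
  let e : Set.range α ≃ I := (Equiv.ofInjective α hfree.injective).symm
  let S := hF.freeRelators (ρ := fun j => ρ (e j)) (fun j => hα (e j)) (hfree.comp e.injective)
  exact S.cohomologicalDimension_le_two hF hG hπ fun c =>
    S.toCompleted_eq_zero_iff hF hG hπ (fun _ => rfl) (hρ.comp e.surjective)

theorem setOf_degree_eq {I : Type*} {ρ : I → F} {α : I → List (Fin d)}
    (hα : ∀ i, (hF.magnus (ρ i) - 1).IsHighestTerm (α i)) (n : ℕ) :
    {i | hF.degree (ρ i) = n} = {i | (α i).length = n} := by
  ext i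
  rw [Set.mem_ofPred_eq, Set.mem_ofPred_eq, degree, (hα i).valuation_eq, Nat.cast_inj]

end IsFreeProP

end

theorem mainTheorem2_general {p : ℕ} [Fact p.Prime] {d : ℕ}
    {F : Type*} [Group F] [TopologicalSpace F] [IsTopologicalGroup F]
    {G : Type*} [Group G] [TopologicalSpace G] [IsTopologicalGroup G]
    (hG : IsProP p G)
    (x : Fin d → F) (hF : IsFreeProP p x)
    (π : F →ₜ* G) (hπ : Function.Surjective π)
    {I : Type*} (ρ : I → (π : F →* G).ker)
    (hρ : GeneratesRelationModule p ρ)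
    (α : I → List (Fin d))
    (hα : ∀ i, (hF.magnus (ρ i) - 1).IsHighestTerm (α i))
    (hfree : CombinatoriallyFree α) :
    (∃ _ : Module (CompletedGroupAlgebra p G) (RelationModule p (π : F →* G).ker),
      (Continuous fun c : CompletedGroupAlgebra p G × RelationModule p (π : F →* G).ker =>
        c.1 • c.2) ∧
      (∀ (y : F) (r : (π : F →* G).ker),
        CompletedGroupAlgebra.of p (π y) • RelationModule.mk p r =
          RelationModule.mk p (MulAut.conjNormal y r)) ∧
      Nonempty (RelationModule p (π : F →* G).ker ≃L[CompletedGroupAlgebra p G]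
        (I → CompletedGroupAlgebra p G))) ∧
    cohomologicalDimension p G ≤ 2 ∧
    (∀ n, Module.Finite (ZMod p) (gradedPiece hF π n)) ∧
    (∀ n : ℕ, {i | hF.degree (ρ i) = n}.Finite) ∧
    poincareSeries hF π * (1 - PowerSeries.C (d : ℤ) * PowerSeries.X +
      PowerSeries.mk fun n : ℕ => ({i | hF.degree (ρ i) = n}.ncard : ℤ)) = 1 := by
  let S := hF.freeRelators hα hfree
  have mem_ideal_iff (c : MagnusAlgebra p d) : hF.toCompleted hG π c = 0 ↔ c ∈ S.ideal :=
    S.toCompleted_eq_zero_iff hF hG hπ (fun _ => rfl) hρ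
  have magnus_sub_one_mem : ∀ r ∈ (π : F →* G).ker, hF.magnus r - 1 ∈ S.ideal :=
    fun _ => S.magnus_sub_one_mem_ideal hF (fun _ => rfl) hρ
  refine ⟨S.exists_module_continuousLinearEquiv hF hG magnus_sub_one_mem mem_ideal_iff
      (fun _ => rfl) hπ hρ, hF.cohomologicalDimension_le_two hG hπ hρ hα hfree,
    S.finite_gradedPiece hF hG mem_ideal_iff, fun n => ?_, ?_⟩
  · rw [hF.setOf_degree_eq hα]
    exact hfree.finite_length_eq n
  · simp only [hF.setOf_degree_eq hα]
    exact S.poincareSeries_mul hF hG mem_ideal_iff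

theorem mainTheorem2 {p : ℕ} [Fact p.Prime] {d : ℕ}
    {F : Type*} [Group F] [TopologicalSpace F] [IsTopologicalGroup F]
    {G : Type*} [Group G] [TopologicalSpace G] [IsTopologicalGroup G]
    (hG : IsProP p G)
    -- a minimal presentation `1 → R → F → G → 1`, with `R = ker π`
    (x : Fin d → F) (hF : IsFreeProP p x)
    (π : F →ₜ* G) (hπ : Function.Surjective π) (hd : d = pRank p G)
    -- a family of topological generators of the `Λ_G`-module `R / R^p[R,R]`
    {I : Type*} (ρ : I → (π : F →* G).ker)
    (hρ : Dense (AddSubgroup.closure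
      {m | ∃ (y : F) (i : I), m = RelationModule.mk p (MulAut.conjNormal y (ρ i))} :
        Set (RelationModule p (π : F →* G).ker)))
    -- the highest terms of the relations
    (α : I → List (Fin d))
    (hα : ∀ i, (hF.magnus (ρ i) - 1).IsHighestTerm (α i))
    (hfree : CombinatoriallyFree α) :
    -- `R / R^p[R,R] ≃ ∏_I Λ_G` as topological `Λ_G`-modules, where `Λ_G` acts through the
    -- continuous extension of the conjugation action of `G`
    (∃ _ : Module (CompletedGroupAlgebra p G) (RelationModule p (π : F →* G).ker),
      (Continuous fun c : CompletedGroupAlgebra p G × RelationModule p (π : F →* G).ker =>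
        c.1 • c.2) ∧
      (∀ (y : F) (r : (π : F →* G).ker),
        CompletedGroupAlgebra.of p (π y) • RelationModule.mk p r =
          RelationModule.mk p (MulAut.conjNormal y r)) ∧
      Nonempty (RelationModule p (π : F →* G).ker ≃L[CompletedGroupAlgebra p G]
        (I → CompletedGroupAlgebra p G))) ∧
    cohomologicalDimension p G ≤ 2 ∧
    -- the Poincaré series is the inverse of `1 - d t + ∑_i t ^ deg ρ_i`
    (∀ n, Module.Finite (ZMod p) (gradedPiece hF π n)) ∧
    (∀ n : ℕ, {i | hF.degree (ρ i) = n}.Finite) ∧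
    poincareSeries hF π * (1 - PowerSeries.C (d : ℤ) * PowerSeries.X +
      PowerSeries.mk fun n : ℕ => ({i | hF.degree (ρ i) = n}.ncard : ℤ)) = 1 := by
  exact mainTheorem2_general hG x hF π hπ ρ hρ α hα hfree
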